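/- All graphs are finite, simple and undirected. A graph is $2$-connected if it has at least three vertices, is connected, and remains connected after deleting any one vertex. An edge-coloured path is rainbow if its edges have pairwise distinct colours. For a $2$-connected graph $G$, let $rc_2(G)$ be the minimum number of colours in a (not necessarily proper) edge-colouring of $G$ in which any two distinct vertices are joined by two distinct internally vertex-disjoint rainbow paths. Let $t_2(n,r)$ be the minimum number of edges of a $2$-connected graph $G$ on $n$ vertices with $rc_2(G)\le r$; such graphs exist, so $t_2(n,r)$ is well-defined, for all $n\ge 4$ and $r\ge 2$. Then: (a) $t_2(n,2)=(1+o(1))\,n\log_2 n$ as $n\to\infty$. (b) $t_2(n,r)\ge \frac43 n-24$ if $r\in\{3,4\}$ and $n\ge 18$; and $t_2(n,r)\ge \frac65 n-\frac15 r(r-1)$ if $5\le r\le n-1$ and $n>\frac16 r(r-1)$. (c) $t_2(n,r)\le \frac52 n-5$ if $r\in\{3,4\}$ and $n\ge r+1$; $t_2(n,5)\le \frac{7n-19}{3}$ if $n\ge 7$; and $t_2(n,r)\le 2n-r+2$ if $6\le r\le n-3$. (d) $t_2(n,n-2)=n+2$ for $n\ge 6$, and $t_2(n,n-1)=n+1$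 for $n\ge 4$. -/

import Mathlib

namespace RainbowConnection

/-- `G` is `k`-connected: it has more than `k` vertices, and deleting fewer than `k` vertices
always leaves a connected graph. -/
def IsKConnected {V : Type*} [Fintype V] (G : SimpleGraph V) (k : ℕ) : Prop :=
  k < Fintype.card V ∧ ∀ S : Finset V, S.card < k → (G.induce {v | v ∉ S}).Connected

/-- A walk is rainbow for the edge-colouring `c` if no two distinct edges of it have the same
colour. (It is only used for paths, which never repeat an edge.) -/
def IsRainbow {V K : Type*} {G : SimpleGraph V} (c : G.EdgeLabeling K) {u v : V}
    (p : G.Walk u v) : Prop :=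
  ∀ e f : G.edgeSet, (e : Sym2 V) ∈ p.edges → (f : Sym2 V) ∈ p.edges → c e = c f → e = f

/-- The edge-colouring `c` is rainbow `k`-connected: any two distinct vertices are joined by `k`
distinct, pairwise internally vertex-disjoint rainbow paths. -/
def IsRainbowKConnected {V K : Type*} {G : SimpleGraph V} (c : G.EdgeLabeling K) (k : ℕ) : Prop :=
  ∀ u v : V, u ≠ v → ∃ P : Fin k → G.Walk u v,
    (∀ i, (P i).IsPath ∧ IsRainbow c (P i)) ∧
    ∀ i j, i ≠ j → P i ≠ P j ∧ ∀ w, w ∈ (P i).support → w ∈ (P j).support → w = u ∨ w = v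

/-- The rainbow `k`-connection number: the least number of colours in a rainbow `k`-connected
edge-colouring of `G` (and `⊤` if `G` has no such colouring). -/
noncomputable def rc {V : Type*} (k : ℕ) (G : SimpleGraph V) : ℕ∞ :=
  sInf {x : ℕ∞ | ∃ r : ℕ, x = r ∧ ∃ c : G.EdgeLabeling (Fin r), IsRainbowKConnected c k}

/-- The numbers of edges of the `k`-connected graphs on `n` vertices with `rc k G ≤ r`. -/
def edgeCounts (k n r : ℕ) : Set ℕ :=
  {e | ∃ G : SimpleGraph (Fin n), IsKConnected G k ∧ rc k G ≤ r ∧ G.edgeSet.ncard = e}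

/-- The least number of edges of a `k`-connected graph on `n` vertices with `rc k G ≤ r`
(meaningful when `edgeCounts k n r` is nonempty). -/
noncomputable def t (k n r : ℕ) : ℕ := sInf (edgeCounts k n r)

end RainbowConnection

/-! Upper bounds come from explicit colourings, lower bounds from what vertices of small degree
force.

Upper bounds in (c) and (d): copies of a small unit are glued to a base with two hubs. Two vertices
lie in the base and at most two copies, so checking one and two copies settles every number of
copies (`glue_linked`); optional base vertices of degree two adjust the residue of n. Further
colours are absorbed by a chain between two vertices: m + 1 new vertices, m new colours and m + 2
edges (`attach_linked`). Chains on a triangle and on K4 minus an edge give the values in (d).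

(a), upper bound: p + 1 vertices stand for the coordinates of binary words of length p with a parity
bit, where p is about log n. Every other vertex is a word, joined to each coordinate in the colour
of its entry. Distinct words differ in two coordinates, which yields two rainbow paths
(`codeGraph_linked`). Lower bound: with two colours any two vertices have a common neighbour seen in
different colours. For a random f prescribing a colour at each high-degree vertex, call a low-degree
vertex a survivor if all its edges to high-degree vertices have the prescribed colours. Two
survivors can be joined only through a low-degree vertex, so there are few. Averaging over f shows
that few low-degree vertices have at most T high-degree neighbours (`card_low_le`), and all other
low-degree vertices contribute T + 1 edges each.

(b) and the lower bounds in (d) rest on one fact: a path through a vertex of degree two uses both of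
its edges. Hence an edge between two vertices of degree two is determined by an ordered pair of
distinct colours (`inner_edge_eq`), so there are at most r(r - 1) of them, and counting degrees
gives the bound for r ≥ 5. With four colours rainbow paths have length at most four. This makes
cherries (vertices of degree three with two neighbours of degree two) with equal colours lie close
together, so cherries are few and a weighted degree count gives 4n/3. For (d), a graph with at most
n + 1 edges has at most two vertices of degree above two, and then so many edges must have distinct
colours that the colours run out. -/

namespace RainbowConnection

/-! ### Coloured graphs as colour functions, rainbow paths as vertex lists -/

/-- An edge-coloured graph, given by the colour of each pair of vertices, where `none` means
that the pair is not an edge. -/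
structure ColoredGraph (V K : Type*) where
  col : V → V → Option K
  symm : ∀ u v, col u v = col v u
  irrefl : ∀ u, col u u = none

namespace ColoredGraph

variable {V W K L : Type*}

/-- The underlying simple graph. -/
def toGraph (C : ColoredGraph V K) : SimpleGraph V where
  Adj u v := C.col u v ≠ none
  symm := ⟨fun u v h => by rwa [C.symm v u]⟩
  loopless := ⟨fun u h => h (C.irrefl u)⟩

/-- The colour of an unordered pair. -/
def symCol (C : ColoredGraph V K) : Sym2 V → Option K := Sym2.lift ⟨C.col, C.symm⟩

theorem symCol_ne_none (C : ColoredGraph V K) (e : C.toGraph.edgeSet) : C.symCol e ≠ none := by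
  obtain ⟨e, he⟩ := e
  induction e with
  | h u v => exact he

/-- The edge-colouring of the underlying graph. -/
def labeling (C : ColoredGraph V K) : C.toGraph.EdgeLabeling K := fun e =>
  (C.symCol e).get (Option.isSome_iff_ne_none.2 (C.symCol_ne_none e))

theorem some_labeling (C : ColoredGraph V K) (e : C.toGraph.edgeSet) :
    some (C.labeling e) = C.symCol e := by
  simp [labeling]

/-- The colours of the consecutive pairs of a list of vertices. -/
def edgeCols (C : ColoredGraph V K) (l : List V) : List (Option K) := List.zipWith C.col l l.tail

@[simp] theorem edgeCols_singleton (C : ColoredGraph V K) (u : V) : C.edgeCols [u] = [] := rfl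

@[simp] theorem edgeCols_cons_cons (C : ColoredGraph V K) (u v : V) (l : List V) :
    C.edgeCols (u :: v :: l) = C.col u v :: C.edgeCols (v :: l) := rfl

theorem edgeCols_append (C : ColoredGraph V K) (l₁ : List V) (x : V) (l₂ : List V) :
    C.edgeCols (l₁ ++ x :: l₂) = C.edgeCols (l₁ ++ [x]) ++ C.edgeCols (x :: l₂) := by
  induction l₁ with
  | nil => rfl
  | cons a l₁ ih => cases l₁ <;> simp_all

theorem edgeCols_reverse (C : ColoredGraph V K) (l : List V) :
    C.edgeCols l.reverse = (C.edgeCols l).reverse := by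
  induction l with
  | nil => rfl
  | cons a l ih =>
    cases l with
    | nil => rfl
    | cons b l =>
      rw [List.reverse_cons, List.reverse_cons, List.append_assoc, List.singleton_append,
        edgeCols_append, ← List.reverse_cons, ih]
      simp [C.symm b a]

/-- The list `l` is the vertex sequence of a rainbow path from `u` to `v`. -/
def IsRainbowPath (C : ColoredGraph V K) (u v : V) (l : List V) : Prop :=
  l.head? = some u ∧ l.getLast? = some v ∧ l.Nodup ∧ (C.edgeCols l).Nodup ∧ none ∉ C.edgeCols l

instance [DecidableEq V] [DecidableEq K] (C : ColoredGraph V K) (u v : V) (l : List V) :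
    Decidable (C.IsRainbowPath u v l) := by unfold IsRainbowPath; infer_instance

/-- The vertices `u` and `v` are joined by two internally disjoint rainbow paths. -/
def Linked (C : ColoredGraph V K) (u v : V) : Prop :=
  ∃ l₁ l₂ : List V, C.IsRainbowPath u v l₁ ∧ C.IsRainbowPath u v l₂ ∧ l₁ ≠ l₂ ∧
    ∀ w ∈ l₁, w ∈ l₂ → w = u ∨ w = v

theorem isRainbowPath_reverse (C : ColoredGraph V K) {u v : V} {l : List V}
    (h : C.IsRainbowPath u v l) : C.IsRainbowPath v u l.reverse := by
  obtain ⟨h1, h2, h3, h4, h5⟩ := h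
  refine ⟨by simpa using h2, by simpa using h1, by simpa using h3, ?_, ?_⟩ <;>
    rw [edgeCols_reverse] <;> simpa

theorem Linked.symm {C : ColoredGraph V K} {u v : V} (h : C.Linked u v) : C.Linked v u := by
  obtain ⟨l₁, l₂, h₁, h₂, hne, hd⟩ := h
  refine ⟨l₁.reverse, l₂.reverse, C.isRainbowPath_reverse h₁, C.isRainbowPath_reverse h₂,
    by simpa using hne, fun w hw₁ hw₂ => ?_⟩
  simp only [List.mem_reverse] at hw₁ hw₂
  exact (hd w hw₁ hw₂).symm

/-- Rainbow paths are preserved by injective maps that preserve the colours of edges. -/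
theorem IsRainbowPath.map {C : ColoredGraph V K} {D : ColoredGraph W L} {f : V → W} {g : K → L}
    (hf : Function.Injective f) (hg : Function.Injective g)
    (hcol : ∀ u v, C.col u v ≠ none → D.col (f u) (f v) = (C.col u v).map g) {u v : V}
    {l : List V} (h : C.IsRainbowPath u v l) : D.IsRainbowPath (f u) (f v) (l.map f) ∧
      D.edgeCols (l.map f) = (C.edgeCols l).map (Option.map g) := by
  obtain ⟨h1, h2, h3, h4, h5⟩ := h
  have key : D.edgeCols (l.map f) = (C.edgeCols l).map (Option.map g) := by
    clear h1 h2 h3 h4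
    induction l with
    | nil => rfl
    | cons a l ih =>
      cases l with
      | nil => rfl
      | cons b l =>
        simp only [edgeCols_cons_cons, List.mem_cons, not_or] at h5
        simp only [List.map_cons, edgeCols_cons_cons]
        rw [hcol a b (Ne.symm h5.1)]
        congr 1
        exact ih h5.2
  refine ⟨⟨by simp [h1], by simp [h2], h3.map hf, ?_, ?_⟩, key⟩
  · rw [key]; exact h4.map (Option.map_injective hg)
  · rw [key]; simpa using h5

theorem Linked.map {C : ColoredGraph V K} {D : ColoredGraph W L} {f : V → W} {g : K → L}
    (hf : Function.Injective f) (hg : Function.Injective g)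
    (hcol : ∀ u v, C.col u v ≠ none → D.col (f u) (f v) = (C.col u v).map g) {u v : V}
    (h : C.Linked u v) : D.Linked (f u) (f v) := by
  obtain ⟨l₁, l₂, h₁, h₂, hne, hd⟩ := h
  refine ⟨l₁.map f, l₂.map f, (h₁.map hf hg hcol).1, (h₂.map hf hg hcol).1,
    fun h => hne (List.map_injective_iff.2 hf h), ?_⟩
  intro w hw₁ hw₂
  obtain ⟨x, hx, rfl⟩ := List.mem_map.1 hw₁
  obtain ⟨y, hy, hxy⟩ := List.mem_map.1 hw₂
  obtain rfl := hf hxy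
  exact (hd y hx hy).imp (congrArg f) (congrArg f)

theorem isChain_of_none_notMem (C : ColoredGraph V K) {l : List V} (h : none ∉ C.edgeCols l) :
    l.IsChain C.toGraph.Adj := by
  induction l with
  | nil => exact .nil
  | cons a l ih =>
    cases l with
    | nil => exact .singleton a
    | cons b l =>
      simp only [edgeCols_cons_cons, List.mem_cons, not_or] at h
      exact .cons_cons (Ne.symm h.1) (ih h.2)

theorem map_symCol_edges (C : ColoredGraph V K) {u v : V} (p : C.toGraph.Walk u v) :
    p.edges.map C.symCol = C.edgeCols p.support := by
  rw [SimpleGraph.Walk.edges_eq_zipWith_support, List.map_zipWith]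
  rfl

theorem IsRainbowPath.exists_walk {C : ColoredGraph V K} {u v : V} {l : List V}
    (h : C.IsRainbowPath u v l) :
    ∃ p : C.toGraph.Walk u v, p.support = l ∧ p.IsPath ∧ IsRainbow C.labeling p := by
  obtain ⟨h1, h2, h3, h4, h5⟩ := h
  have hne : l ≠ [] := by rintro rfl; simp at h1
  have hu : l.head hne = u := by
    rw [List.head?_eq_some_head hne] at h1; exact Option.some_injective _ h1
  have hv : l.getLast hne = v := by
    rw [List.getLast?_eq_some_getLast hne] at h2; exact Option.some_injective _ h2
  subst hu hv
  refine ⟨SimpleGraph.Walk.ofSupport l hne (C.isChain_of_none_notMem h5),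
    SimpleGraph.Walk.support_ofSupport _ _, ?_, ?_⟩
  · rw [SimpleGraph.Walk.isPath_def, SimpleGraph.Walk.support_ofSupport]; exact h3
  · intro e f he hf hef
    have hn : ((SimpleGraph.Walk.ofSupport l hne (C.isChain_of_none_notMem h5)).edges.map
        C.symCol).Nodup := by
      rw [map_symCol_edges, SimpleGraph.Walk.support_ofSupport]; exact h4
    apply Subtype.ext
    apply List.inj_on_of_nodup_map hn he hf
    rw [← some_labeling, ← some_labeling, hef]

theorem isRainbowKConnected_of_linked (C : ColoredGraph V K)
    (h : ∀ u v, u ≠ v → C.Linked u v) : IsRainbowKConnected C.labeling 2 := by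
  intro u v huv
  obtain ⟨l₁, l₂, h₁, h₂, hne, hd⟩ := h u v huv
  obtain ⟨p, rfl, hp⟩ := h₁.exists_walk
  obtain ⟨q, rfl, hq⟩ := h₂.exists_walk
  have hpq : p ≠ q := fun h => hne (by rw [h])
  refine ⟨![p, q], ?_, ?_⟩
  · intro i; fin_cases i
    · exact hp
    · exact hq
  · intro i j hij
    fin_cases i <;> fin_cases j
    · exact absurd rfl hij
    · exact ⟨hpq, hd⟩
    · exact ⟨hpq.symm, fun w h1 h2 => hd w h2 h1⟩
    · exact absurd rfl hij

end ColoredGraph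

/-! ### Passing between colourings, `rc` and `edgeCounts` -/

/-- A graph on at least three vertices with a rainbow `2`-connected colouring is `2`-connected. -/
theorem IsRainbowKConnected.isKConnected {V K : Type*} [Fintype V] {G : SimpleGraph V}
    {c : G.EdgeLabeling K} (h : IsRainbowKConnected c 2) (hV : 2 < Fintype.card V) :
    IsKConnected G 2 := by
  classical
  refine ⟨hV, fun S hS => ?_⟩
  have hne : Nonempty {v | v ∉ S} := by
    by_contra hcon
    have : S = Finset.univ := by
      ext x; by_contra hx
      exact hcon ⟨⟨x, by simpa using hx⟩⟩
    rw [this, Finset.card_univ] at hS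
    omega
  refine { preconnected := ?_, nonempty := hne }
  rintro ⟨u, hu⟩ ⟨v, hv⟩
  by_cases huv : u = v
  · subst huv; rfl
  obtain ⟨P, -, hP⟩ := h u v huv
  -- At most one vertex is deleted, and it cannot be an inner vertex of both paths.
  have : ∃ i, ∀ w ∈ (P i).support, w ∈ {v | v ∉ S} := by
    by_contra! hcon
    obtain ⟨x, hx, hxS⟩ := hcon 0
    obtain ⟨y, hy, hyS⟩ := hcon 1
    have hxS' : x ∈ S := by simpa using hxS
    have hyS' : y ∈ S := by simpa using hyS
    have hxy : x = y := Finset.card_le_one.1 (by omega) _ hxS' _ hyS'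
    subst hxy
    rcases (hP 0 1 (by decide)).2 x hx hy with rfl | rfl
    · exact hu hxS'
    · exact hv hxS'
  obtain ⟨i, hi⟩ := this
  exact ⟨(P i).induce _ hi⟩

theorem rc_le_of_isRainbowKConnected {V : Type*} {G : SimpleGraph V} {k r : ℕ}
    (c : G.EdgeLabeling (Fin r)) (h : IsRainbowKConnected c k) : rc k G ≤ r :=
  sInf_le ⟨r, rfl, c, h⟩

theorem exists_isRainbowKConnected_of_rc_le {V : Type*} {G : SimpleGraph V} {k r : ℕ}
    (h : rc k G ≤ r) : ∃ c : G.EdgeLabeling (Fin r), IsRainbowKConnected c k := by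
  -- The infimum of the empty set is `⊤`, which exceeds `r`; so the set is nonempty and its infimum
  -- is attained.
  have hne : {x : ℕ∞ | ∃ r : ℕ, x = r ∧
      ∃ c : G.EdgeLabeling (Fin r), IsRainbowKConnected c k}.Nonempty := by
    by_contra hcon
    rw [Set.not_nonempty_iff_eq_empty] at hcon
    rw [rc, hcon, sInf_empty] at h
    exact absurd h (by simp)
  obtain ⟨s, hs, c, hc⟩ := csInf_mem hne
  have hsr : s ≤ r := by
    rw [rc, hs] at h; exact_mod_cast h
  refine ⟨fun e => Fin.castLE hsr (c e), fun u v huv => ?_⟩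
  obtain ⟨P, hP, hP'⟩ := hc u v huv
  refine ⟨P, fun i => ⟨(hP i).1, fun e f he hf hef => ?_⟩, hP'⟩
  exact (hP i).2 e f he hf (Fin.castLE_injective hsr hef)

theorem edgeCounts_mono {k n r s : ℕ} (hrs : r ≤ s) : edgeCounts k n r ⊆ edgeCounts k n s := by
  rintro e ⟨G, h1, h2, h3⟩
  exact ⟨G, h1, h2.trans (by exact_mod_cast hrs), h3⟩

/-- A rainbow `2`-connected coloured graph yields a member of `edgeCounts`. -/
theorem ColoredGraph.ncard_mem_edgeCounts {V K : Type*} [Fintype V] [Fintype K] {n r : ℕ}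
    (C : ColoredGraph V K) (hn : Fintype.card V = n) (hr : Fintype.card K = r) (h3 : 3 ≤ n)
    (h : ∀ u v, u ≠ v → C.Linked u v) : C.toGraph.edgeSet.ncard ∈ edgeCounts 2 n r := by
  let φ : V ≃ Fin n := Fintype.equivFinOfCardEq hn
  let γ : K ≃ Fin r := Fintype.equivFinOfCardEq hr
  let D : ColoredGraph (Fin n) (Fin r) :=
    { col := fun u v => (C.col (φ.symm u) (φ.symm v)).map γ
      symm := fun u v => by rw [C.symm]
      irrefl := fun u => by rw [C.irrefl]; rfl }
  have hD : ∀ u v, u ≠ v → D.Linked u v := by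
    intro u v huv
    have := (h (φ.symm u) (φ.symm v) (by simpa using huv)).map (D := D) (f := φ) (g := γ)
      φ.injective γ.injective (by intro a b _; simp [D])
    simpa using this
  have hR := D.isRainbowKConnected_of_linked hD
  refine ⟨D.toGraph, hR.isKConnected (by rw [Fintype.card_fin]; omega),
    rc_le_of_isRainbowKConnected _ hR, ?_⟩
  let ψ : D.toGraph ≃g C.toGraph :=
    { toEquiv := φ.symm, map_rel_iff' := by intro a b; simp [toGraph, D] }
  exact Nat.card_congr ψ.mapEdgeSet

theorem t_le_of_linked {V K : Type*} [Fintype V] [Fintype K] {n r e : ℕ} (C : ColoredGraph V K)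
    (hn : Fintype.card V = n) (hr : Fintype.card K = r) (h3 : 3 ≤ n)
    (h : ∀ u v, u ≠ v → C.Linked u v) (he : C.toGraph.edgeSet.ncard ≤ e) : t 2 n r ≤ e :=
  (Nat.sInf_le (C.ncard_mem_edgeCounts hn hr h3 h)).trans he

namespace ColoredGraph
variable {V K : Type*}

/-- The coloured graph of an edge-colouring. -/
noncomputable def ofLabeling {G : SimpleGraph V} (c : G.EdgeLabeling K) : ColoredGraph V K := by
  classical
  exact
  { col := fun u v => if h : G.Adj u v then some (c.get u v h) else none
    symm := fun u v => by
      by_cases h : G.Adj u v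
      · simp [h, h.symm, c.get_comm v u h]
      · have h' : ¬ G.Adj v u := fun h' => h h'.symm
        simp [h, h']
    irrefl := fun u => by simp }

theorem ofLabeling_col_of_adj {G : SimpleGraph V} (c : G.EdgeLabeling K) {u v : V}
    (h : G.Adj u v) : (ofLabeling c).col u v = some (c.get u v h) := by
  simp [ofLabeling, h]

theorem ofLabeling_col_ne_none {G : SimpleGraph V} (c : G.EdgeLabeling K) {u v : V} :
    (ofLabeling c).col u v ≠ none ↔ G.Adj u v := by
  simp [ofLabeling]

theorem toGraph_ofLabeling {G : SimpleGraph V} (c : G.EdgeLabeling K) :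
    (ofLabeling c).toGraph = G := by
  ext u v
  exact ofLabeling_col_ne_none c

theorem symCol_ofLabeling {G : SimpleGraph V} (c : G.EdgeLabeling K) {e : Sym2 V}
    (he : e ∈ G.edgeSet) : (ofLabeling c).symCol e = some (c ⟨e, he⟩) := by
  induction e with
  | h x y => exact ofLabeling_col_of_adj c he

theorem isRainbowPath_support {G : SimpleGraph V} (c : G.EdgeLabeling K) {u v : V}
    {p : G.Walk u v} (hp : p.IsPath) (hr : IsRainbow c p) :
    (ofLabeling c).IsRainbowPath u v p.support := by
  have key : (ofLabeling c).edgeCols p.support = p.edges.map (ofLabeling c).symCol := by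
    rw [SimpleGraph.Walk.edges_eq_zipWith_support, List.map_zipWith]; rfl
  refine ⟨?_, ?_, hp.support_nodup, ?_, ?_⟩
  · rw [List.head?_eq_some_head p.support_ne_nil, p.head_support]
  · rw [List.getLast?_eq_some_getLast p.support_ne_nil, p.getLast_support]
  · rw [key]
    refine List.Nodup.map_on ?_ hp.isTrail.edges_nodup
    intro e he f hf hef
    rw [symCol_ofLabeling c (p.edges_subset_edgeSet he),
      symCol_ofLabeling c (p.edges_subset_edgeSet hf)] at hef
    exact congrArg Subtype.val (hr _ _ he hf (Option.some_injective _ hef))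
  · rw [key]
    intro h
    obtain ⟨e, he, h⟩ := List.mem_map.1 h
    rw [symCol_ofLabeling c (p.edges_subset_edgeSet he)] at h
    exact absurd h (by simp)

theorem linked_ofLabeling {G : SimpleGraph V} {c : G.EdgeLabeling K}
    (h : IsRainbowKConnected c 2) {u v : V} (huv : u ≠ v) : (ofLabeling c).Linked u v := by
  obtain ⟨P, hP, hP'⟩ := h u v huv
  refine ⟨(P 0).support, (P 1).support, isRainbowPath_support c (hP 0).1 (hP 0).2,
    isRainbowPath_support c (hP 1).1 (hP 1).2, fun h => ?_, (hP' 0 1 (by decide)).2⟩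
  exact (hP' 0 1 (by decide)).1 (SimpleGraph.Walk.ext_support h)

end ColoredGraph
end RainbowConnection

namespace RainbowConnection
namespace ColoredGraph

variable {V K B S : Type*}

/-! ### Searching for rainbow paths -/

/-- The vertex sequences of the rainbow paths of length at most `n` that start at `x`, avoid the
vertices `vis` and the colours `cols`, and use only vertices of `vs`. -/
def rainbowLists [DecidableEq V] [DecidableEq K] (C : ColoredGraph V K) (vs : List V) :
    ℕ → V → List V → List K → List (List V)
  | 0, x, _, _ => [[x]]
  | n + 1, x, vis, cols => [x] :: vs.flatMap fun y =>
      match C.col x y with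
      | none => []
      | some c => if c ∈ cols then [] else if y ∈ vis then [] else
          (C.rainbowLists vs n y (y :: vis) (c :: cols)).map (x :: ·)

/-- A search for two internally disjoint rainbow paths between all pairs from `vs`. -/
def linkedCheck [DecidableEq V] [DecidableEq K] (C : ColoredGraph V K) (vs : List V) (n : ℕ) :
    Bool :=
  vs.all fun u =>
    let P := C.rainbowLists vs n u [u] []
    vs.all fun v => u = v || (
      let Q := P.filter fun l => l.getLast? = some v
      Q.any fun l₁ => Q.any fun l₂ => (l₁ ≠ l₂ : Bool) &&
        (l₁.all fun w => !(l₂.contains w) || w = u || w = v) &&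
        (C.IsRainbowPath u v l₁ : Bool) && (C.IsRainbowPath u v l₂ : Bool))

/-- The check re-tests every path that it finds with `IsRainbowPath`, so soundness needs no property
of `rainbowLists`. -/
theorem linked_of_linkedCheck [DecidableEq V] [DecidableEq K] {C : ColoredGraph V K} {vs : List V}
    {n : ℕ} (h : C.linkedCheck vs n = true) {u v : V} (hu : u ∈ vs) (hv : v ∈ vs) (huv : u ≠ v) :
    C.Linked u v := by
  simp only [linkedCheck, List.all_eq_true] at h
  have h' := h u hu v hv
  simp only [huv, decide_false, Bool.false_or, List.any_eq_true] at h'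
  obtain ⟨l₁, -, l₂, -, h'⟩ := h'
  simp only [Bool.and_eq_true, decide_eq_true_eq] at h'
  obtain ⟨⟨⟨hne, hd⟩, h1⟩, h2⟩ := h'
  refine ⟨l₁, l₂, h1, h2, hne, fun w hw hw' => ?_⟩
  have := List.all_eq_true.1 hd w hw
  simpa [hw'] using this

/-! ### Gluing copies of a unit to a base -/

/-- The colour of a pair in a list of coloured edges between vertices given by codes. -/
def lookup (E : List (ℕ × ℕ × K)) (x y : ℕ) : Option K :=
  if x = y then none else
    (E.find? fun e => (e.1 == x && e.2.1 == y) || (e.1 == y && e.2.1 == x)).map (·.2.2)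

/-- The coloured graph given by a list of edges, where vertices are represented by codes. -/
def ofList (code : V → ℕ) (E : List (ℕ × ℕ × K)) : ColoredGraph V K where
  col u v := lookup E (code u) (code v)
  symm u v := by
    unfold lookup
    simp only [eq_comm (a := code u)]
    congr 3
    funext e
    rw [Bool.or_comm]
  irrefl u := by simp [lookup]

/-- The vertices of the unit get codes from `10` on. -/
def code {b s : ℕ} : Fin b ⊕ Fin s → ℕ := Sum.elim (fun x => x) (fun x => 10 + x)

/-- `k` copies of the part `S` of a coloured graph on `B ⊕ S`, all attached to `B`. -/
def glue (C : ColoredGraph (B ⊕ S) K) (k : ℕ) : ColoredGraph (B ⊕ Fin k × S) K where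
  col u v := match u, v with
    | .inl x, .inl y => C.col (.inl x) (.inl y)
    | .inl x, .inr (_, y) => C.col (.inl x) (.inr y)
    | .inr (_, x), .inl y => C.col (.inr x) (.inl y)
    | .inr (i, x), .inr (j, y) => if i = j then C.col (.inr x) (.inr y) else none
  symm u v := by
    rcases u with x | ⟨i, x⟩ <;> rcases v with y | ⟨j, y⟩ <;> simp only [C.symm, eq_comm]
  irrefl u := by rcases u with x | ⟨i, x⟩ <;> simp [C.irrefl]

/-- The inclusion of a glued graph into one with more copies. -/
def glueMap {k m : ℕ} (f : Fin k → Fin m) : B ⊕ Fin k × S → B ⊕ Fin m × S :=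
  Sum.map id (Prod.map f id)

theorem glueMap_injective {k m : ℕ} {f : Fin k → Fin m} (hf : Function.Injective f) :
    Function.Injective (glueMap (B := B) (S := S) f) :=
  Sum.map_injective.2 ⟨Function.injective_id, hf.prodMap Function.injective_id⟩

theorem glue_col_glueMap (C : ColoredGraph (B ⊕ S) K) {k m : ℕ} {f : Fin k → Fin m}
    (hf : Function.Injective f) (u v : B ⊕ Fin k × S) :
    (C.glue m).col (glueMap f u) (glueMap f v) = ((C.glue k).col u v).map id := by
  rcases u with x | ⟨i, x⟩ <;> rcases v with y | ⟨j, y⟩ <;> simp [glueMap, glue, hf.eq_iff]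

theorem exists_glueMap_eq {k : ℕ} (i : Fin k) {u : B ⊕ Fin k × S}
    (hu : ∀ j x, u = .inr (j, x) → j = i) : ∃ u' : B ⊕ Fin 1 × S, glueMap (fun _ => i) u' = u := by
  rcases u with x | ⟨j, x⟩
  · exact ⟨.inl x, rfl⟩
  · obtain rfl := hu j x rfl
    exact ⟨.inr (0, x), rfl⟩

/-- Two vertices meet at most two copies, so two copies already contain them. -/
theorem exists_glueMap_pair {k : ℕ} (hk : 2 ≤ k) (u v : B ⊕ Fin k × S) :
    ∃ f : Fin 2 → Fin k, Function.Injective f ∧ ∃ u' v', glueMap f u' = u ∧ glueMap f v' = v := by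
  have aux : ∀ i : Fin k, ∃ j, j ≠ i := fun i => by
    have : Nontrivial (Fin k) := Fin.nontrivial_iff_two_le.2 hk
    exact exists_ne i
  have inj : ∀ i j : Fin k, j ≠ i → Function.Injective ![i, j] := by
    intro i j hij a b hab
    fin_cases a <;> fin_cases b <;> simp_all
  rcases u with x | ⟨i, x⟩ <;> rcases v with y | ⟨j, y⟩
  · obtain ⟨j, hj⟩ := aux ⟨0, by omega⟩
    exact ⟨_, inj _ _ hj, .inl x, .inl y, rfl, rfl⟩
  · obtain ⟨l, hl⟩ := aux j
    exact ⟨_, inj _ _ hl, .inl x, .inr (0, y), rfl, rfl⟩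
  · obtain ⟨l, hl⟩ := aux i
    exact ⟨_, inj _ _ hl, .inr (0, x), .inl y, rfl, rfl⟩
  · by_cases hij : j = i
    · obtain ⟨l, hl⟩ := aux i
      exact ⟨_, inj _ _ hl, .inr (0, x), .inr (0, y), rfl, by subst hij; rfl⟩
    · exact ⟨_, inj _ _ hij, .inr (0, x), .inr (1, y), rfl, rfl⟩

/-- If one and two copies of the unit give a rainbow `2`-connected colouring, then so does any
positive number of copies. -/
theorem glue_linked {C : ColoredGraph (B ⊕ S) K} (h1 : ∀ u v, u ≠ v → (C.glue 1).Linked u v)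
    (h2 : ∀ u v, u ≠ v → (C.glue 2).Linked u v) {k : ℕ} (hk : 1 ≤ k) {u v : B ⊕ Fin k × S}
    (huv : u ≠ v) : (C.glue k).Linked u v := by
  obtain rfl | hk := hk.eq_or_lt
  · exact h1 u v huv
  · obtain ⟨f, hf, u', v', rfl, rfl⟩ := exists_glueMap_pair hk u v
    exact (h2 u' v' fun h => huv (by rw [h])).map (glueMap_injective hf) Function.injective_id
      fun a b _ => C.glue_col_glueMap hf a b

/-! ### Counting the edges of a glued graph -/

/-- The indicator of adjacency. -/
def edgeInd (C : ColoredGraph V K) (u v : V) : ℕ := if (C.col u v).isSome then 1 else 0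

theorem edgeInd_comm (C : ColoredGraph V K) (u v : V) : C.edgeInd u v = C.edgeInd v u := by
  unfold edgeInd; rw [C.symm]

/-- The number of ordered pairs of adjacent vertices is twice the number of edges. -/
theorem two_mul_ncard_edgeSet [Fintype V] (C : ColoredGraph V K) :
    2 * C.toGraph.edgeSet.ncard = ∑ u, ∑ v, C.edgeInd u v := by
  classical
  rw [← SimpleGraph.coe_edgeFinset, Set.ncard_coe_finset,
    ← SimpleGraph.sum_degrees_eq_twice_card_edges]
  refine Finset.sum_congr rfl fun u _ => ?_
  unfold edgeInd
  rw [← SimpleGraph.card_neighborFinset_eq_degree, ← Finset.card_filter]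
  congr 1
  ext v
  rw [SimpleGraph.mem_neighborFinset, Finset.mem_filter, Option.isSome_iff_ne_none]
  exact ⟨fun h => ⟨Finset.mem_univ v, h⟩, fun h => h.2⟩

theorem two_mul_ncard_edgeSet_glue [Fintype B] [Fintype S] (C : ColoredGraph (B ⊕ S) K) (k : ℕ) :
    2 * (C.glue k).toGraph.edgeSet.ncard = (∑ x, ∑ y, C.edgeInd (.inl x) (.inl y)) +
      k * (2 * (∑ x, ∑ y, C.edgeInd (.inl x) (.inr y)) +
        ∑ x, ∑ y, C.edgeInd (.inr x) (.inr y)) := by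
  rw [two_mul_ncard_edgeSet]
  have h0 : ∀ x y, (C.glue k).edgeInd (.inl x) (.inl y) = C.edgeInd (.inl x) (.inl y) :=
    fun _ _ => rfl
  have h1 : ∀ x i y, (C.glue k).edgeInd (.inr (i, x)) (.inl y) = C.edgeInd (.inl y) (.inr x) :=
    fun _ _ _ => C.edgeInd_comm _ _
  have h1' : ∀ x i y, (C.glue k).edgeInd (.inl x) (.inr (i, y)) = C.edgeInd (.inl x) (.inr y) :=
    fun _ _ _ => rfl
  have h2 : ∀ (i : Fin k) (x : S), ∑ j : Fin k, ∑ y, (C.glue k).edgeInd (.inr (i, x))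
      (.inr (j, y)) = ∑ y, C.edgeInd (.inr x) (.inr y) := by
    intro i x
    rw [Finset.sum_eq_single i]
    · simp [glue, edgeInd]
    · intro j _ hj; simp [glue, hj.symm, edgeInd]
    · simp
  simp only [Fintype.sum_sum_type, Fintype.sum_prod_type, h2, Finset.sum_add_distrib, h0, h1, h1',
    Finset.sum_const, Finset.card_univ, Fintype.card_fin, smul_eq_mul, ← Finset.mul_sum]
  rw [Finset.sum_comm (f := fun x y => C.edgeInd (.inl y) (.inr x))]
  ring

end ColoredGraph
end RainbowConnection

/-! ### Concatenation of rainbow paths; fans, bridges and chains -/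

namespace RainbowConnection
namespace ColoredGraph

variable {V W K L : Type*}

theorem IsRainbowPath.trans {C : ColoredGraph V K} {u x v : V} {l₁ l₂ : List V}
    (h₁ : C.IsRainbowPath u x l₁) (h₂ : C.IsRainbowPath x v l₂)
    (hd : ∀ w ∈ l₁, w ∈ l₂ → w = x) (hc : ∀ c ∈ C.edgeCols l₁, c ∉ C.edgeCols l₂) :
    C.IsRainbowPath u v (l₁ ++ l₂.tail) ∧
      C.edgeCols (l₁ ++ l₂.tail) = C.edgeCols l₁ ++ C.edgeCols l₂ := by
  obtain ⟨a1, a2, a3, a4, a5⟩ := h₁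
  obtain ⟨b1, b2, b3, b4, b5⟩ := h₂
  obtain ⟨t, rfl⟩ : ∃ t, l₂ = x :: t := by
    cases l₂ with
    | nil => simp at b1
    | cons y t => simp at b1; exact ⟨t, by rw [b1]⟩
  obtain ⟨s, rfl⟩ : ∃ s, l₁ = s ++ [x] := List.getLast?_eq_some_iff.1 a2
  have hcol : C.edgeCols (s ++ [x] ++ t) = C.edgeCols (s ++ [x]) ++ C.edgeCols (x :: t) := by
    rw [List.append_assoc, List.singleton_append, edgeCols_append]
  simp only [List.tail_cons]
  refine ⟨⟨?_, ?_, ?_, ?_, ?_⟩, hcol⟩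
  · cases s <;> simpa using a1
  · rw [List.append_assoc, List.singleton_append, List.getLast?_append, b2]; rfl
  · refine List.Nodup.append a3 (List.nodup_cons.1 b3).2 fun w hw hw' => ?_
    obtain rfl := hd w hw (List.mem_cons_of_mem _ hw')
    exact (List.nodup_cons.1 b3).1 hw'
  · rw [hcol]; exact List.Nodup.append a4 b4 fun c hc1 hc2 => hc c hc1 hc2
  · rw [hcol]; simpa using ⟨a5, b5⟩

theorem IsRainbowPath.left_mem {C : ColoredGraph V K} {u v : V} {l : List V}
    (h : C.IsRainbowPath u v l) : u ∈ l := List.mem_of_mem_head? h.1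

theorem IsRainbowPath.right_mem {C : ColoredGraph V K} {u v : V} {l : List V}
    (h : C.IsRainbowPath u v l) : v ∈ l := List.mem_of_getLast? h.2.1

/-- There are rainbow paths from `h₀` and `h₁` to `v` that share only `v`, the first avoiding the
colour `A` and the second avoiding the colour `B`. -/
def Fan (C : ColoredGraph V K) (h₀ h₁ : V) (A B : K) (v : V) : Prop :=
  ∃ l₀ l₁ : List V, C.IsRainbowPath h₀ v l₀ ∧ C.IsRainbowPath h₁ v l₁ ∧
    some A ∉ C.edgeCols l₀ ∧ some B ∉ C.edgeCols l₁ ∧ ∀ w ∈ l₀, w ∈ l₁ → w = v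

/-- There is a rainbow path from `h₀` to `h₁` avoiding the colours `A` and `B`. -/
def Bridge (C : ColoredGraph V K) (h₀ h₁ : V) (A B : K) : Prop :=
  ∃ l : List V, C.IsRainbowPath h₀ h₁ l ∧ some A ∉ C.edgeCols l ∧ some B ∉ C.edgeCols l

theorem Fan.map {C : ColoredGraph V K} {D : ColoredGraph W K} {f : V → W}
    (hf : Function.Injective f) (hcol : ∀ u v, C.col u v ≠ none → D.col (f u) (f v) = C.col u v)
    {h₀ h₁ v : V} {A B : K} (h : C.Fan h₀ h₁ A B v) : D.Fan (f h₀) (f h₁) A B (f v) := by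
  obtain ⟨l₀, l₁, a, b, c, d, e⟩ := h
  have ha := a.map (D := D) hf (Function.injective_id (α := K))
    fun u v h => by rw [hcol u v h]; simp
  have hb := b.map (D := D) hf (Function.injective_id (α := K))
    fun u v h => by rw [hcol u v h]; simp
  refine ⟨_, _, ha.1, hb.1, by rw [ha.2]; simpa using c, by rw [hb.2]; simpa using d, ?_⟩
  intro w hw₁ hw₂
  obtain ⟨x, hx, rfl⟩ := List.mem_map.1 hw₁
  obtain ⟨y, hy, hxy⟩ := List.mem_map.1 hw₂
  obtain rfl := hf hxy
  rw [e y hx hy]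

theorem Bridge.map {C : ColoredGraph V K} {D : ColoredGraph W K} {f : V → W}
    (hf : Function.Injective f) (hcol : ∀ u v, C.col u v ≠ none → D.col (f u) (f v) = C.col u v)
    {h₀ h₁ : V} {A B : K} (h : C.Bridge h₀ h₁ A B) : D.Bridge (f h₀) (f h₁) A B := by
  obtain ⟨l, a, c, d⟩ := h
  have ha := a.map (D := D) hf (Function.injective_id (α := K))
    fun u v h => by rw [hcol u v h]; simp
  exact ⟨_, ha.1, by rw [ha.2]; simpa using c, by rw [ha.2]; simpa using d⟩

/-- A search for the paths required by `Fan` and `Bridge`. -/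
def chainCheck [DecidableEq V] [DecidableEq K] (C : ColoredGraph V K) (vs : List V) (n : ℕ)
    (h₀ h₁ : V) (A B : K) : Bool :=
  let P := C.rainbowLists vs n h₀ [h₀] [A]
  let Q := C.rainbowLists vs n h₁ [h₁] [B]
  (vs.all fun v => P.any fun l₀ => Q.any fun l₁ => l₀.getLast? = some v &&
    l₁.getLast? = some v && (l₀.all fun w => !(l₁.contains w) || w = v) &&
    (some A ∉ C.edgeCols l₀ : Bool) && (some B ∉ C.edgeCols l₁ : Bool) &&
    (C.IsRainbowPath h₀ v l₀ : Bool) && (C.IsRainbowPath h₁ v l₁ : Bool)) &&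
  P.any fun l => (some A ∉ C.edgeCols l : Bool) && (some B ∉ C.edgeCols l : Bool) &&
    (C.IsRainbowPath h₀ h₁ l : Bool)

theorem of_chainCheck [DecidableEq V] [DecidableEq K] {C : ColoredGraph V K} {vs : List V} {n : ℕ}
    {h₀ h₁ : V} {A B : K} (h : C.chainCheck vs n h₀ h₁ A B = true) :
    (∀ v ∈ vs, C.Fan h₀ h₁ A B v) ∧ C.Bridge h₀ h₁ A B := by
  simp only [chainCheck, Bool.and_eq_true, List.all_eq_true (l := vs), List.any_eq_true,
    decide_eq_true_eq] at h
  obtain ⟨h1, l, -, ⟨h2, h3⟩, h4⟩ := h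
  refine ⟨fun v hv => ?_, l, h4, h2, h3⟩
  obtain ⟨l₀, -, l₁, -, ⟨⟨⟨⟨-, hd⟩, ha⟩, hb⟩, hp⟩, hq⟩ := h1 v hv
  refine ⟨l₀, l₁, hp, hq, ha, hb, fun w hw hw' => ?_⟩
  have := List.all_eq_true.1 hd w hw
  simpa [hw'] using this

/-! ### Attaching a chain -/

section Chain

/-- The coloured graph obtained by joining `h₀` and `h₁` by a path with `m + 1` new inner vertices,
whose first and last edges have the colours `A` and `B`, the others having new colours. -/
def attach [DecidableEq V] (C : ColoredGraph V K) (h₀ h₁ : V) (A B : K) (m : ℕ) :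
    ColoredGraph (V ⊕ Fin (m + 1)) (K ⊕ Fin m) where
  col u v := match u, v with
    | .inl u, .inl v => (C.col u v).map .inl
    | .inl u, .inr i | .inr i, .inl u =>
      if u = h₀ ∧ i.val = 0 then some (.inl A)
      else if u = h₁ ∧ i.val = m then some (.inl B) else none
    | .inr i, .inr j =>
      if h : i.val + 1 = j.val then some (.inr ⟨i.val, by omega⟩)
      else if h : j.val + 1 = i.val then some (.inr ⟨j.val, by omega⟩) else none
  symm u v := by
    rcases u with u | i <;> rcases v with v | j <;> simp only [C.symm]
    by_cases h : i.val + 1 = j.val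
    · simp [h]; omega
    · simp [h]
  irrefl u := by rcases u with u | i <;> simp [C.irrefl]

variable (C : ColoredGraph V K) (h₀ h₁ : V) (A B : K) (m : ℕ)

/-- The vertices of the chain, in order, with `h₀` at position `0` and `h₁` at `m + 2`. -/
def chainPos (i : ℕ) : V ⊕ Fin (m + 1) :=
  if i = 0 then .inl h₀ else if h : i ≤ m + 1 then .inr ⟨i - 1, by omega⟩ else .inl h₁

/-- The colours of the edges of the chain, in order. -/
def chainCol (i : ℕ) : K ⊕ Fin m :=
  if h0 : i = 0 then .inl A else if h : i ≤ m then .inr ⟨i - 1, by omega⟩ else .inl B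

variable {h₀ h₁ A B m}

theorem attach_col_chainPos [DecidableEq V] {i : ℕ} (hi : i ≤ m + 1) (h01 : h₀ ≠ h₁) :
    (C.attach h₀ h₁ A B m).col (chainPos h₀ h₁ m i) (chainPos h₀ h₁ m (i + 1)) =
      some (chainCol A B m i) := by
  unfold chainPos chainCol
  rcases Nat.eq_zero_or_pos i with rfl | h0
  · simp [attach]
  · have h0' : i ≠ 0 := by omega
    rcases hi.lt_or_eq with h | rfl
    · have h1 : i ≤ m := by omega
      have h2 : i - 1 + 1 = i := by omega
      simp [attach, h0', h1, h2, Nat.le_succ_of_le h1]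
    · simp [attach, h01.symm]

theorem chainPos_inj (h01 : h₀ ≠ h₁) {i j : ℕ} (hi : i ≤ m + 2) (hj : j ≤ m + 2)
    (h : chainPos h₀ h₁ m i = chainPos h₀ h₁ m j) : i = j := by
  unfold chainPos at h
  have := h01.symm
  split_ifs at h <;> simp_all <;> omega

theorem chainCol_inj (hAB : A ≠ B) {i j : ℕ} (hi : i ≤ m + 1) (hj : j ≤ m + 1)
    (h : chainCol A B m i = chainCol A B m j) : i = j := by
  unfold chainCol at h
  have := hAB.symm
  split_ifs at h <;> simp_all <;> omega

theorem chainPos_of_pos {i : ℕ} (h0 : 1 ≤ i) (hi : i ≤ m + 1) :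
    chainPos h₀ h₁ m i = .inr ⟨i - 1, by omega⟩ := by
  have : i ≠ 0 := by omega
  simp [chainPos, this, hi]

theorem chainPos_succ (i : Fin (m + 1)) : chainPos h₀ h₁ m (i + 1) = .inr i := by
  simp [chainPos, Nat.lt_succ_iff.1 i.2]

theorem chainPos_zero : chainPos h₀ h₁ m 0 = .inl h₀ := by simp [chainPos]

theorem chainPos_last : chainPos h₀ h₁ m (m + 2) = .inl h₁ := by simp [chainPos]

/-- A segment of the chain is a rainbow path. -/
theorem isRainbowPath_segment [DecidableEq V] (h01 : h₀ ≠ h₁) (hAB : A ≠ B) (d : ℕ) {a : ℕ}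
    (hd : a + d ≤ m + 2) :
    (C.attach h₀ h₁ A B m).IsRainbowPath (chainPos h₀ h₁ m a) (chainPos h₀ h₁ m (a + d))
      ((List.range' a (d + 1)).map (chainPos h₀ h₁ m)) ∧
    (C.attach h₀ h₁ A B m).edgeCols ((List.range' a (d + 1)).map (chainPos h₀ h₁ m)) =
      (List.range' a d).map fun i => some (chainCol A B m i) := by
  have key : (C.attach h₀ h₁ A B m).edgeCols ((List.range' a (d + 1)).map (chainPos h₀ h₁ m)) =
      (List.range' a d).map fun i => some (chainCol A B m i) := by
    clear hAB
    induction d generalizing a with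
    | zero => rfl
    | succ d ih =>
      have := ih (a := a + 1) (by omega)
      rw [List.range'_succ, List.range'_succ] at *
      simp only [List.map_cons, edgeCols_cons_cons] at *
      rw [List.range'_succ, List.map_cons, this, C.attach_col_chainPos (by omega) h01]
  refine ⟨⟨by simp [List.range'_succ], ?_, ?_, ?_, ?_⟩, key⟩
  · rw [List.range'_concat]; simp
  · refine List.Nodup.map_on ?_ List.nodup_range'
    intro x hx y hy hxy
    rw [List.mem_range'_1] at hx hy
    exact chainPos_inj h01 (by omega) (by omega) hxy
  · rw [key]
    refine List.Nodup.map_on ?_ List.nodup_range'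
    intro x hx y hy hxy
    rw [List.mem_range'_1] at hx hy
    exact chainCol_inj hAB (by omega) (by omega) (Option.some_injective _ hxy)
  · rw [key]; simp

end Chain
end ColoredGraph
end RainbowConnection

/-! ### Attaching a chain preserves linkedness -/

namespace RainbowConnection
namespace ColoredGraph

variable {V K : Type*} [DecidableEq V] {C : ColoredGraph V K} {h₀ h₁ : V} {A B : K} {m : ℕ}

theorem IsRainbowPath.attach {u v : V} {l : List V} (h : C.IsRainbowPath u v l) :
    (C.attach h₀ h₁ A B m).IsRainbowPath (.inl u) (.inl v) (l.map .inl) ∧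
      (C.attach h₀ h₁ A B m).edgeCols (l.map .inl) = (C.edgeCols l).map (Option.map .inl) :=
  h.map Sum.inl_injective Sum.inl_injective fun _ _ _ => rfl

/-- From an inner vertex of the chain one reaches `v` along both ends of the chain. -/
theorem attach_linked_inr_inl (h01 : h₀ ≠ h₁) (hAB : A ≠ B) {v : V} (hF : C.Fan h₀ h₁ A B v)
    (i : Fin (m + 1)) : (C.attach h₀ h₁ A B m).Linked (.inr i) (.inl v) := by
  obtain ⟨l₀, l₁, a, b, c, d, e⟩ := hF
  have ha := a.attach (h₀ := h₀) (h₁ := h₁) (A := A) (B := B) (m := m)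
  have hb := b.attach (h₀ := h₀) (h₁ := h₁) (A := A) (B := B) (m := m)
  have hL := C.isRainbowPath_segment h01 hAB (m := m) (i + 1) (a := 0) (by omega)
  have hR := C.isRainbowPath_segment h01 hAB (m := m) (m + 1 - i) (a := i + 1) (by omega)
  have hLr := isRainbowPath_reverse _ hL.1
  rw [show (i : ℕ) + 1 + (m + 1 - i) = m + 2 by omega] at hR
  simp only [zero_add, chainPos_succ, chainPos_zero, chainPos_last] at hLr hR
  have memL : ∀ w ∈ ((List.range' 0 (↑i + 1 + 1)).map (chainPos h₀ h₁ m)).reverse,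
      w = .inl h₀ ∨ ∃ j : Fin (m + 1), j ≤ i ∧ w = .inr j := by
    intro w hw
    simp only [List.mem_reverse, List.mem_map, List.mem_range'_1] at hw
    obtain ⟨x, hx, rfl⟩ := hw
    rcases Nat.eq_zero_or_pos x with rfl | h0
    · exact .inl chainPos_zero
    · exact .inr ⟨⟨x - 1, by omega⟩, by rw [Fin.le_def]; simp only; omega,
        chainPos_of_pos h0 (by omega)⟩
  have memR : ∀ w ∈ (List.range' (↑i + 1) (m + 1 - ↑i + 1)).map (chainPos h₀ h₁ m),
      w = .inl h₁ ∨ ∃ j : Fin (m + 1), i ≤ j ∧ w = .inr j := by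
    intro w hw
    simp only [List.mem_map, List.mem_range'_1] at hw
    obtain ⟨x, hx, rfl⟩ := hw
    rcases (show x ≤ m + 2 by omega).lt_or_eq with h0 | rfl
    · exact .inr ⟨⟨x - 1, by omega⟩, by rw [Fin.le_def]; simp only; omega,
        chainPos_of_pos (by omega) (by omega)⟩
    · exact .inl chainPos_last
  -- The only old colour on this part of the chain is `A`, which `l₀` avoids; its other colours are
  -- new. The other end works likewise with `B` and `l₁`.
  have hp := hLr.trans ha.1 (by
    intro w hw hw'
    obtain ⟨x, hx, rfl⟩ := List.mem_map.1 hw'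
    rcases memL _ hw with h | ⟨j, -, h⟩
    · exact h
    · cases h) (by
    intro x hx hx'
    rw [edgeCols_reverse, hL.2, List.mem_reverse] at hx
    rw [ha.2] at hx'
    obtain ⟨y, hy, rfl⟩ := List.mem_map.1 hx
    obtain ⟨z, hz, hyz⟩ := List.mem_map.1 hx'
    rw [List.mem_range'_1] at hy
    unfold chainCol at hyz
    split_ifs at hyz with h1 h2
    · cases z with
      | none => simp at hyz
      | some z => simp only [Option.map_some, Option.some.injEq, Sum.inl.injEq] at hyz
                  subst hyz; exact c hz
    · cases z <;> simp at hyz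
    · omega)
  have hq := hR.1.trans hb.1 (by
    intro w hw hw'
    obtain ⟨x, hx, rfl⟩ := List.mem_map.1 hw'
    rcases memR _ hw with h | ⟨j, -, h⟩
    · exact h
    · cases h) (by
    intro x hx hx'
    rw [hR.2] at hx
    rw [hb.2] at hx'
    obtain ⟨y, hy, rfl⟩ := List.mem_map.1 hx
    obtain ⟨z, hz, hyz⟩ := List.mem_map.1 hx'
    rw [List.mem_range'_1] at hy
    unfold chainCol at hyz
    split_ifs at hyz with h1 h2
    · omega
    · cases z <;> simp at hyz
    · cases z with
      | none => simp at hyz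
      | some z => simp only [Option.map_some, Option.some.injEq, Sum.inl.injEq] at hyz
                  subst hyz; exact d hz)
  have memP : ∀ w ∈ ((List.range' 0 (↑i + 1 + 1)).map (chainPos h₀ h₁ m)).reverse ++
      (l₀.map Sum.inl).tail, (∃ x ∈ l₀, w = .inl x) ∨ ∃ j : Fin (m + 1), j ≤ i ∧ w = .inr j := by
    intro w hw
    rcases List.mem_append.1 hw with h | h
    · rcases memL _ h with h | h
      · exact .inl ⟨h₀, a.left_mem, h⟩
      · exact .inr h
    · obtain ⟨x, hx, rfl⟩ := List.mem_map.1 (List.mem_of_mem_tail h)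
      exact .inl ⟨x, hx, rfl⟩
  have memQ : ∀ w ∈ (List.range' (↑i + 1) (m + 1 - ↑i + 1)).map (chainPos h₀ h₁ m) ++
      (l₁.map Sum.inl).tail, (∃ x ∈ l₁, w = .inl x) ∨ ∃ j : Fin (m + 1), i ≤ j ∧ w = .inr j := by
    intro w hw
    rcases List.mem_append.1 hw with h | h
    · rcases memR _ h with h | h
      · exact .inl ⟨h₁, b.left_mem, h⟩
      · exact .inr h
    · obtain ⟨x, hx, rfl⟩ := List.mem_map.1 (List.mem_of_mem_tail h)
      exact .inl ⟨x, hx, rfl⟩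
  have hdis : ∀ w ∈ ((List.range' 0 (↑i + 1 + 1)).map (chainPos h₀ h₁ m)).reverse ++
      (l₀.map Sum.inl).tail, w ∈ (List.range' (↑i + 1) (m + 1 - ↑i + 1)).map (chainPos h₀ h₁ m) ++
      (l₁.map Sum.inl).tail → w = .inr i ∨ w = .inl v := by
    intro w hw hw'
    rcases memP w hw with ⟨x, hx, rfl⟩ | ⟨j, hj, rfl⟩ <;>
      rcases memQ _ hw' with ⟨y, hy, hxy⟩ | ⟨k, hk, hjk⟩
    · obtain rfl := Sum.inl_injective hxy
      exact .inr (by rw [e x hx hy])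
    · cases hjk
    · cases hxy
    · obtain rfl := Sum.inr_injective hjk
      exact .inl (by rw [le_antisymm hj hk])
  -- If the paths were equal, `h₀` and `h₁` would both be common vertices, hence both equal to `v`.
  refine ⟨_, _, hp.1, hq.1, fun heq => ?_, hdis⟩
  have h0 : (.inl h₀ : V ⊕ Fin (m + 1)) ∈ ((List.range' 0 (↑i + 1 + 1)).map
      (chainPos h₀ h₁ m)).reverse ++ (l₀.map Sum.inl).tail :=
    List.mem_append_left _ hLr.right_mem
  have h1 : (.inl h₁ : V ⊕ Fin (m + 1)) ∈ (List.range' (↑i + 1) (m + 1 - ↑i + 1)).map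
      (chainPos h₀ h₁ m) ++ (l₁.map Sum.inl).tail :=
    List.mem_append_left _ hR.1.right_mem
  rcases hdis _ h0 (heq ▸ h0) with h | h <;> rcases hdis _ (heq ▸ h1) h1 with h' | h'
  · cases h
  · cases h
  · cases h'
  · exact h01 (Sum.inl_injective (h.trans h'.symm))

/-- Two inner vertices of the chain are linked by the two arcs of a cycle. -/
theorem attach_linked_inr_inr (h01 : h₀ ≠ h₁) (hAB : A ≠ B) (hBr : C.Bridge h₀ h₁ A B)
    {i j : Fin (m + 1)} (hij : i < j) : (C.attach h₀ h₁ A B m).Linked (.inr i) (.inr j) := by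
  rw [Fin.lt_def] at hij
  obtain ⟨l, a, c, d⟩ := hBr
  have ha := a.attach (h₀ := h₀) (h₁ := h₁) (A := A) (B := B) (m := m)
  have hL := C.isRainbowPath_segment h01 hAB (m := m) (i + 1) (a := 0) (by omega)
  have hM := C.isRainbowPath_segment h01 hAB (m := m) (j - i) (a := i + 1) (by omega)
  have hR := C.isRainbowPath_segment h01 hAB (m := m) (m + 1 - j) (a := j + 1) (by omega)
  have hLr := isRainbowPath_reverse _ hL.1
  have hRr := isRainbowPath_reverse _ hR.1
  rw [show (j : ℕ) + 1 + (m + 1 - j) = m + 2 by omega] at hRr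
  rw [show (i : ℕ) + 1 + (j - i) = j + 1 by omega] at hM
  simp only [zero_add, chainPos_succ, chainPos_zero, chainPos_last] at hLr hRr hM
  have memL : ∀ w ∈ ((List.range' 0 (↑i + 1 + 1)).map (chainPos h₀ h₁ m)).reverse,
      w = .inl h₀ ∨ ∃ k : Fin (m + 1), k ≤ i ∧ w = .inr k := by
    intro w hw
    simp only [List.mem_reverse, List.mem_map, List.mem_range'_1] at hw
    obtain ⟨x, hx, rfl⟩ := hw
    rcases Nat.eq_zero_or_pos x with rfl | h0
    · exact .inl chainPos_zero
    · exact .inr ⟨⟨x - 1, by omega⟩, by rw [Fin.le_def]; simp only; omega,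
        chainPos_of_pos h0 (by omega)⟩
  have memR : ∀ w ∈ ((List.range' (↑j + 1) (m + 1 - ↑j + 1)).map (chainPos h₀ h₁ m)).reverse,
      w = .inl h₁ ∨ ∃ k : Fin (m + 1), j ≤ k ∧ w = .inr k := by
    intro w hw
    simp only [List.mem_reverse, List.mem_map, List.mem_range'_1] at hw
    obtain ⟨x, hx, rfl⟩ := hw
    rcases (show x ≤ m + 2 by omega).lt_or_eq with h0 | rfl
    · exact .inr ⟨⟨x - 1, by omega⟩, by rw [Fin.le_def]; simp only; omega,
        chainPos_of_pos (by omega) (by omega)⟩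
    · exact .inl chainPos_last
  have memM : ∀ w ∈ (List.range' (↑i + 1) (↑j - ↑i + 1)).map (chainPos h₀ h₁ m),
      ∃ k : Fin (m + 1), i ≤ k ∧ k ≤ j ∧ w = .inr k := by
    intro w hw
    simp only [List.mem_map, List.mem_range'_1] at hw
    obtain ⟨x, hx, rfl⟩ := hw
    exact ⟨⟨x - 1, by omega⟩, by rw [Fin.le_def]; simp only; omega,
      by rw [Fin.le_def]; simp only; omega, chainPos_of_pos (by omega) (by omega)⟩
  have hp := hLr.trans ha.1 (by
    intro w hw hw'
    obtain ⟨x, hx, rfl⟩ := List.mem_map.1 hw'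
    rcases memL _ hw with h | ⟨j, -, h⟩
    · exact h
    · cases h) (by
    intro x hx hx'
    rw [edgeCols_reverse, hL.2, List.mem_reverse] at hx
    rw [ha.2] at hx'
    obtain ⟨y, hy, rfl⟩ := List.mem_map.1 hx
    obtain ⟨z, hz, hyz⟩ := List.mem_map.1 hx'
    rw [List.mem_range'_1] at hy
    unfold chainCol at hyz
    split_ifs at hyz with h1 h2
    · cases z with
      | none => simp at hyz
      | some z => simp only [Option.map_some, Option.some.injEq, Sum.inl.injEq] at hyz
                  subst hyz; exact c hz
    · cases z <;> simp at hyz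
    · omega)
  have memP : ∀ w ∈ ((List.range' 0 (↑i + 1 + 1)).map (chainPos h₀ h₁ m)).reverse ++
      (l.map Sum.inl).tail, (∃ x ∈ l, w = .inl x) ∨ ∃ j : Fin (m + 1), j ≤ i ∧ w = .inr j := by
    intro w hw
    rcases List.mem_append.1 hw with h | h
    · rcases memL _ h with h | h
      · exact .inl ⟨h₀, a.left_mem, h⟩
      · exact .inr h
    · obtain ⟨x, hx, rfl⟩ := List.mem_map.1 (List.mem_of_mem_tail h)
      exact .inl ⟨x, hx, rfl⟩
  -- The long arc runs from `i` back to `h₀`, over the bridge to `h₁`, and back to `j`. Its two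
  -- chain pieces differ in colour by `chainCol_inj`, and the bridge avoids `B`.
  have hq := hp.1.trans hRr (by
    intro w hw hw'
    rcases memP w hw with ⟨x, hx, rfl⟩ | ⟨k, hk, rfl⟩ <;>
      rcases memR _ hw' with h | ⟨k', hk', h⟩
    · exact h
    · cases h
    · cases h
    · obtain rfl := Sum.inr_injective h
      rw [Fin.le_def] at hk hk'; omega) (by
    intro x hx hx'
    rw [hp.2, List.mem_append, edgeCols_reverse, hL.2, ha.2, List.mem_reverse] at hx
    rw [edgeCols_reverse, hR.2, List.mem_reverse] at hx'
    obtain ⟨y, hy, rfl⟩ := List.mem_map.1 hx'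
    rw [List.mem_range'_1] at hy
    rcases hx with hx | hx
    · obtain ⟨z, hz, hyz⟩ := List.mem_map.1 hx
      rw [List.mem_range'_1] at hz
      have := chainCol_inj hAB (by omega) (by omega) (Option.some_injective _ hyz)
      omega
    · obtain ⟨z, hz, hyz⟩ := List.mem_map.1 hx
      unfold chainCol at hyz
      split_ifs at hyz with h1 h2
      · omega
      · cases z <;> simp at hyz
      · cases z with
        | none => simp at hyz
        | some z => simp only [Option.map_some, Option.some.injEq, Sum.inl.injEq] at hyz
                    subst hyz; exact d hz)
  refine ⟨_, _, hM.1, hq.1, fun heq => ?_, ?_⟩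
  · have h0 : (.inl h₀ : V ⊕ Fin (m + 1)) ∈ (List.range' (↑i + 1) (↑j - ↑i + 1)).map
        (chainPos h₀ h₁ m) := by
      rw [heq]
      exact List.mem_append_left _ (List.mem_append_left _ hLr.right_mem)
    obtain ⟨k, -, -, h⟩ := memM _ h0
    cases h
  · intro w hw hw'
    obtain ⟨k, hik, hkj, rfl⟩ := memM _ hw
    rcases List.mem_append.1 hw' with h | h
    · rcases memP _ h with ⟨x, -, h⟩ | ⟨k', hk', h⟩
      · cases h
      · obtain rfl := Sum.inr_injective h
        exact .inl (by rw [le_antisymm hk' hik])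
    · rcases memR _ (List.mem_of_mem_tail h) with h | ⟨k', hk', h⟩
      · cases h
      · obtain rfl := Sum.inr_injective h
        exact .inr (by rw [le_antisymm hkj hk'])

/-- Old pairs keep their paths, a fan serves a pair of an inner chain vertex and an old vertex, and
the bridge closes the chain to a cycle for two inner vertices. -/
theorem attach_linked (h01 : h₀ ≠ h₁) (hAB : A ≠ B) (hC : ∀ u v, u ≠ v → C.Linked u v)
    (hF : ∀ v, C.Fan h₀ h₁ A B v) (hBr : C.Bridge h₀ h₁ A B) (u v : V ⊕ Fin (m + 1))
    (huv : u ≠ v) : (C.attach h₀ h₁ A B m).Linked u v := by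
  rcases u with u | i <;> rcases v with v | j
  · exact (hC u v fun h => huv (by rw [h])).map Sum.inl_injective Sum.inl_injective
      fun _ _ _ => rfl
  · exact (attach_linked_inr_inl h01 hAB (hF u) j).symm
  · exact attach_linked_inr_inl h01 hAB (hF v) i
  · rcases lt_trichotomy i j with h | h | h
    · exact attach_linked_inr_inr h01 hAB hBr h
    · exact absurd (by rw [h]) huv
    · exact (attach_linked_inr_inr h01 hAB hBr h).symm

theorem ncard_edgeSet_attach_le [Fintype V] :
    (C.attach h₀ h₁ A B m).toGraph.edgeSet.ncard ≤ C.toGraph.edgeSet.ncard + (m + 2) := by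
  classical
  have hsub : (C.attach h₀ h₁ A B m).toGraph.edgeSet ⊆ Sym2.map .inl '' C.toGraph.edgeSet ∪
      (fun i => s(chainPos h₀ h₁ m i, chainPos h₀ h₁ m (i + 1))) '' Set.Iio (m + 2) := by
    have aux : ∀ (u : V) (i : Fin (m + 1)), (C.attach h₀ h₁ A B m).col (.inl u) (.inr i) ≠ none →
        s(Sum.inl u, Sum.inr i) ∈ (fun i => s(chainPos h₀ h₁ m i, chainPos h₀ h₁ m (i + 1))) ''
          Set.Iio (m + 2) := by
      intro u i h
      simp only [attach] at h
      split_ifs at h with h1 h2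
      · refine ⟨0, by simp, ?_⟩
        have := chainPos_succ (h₀ := h₀) (h₁ := h₁) i
        rw [h1.2] at this
        simp only
        rw [this, chainPos_zero, h1.1]
      · refine ⟨m + 1, by simp, ?_⟩
        have := chainPos_succ (h₀ := h₀) (h₁ := h₁) i
        rw [h2.2] at this
        simp only
        rw [this, chainPos_last, h2.1, Sym2.eq_swap]
      · exact absurd rfl h
    intro e he
    induction e with
    | h u v =>
      replace he : (C.attach h₀ h₁ A B m).col u v ≠ none := he
      rcases u with u | i <;> rcases v with v | j
      · refine .inl ⟨s(u, v), ?_, rfl⟩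
        intro h
        exact he (by simp [attach, h])
      · exact .inr (aux u j he)
      · rw [Sym2.eq_swap]; rw [ColoredGraph.symm] at he; exact .inr (aux v i he)
      · right
        simp only [attach] at he
        split_ifs at he with h1 h2
        · refine ⟨i + 1, by simp; omega, ?_⟩
          simp only
          rw [chainPos_succ, h1, chainPos_succ]
        · refine ⟨j + 1, by simp; omega, ?_⟩
          simp only
          rw [chainPos_succ, h2, chainPos_succ, Sym2.eq_swap]
        · exact absurd rfl he
  refine (Set.ncard_le_ncard hsub (Set.toFinite _)).trans ((Set.ncard_union_le _ _).trans ?_)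
  refine add_le_add (Set.ncard_image_le (Set.toFinite _)) ((Set.ncard_image_le
    (Set.finite_Iio _)).trans ?_)
  rw [← Finset.coe_Iio, Set.ncard_coe_finset, Nat.card_Iio]

/-- A chain with `m + 1` inner vertices adds `m` colours and `m + 2` edges. -/
theorem t_le_of_attach [Fintype V] [Fintype K] (C : ColoredGraph V K) (h₀ h₁ : V) (A B : K)
    (m : ℕ) {n r e : ℕ} (hn : Fintype.card V + (m + 1) = n) (hr : Fintype.card K + m = r)
    (h01 : h₀ ≠ h₁) (hAB : A ≠ B) (hC : ∀ u v, u ≠ v → C.Linked u v)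
    (hF : ∀ v, C.Fan h₀ h₁ A B v) (hBr : C.Bridge h₀ h₁ A B)
    (he : C.toGraph.edgeSet.ncard + (m + 2) ≤ e) : t 2 n r ≤ e := by
  have hV : 1 < Fintype.card V := Fintype.one_lt_card_iff.2 ⟨h₀, h₁, h01⟩
  exact t_le_of_linked (C.attach h₀ h₁ A B m) (by simp [hn]) (by simp [hr]) (by omega)
    (attach_linked h01 hAB hC hF hBr) (ncard_edgeSet_attach_le.trans he)

end ColoredGraph
end RainbowConnection

/-! ### Finite verification of the explicit colourings -/

namespace RainbowConnection
namespace ColoredGraph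

/-- All vertices of a glued graph. -/
def glueVerts (b k s : ℕ) : List (Fin b ⊕ Fin k × Fin s) :=
  (List.finRange b).map .inl ++
    (List.finRange k).flatMap fun i => (List.finRange s).map fun j => .inr (i, j)

theorem mem_glueVerts {b k s : ℕ} (v : Fin b ⊕ Fin k × Fin s) : v ∈ glueVerts b k s := by
  rcases v with x | ⟨i, j⟩ <;> simp [glueVerts]

variable {K : Type*} [DecidableEq K] {b s : ℕ}

theorem glue_linked_of_check {C : ColoredGraph (Fin b ⊕ Fin s) K} {n : ℕ}
    (h : ((C.glue 1).linkedCheck (glueVerts b 1 s) n && (C.glue 2).linkedCheck (glueVerts b 2 s) n)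
      = true) {k : ℕ} (hk : 1 ≤ k) (u v : Fin b ⊕ Fin k × Fin s) (huv : u ≠ v) :
    (C.glue k).Linked u v := by
  rw [Bool.and_eq_true] at h
  exact glue_linked
    (fun u v huv => linked_of_linkedCheck h.1 (mem_glueVerts u) (mem_glueVerts v) huv)
    (fun u v huv => linked_of_linkedCheck h.2 (mem_glueVerts u) (mem_glueVerts v) huv) hk huv

/-- A fan involves the hubs and one further vertex, so a single copy contains all that has to be
checked. -/
theorem glue_fan_of_check {C : ColoredGraph (Fin b ⊕ Fin s) K} {n : ℕ} {h₀ h₁ : Fin b} {A B : K}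
    (h : (C.glue 1).chainCheck (glueVerts b 1 s) n (.inl h₀) (.inl h₁) A B = true) {k : ℕ}
    (hk : 1 ≤ k) : (∀ v, (C.glue k).Fan (.inl h₀) (.inl h₁) A B v) ∧
      (C.glue k).Bridge (.inl h₀) (.inl h₁) A B := by
  obtain ⟨hF, hB⟩ := of_chainCheck h
  have hf : ∀ i : Fin k, Function.Injective fun _ : Fin 1 => i := fun i a b _ =>
    Subsingleton.elim a b
  have hcol : ∀ (i : Fin k) (u v : Fin b ⊕ Fin 1 × Fin s), (C.glue 1).col u v ≠ none →
      (C.glue k).col (glueMap (fun _ => i) u) (glueMap (fun _ => i) v) = (C.glue 1).col u v := by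
    intro i u v _
    rw [C.glue_col_glueMap (hf i)]; simp
  refine ⟨fun v => ?_, hB.map (glueMap_injective (hf ⟨0, hk⟩)) (hcol ⟨0, hk⟩)⟩
  obtain ⟨i, hi⟩ : ∃ i : Fin k, ∀ j x, v = .inr (j, x) → j = i := by
    rcases v with x | ⟨j, x⟩
    · exact ⟨⟨0, hk⟩, fun _ _ h => by cases h⟩
    · exact ⟨j, fun _ _ h => by cases h; rfl⟩
  obtain ⟨u, rfl⟩ := exists_glueMap_eq i hi
  exact (hF u (mem_glueVerts u)).map (glueMap_injective (hf i)) (hcol i)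

/-! ### The constructions for three colours -/

/-- Two hubs, a vertex of degree two, and a unit with two vertices. -/
def edges3 : List (ℕ × ℕ × Fin 3) :=
  [(0, 10, 0), (0, 11, 1), (1, 10, 1), (1, 11, 0), (10, 11, 2), (0, 2, 2), (1, 2, 2)]

/-- `j` decides whether the optional vertex of degree two is present. Listed edges at codes outside
the base are never looked up, so one list serves every `j`. Each unit brings two vertices and five
edges. -/
theorem t_three_le (j : Fin 2) {k : ℕ} (hk : 1 ≤ k) :
    t 2 (2 + j + 2 * k) 3 ≤ 5 * k + 2 * j := by
  let C : ColoredGraph (Fin (2 + j) ⊕ Fin 2) (Fin 3) := ofList code edges3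
  refine t_le_of_linked (C.glue k) (by simp; ring) (by simp) (by omega)
    (glue_linked_of_check (n := 4) ?_ hk) ?_
  · fin_cases j <;> decide +kernel
  · have := two_mul_ncard_edgeSet_glue C k
    have h2 : (∑ x, ∑ y, C.edgeInd (.inl x) (.inl y)) = 4 * j ∧
        2 * (∑ x, ∑ y, C.edgeInd (.inl x) (.inr y)) + ∑ x, ∑ y, C.edgeInd (.inr x) (.inr y)
          = 10 := by
      fin_cases j <;> decide +kernel
    rw [h2.1, h2.2] at this
    omega

/-! ### The constructions for five colours -/

/-- Two hubs joined by a path with two inner vertices, two vertices of degree two, and a unit with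
three vertices. -/
def edges5 : List (ℕ × ℕ × Fin 5) :=
  [(0, 10, 0), (1, 10, 0), (0, 11, 1), (0, 12, 0), (1, 12, 1), (10, 11, 2), (11, 12, 3),
    (0, 2, 2), (2, 3, 3), (3, 1, 4), (0, 4, 0), (1, 4, 2), (0, 5, 1), (1, 5, 0)]

/-- Each unit brings three vertices and seven edges; the `j` optional vertices bring two edges each
and correct n modulo three. -/
theorem t_five_le (j : Fin 3) {k : ℕ} (hk : 1 ≤ k) :
    t 2 (4 + j + 3 * k) 5 ≤ 7 * k + 3 + 2 * j := by
  let C : ColoredGraph (Fin (4 + j) ⊕ Fin 3) (Fin 5) := ofList code edges5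
  refine t_le_of_linked (C.glue k) (by simp; ring) (by simp) (by omega)
    (glue_linked_of_check (n := 5) ?_ hk) ?_
  · fin_cases j <;> decide +kernel
  · have := two_mul_ncard_edgeSet_glue C k
    have h2 : (∑ x, ∑ y, C.edgeInd (.inl x) (.inl y)) = 6 + 4 * j ∧
        2 * (∑ x, ∑ y, C.edgeInd (.inl x) (.inr y)) + ∑ x, ∑ y, C.edgeInd (.inr x) (.inr y)
          = 14 := by
      fin_cases j <;> decide +kernel
    rw [h2.1, h2.2] at this
    omega

/-! ### The constructions for at least six colours -/

/-- Two hubs, three vertices of degree two, and a unit that is a cycle of length four. -/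
def edges6 : List (ℕ × ℕ × Fin 6) :=
  [(0, 10, 0), (1, 11, 1), (0, 12, 1), (1, 13, 0), (10, 11, 2), (11, 12, 3), (12, 13, 4),
    (13, 10, 5), (0, 2, 3), (1, 2, 2), (0, 3, 4), (1, 3, 4), (0, 4, 5), (1, 4, 5)]

/-- The colours 2 and 3 are reused at the ends of the chain, which is why its `m + 2` edges cost
only `m` new colours. -/
theorem chainCheck_edges6 (j : Fin 4) :
    ((ofList code edges6 : ColoredGraph (Fin (2 + j) ⊕ Fin 4) (Fin 6)).glue 1).chainCheck
      (glueVerts (2 + j) 1 4) 5 (.inl ⟨0, by omega⟩) (.inl ⟨1, by omega⟩) 2 3 = true := by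
  fin_cases j <;> decide +kernel

theorem t_six_add_le (j : Fin 4) {k : ℕ} (hk : 1 ≤ k) (m : ℕ) :
    t 2 (3 + j + 4 * k + m) (6 + m) ≤ 8 * k + 2 * j + m + 2 := by
  let C : ColoredGraph (Fin (2 + j) ⊕ Fin 4) (Fin 6) := ofList code edges6
  have hF := glue_fan_of_check (chainCheck_edges6 j) hk
  refine t_le_of_attach (C.glue k) (.inl ⟨0, by omega⟩) (.inl ⟨1, by omega⟩) 2 3 m
    (by simp; ring) (by simp) (by simp) (by decide)
    (glue_linked_of_check (n := 5) ?_ hk) hF.1 hF.2 ?_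
  · fin_cases j <;> decide +kernel
  · have := two_mul_ncard_edgeSet_glue C k
    have h2 : (∑ x, ∑ y, C.edgeInd (.inl x) (.inl y)) = 4 * j ∧
        2 * (∑ x, ∑ y, C.edgeInd (.inl x) (.inr y)) + ∑ x, ∑ y, C.edgeInd (.inr x) (.inr y)
          = 16 := by
      fin_cases j <;> decide +kernel
    rw [h2.1, h2.2] at this
    omega

/-! ### The constructions with few edges -/

/-- A rainbow triangle with a chain between two of its vertices: `m + 4` vertices, `m + 3` colours
and `3 + (m + 2)` edges. -/
theorem t_add_three_le (m : ℕ) : t 2 (m + 4) (m + 3) ≤ m + 5 := by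
  let C : ColoredGraph (Fin 3) (Fin 3) := ofList Fin.val [(0, 1, 2), (0, 2, 0), (1, 2, 1)]
  have hF := of_chainCheck (C := C) (vs := List.finRange 3) (n := 3) (h₀ := 0) (h₁ := 1)
    (A := 1) (B := 0) (by decide +kernel)
  refine t_le_of_attach C 0 1 1 0 m (by simp; ring) (by simp; ring) (by decide) (by decide)
    (fun u v huv => linked_of_linkedCheck (vs := List.finRange 3) (n := 3) (by decide +kernel)
      (List.mem_finRange u) (List.mem_finRange v) huv)
    (fun v => hF.1 v (List.mem_finRange v)) hF.2 ?_
  have := C.two_mul_ncard_edgeSet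
  have h2 : ∑ u, ∑ v, C.edgeInd u v = 6 := by decide +kernel
  omega

/-- The base is K4 minus an edge, coloured with three colours, and the chain joins its two vertices
of degree three. -/
theorem t_add_five_le (m : ℕ) : t 2 (m + 5) (m + 3) ≤ m + 7 := by
  let C : ColoredGraph (Fin 4) (Fin 3) :=
    ofList Fin.val [(0, 1, 0), (0, 2, 0), (0, 3, 1), (1, 2, 0), (1, 3, 2)]
  have hF := of_chainCheck (C := C) (vs := List.finRange 4) (n := 3) (h₀ := 0) (h₁ := 1)
    (A := 2) (B := 1) (by decide +kernel)
  refine t_le_of_attach C 0 1 2 1 m (by simp; ring) (by simp; ring) (by decide) (by decide)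
    (fun u v huv => linked_of_linkedCheck (vs := List.finRange 4) (n := 3) (by decide +kernel)
      (List.mem_finRange u) (List.mem_finRange v) huv)
    (fun v => hF.1 v (List.mem_finRange v)) hF.2 ?_
  have := C.two_mul_ncard_edgeSet
  have h2 : ∑ u, ∑ v, C.edgeInd u v = 10 := by decide +kernel
  omega

/-! ### Complete graphs with two colours -/

/-- The complete graph on `n` vertices where the edges of a Hamiltonian path have one colour and
the other edges another one. -/
def pathColoring (n : ℕ) : ColoredGraph (Fin n) (Fin 2) where
  col u v := if u = v then none else if u.val + 1 = v.val ∨ v.val + 1 = u.val then some 0 else some 1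
  symm u v := by simp only [eq_comm (a := u), or_comm]
  irrefl u := by simp

theorem isRainbowPath_pair {V K : Type*} (C : ColoredGraph V K) {u v : V} (huv : u ≠ v)
    (h : C.col u v ≠ none) : C.IsRainbowPath u v [u, v] :=
  ⟨rfl, rfl, by simpa using huv, by simp, by simpa using Ne.symm h⟩

theorem isRainbowPath_triple {V K : Type*} (C : ColoredGraph V K) {u w v : V} (huv : u ≠ v)
    (huw : C.col u w ≠ none) (hwv : C.col w v ≠ none) (h : C.col u w ≠ C.col w v) :
    C.IsRainbowPath u v [u, w, v] := by
  have h1 : u ≠ w := by rintro rfl; exact huw (C.irrefl u)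
  have h2 : w ≠ v := by rintro rfl; exact hwv (C.irrefl w)
  exact ⟨rfl, rfl, by simp [h1, h2, huv], by simpa using h, by simp [huw.symm, hwv.symm]⟩

theorem linked_of_triple {V K : Type*} (C : ColoredGraph V K) {u v : V} (w : V) (huv : u ≠ v)
    (h : C.col u v ≠ none) (huw : C.col u w ≠ none) (hwv : C.col w v ≠ none)
    (hne : C.col u w ≠ C.col w v) : C.Linked u v :=
  ⟨_, _, C.isRainbowPath_pair huv h, C.isRainbowPath_triple huv huw hwv hne, by simp,
    by simp⟩

theorem pathColoring_linked {n : ℕ} (hn : 4 ≤ n) (u v : Fin n) (huv : u ≠ v) :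
    (pathColoring n).Linked u v := by
  wlog h : u < v generalizing u v
  · exact (this v u huv.symm (lt_of_le_of_ne (not_lt.1 h) huv.symm)).symm
  rw [Fin.lt_def] at h
  have aux : ∀ w : Fin n, (w ≠ u ∧ w ≠ v ∧ ((u.val + 1 = w.val ∨ w.val + 1 = u.val) ↔
      ¬ (w.val + 1 = v.val ∨ v.val + 1 = w.val))) → (pathColoring n).Linked u v := by
    rintro w ⟨h1, h2, h3⟩
    refine linked_of_triple _ w huv ?_ ?_ ?_ ?_ <;> simp only [pathColoring]
    · rw [if_neg huv]; split_ifs <;> simp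
    · rw [if_neg h1.symm]; split_ifs <;> simp
    · rw [if_neg h2]; split_ifs <;> simp
    · rw [if_neg h1.symm, if_neg h2]
      by_cases h4 : u.val + 1 = w.val ∨ w.val + 1 = u.val
      · rw [if_pos h4, if_neg (h3.1 h4)]; simp
      · rw [if_neg h4, if_pos (by_contra fun h5 => h4 (h3.2 h5))]; simp
  -- A vertex `w` is needed such that exactly one of `uw` and `wv` lies on the Hamiltonian path: the
  -- successor of `v`, else the predecessor of `u`, else the vertex 1 when `u` and `v` are the ends
  -- of the path. The last choice needs n ≥ 4.
  by_cases h1 : v.val + 1 < n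
  · refine aux ⟨v.val + 1, h1⟩ ⟨by simp only [ne_eq, Fin.ext_iff]; omega,
      by simp only [ne_eq, Fin.ext_iff]; omega, iff_of_false ?_ (not_not_intro (.inr rfl))⟩
    simp only; omega
  · by_cases h2 : 1 ≤ u.val
    · refine aux ⟨u.val - 1, by omega⟩ ?_
      simp only [ne_eq, Fin.ext_iff]; omega
    · refine aux ⟨1, by omega⟩ ?_
      simp only [ne_eq, Fin.ext_iff]; omega

end ColoredGraph

/-! ### The minimum is attained; upper bounds with at least three colours -/

theorem edgeCounts_two_nonempty {n r : ℕ} (hn : 4 ≤ n) (hr : 2 ≤ r) :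
    (edgeCounts 2 n r).Nonempty :=
  ⟨_, edgeCounts_mono hr ((ColoredGraph.pathColoring n).ncard_mem_edgeCounts (by simp) (by simp)
    (by omega) (ColoredGraph.pathColoring_linked hn))⟩

theorem t_mem_edgeCounts {n r : ℕ} (hn : 4 ≤ n) (hr : 2 ≤ r) : t 2 n r ∈ edgeCounts 2 n r :=
  Nat.sInf_mem (edgeCounts_two_nonempty hn hr)

/-- Nonemptiness matters here: the natural infimum of an empty set would be 0. -/
theorem t_anti {n r s : ℕ} (hn : 4 ≤ n) (hr : 2 ≤ r) (hrs : r ≤ s) : t 2 n s ≤ t 2 n r :=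
  Nat.sInf_le (edgeCounts_mono hrs (t_mem_edgeCounts hn hr))

theorem t_le_five_halves {n r : ℕ} (hr : 3 ≤ r) (hn : 4 ≤ n) : 2 * t 2 n r ≤ 5 * n - 10 := by
  have h := t_anti hn (by omega) hr
  obtain ⟨k, j, hk, rfl⟩ : ∃ (k : ℕ) (j : Fin 2), 1 ≤ k ∧ n = 2 + j + 2 * k :=
    ⟨(n - 2) / 2, ⟨(n - 2) % 2, by omega⟩, by omega, by simp only; omega⟩
  have := ColoredGraph.t_three_le j hk
  omega

theorem t_five_le_seven_thirds {n : ℕ} (hn : 7 ≤ n) : 3 * t 2 n 5 ≤ 7 * n - 19 := by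
  obtain ⟨k, j, hk, rfl⟩ : ∃ (k : ℕ) (j : Fin 3), 1 ≤ k ∧ n = 4 + j + 3 * k :=
    ⟨(n - 4) / 3, ⟨(n - 4) % 3, by omega⟩, by omega, by simp only; omega⟩
  have := ColoredGraph.t_five_le j hk
  omega

theorem t_add_le_two_mul {n r : ℕ} (hr : 6 ≤ r) (hn : r + 3 ≤ n) : t 2 n r + r ≤ 2 * n + 2 := by
  obtain ⟨m, rfl⟩ := Nat.exists_eq_add_of_le hr
  obtain ⟨k, j, hk, rfl⟩ : ∃ (k : ℕ) (j : Fin 4), 1 ≤ k ∧ n = 3 + j + 4 * k + m :=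
    ⟨(n - 3 - m) / 4, ⟨(n - 3 - m) % 4, by omega⟩, by omega, by simp only; omega⟩
  have := ColoredGraph.t_six_add_le j hk m
  omega

end RainbowConnection

namespace RainbowConnection
namespace ColoredGraph

/-! ### Two colours: the upper bound -/

/-- A vector over `ZMod 2` extended by its parity. -/
def withParity {p : ℕ} (x : Fin p → ZMod 2) (a : Option (Fin p)) : ZMod 2 :=
  a.elim (∑ i, x i) x

/-- Words that differ in a single coordinate have different parities, so the extended code has
minimum distance two. -/
theorem exists_two_ne_withParity {p : ℕ} {x y : Fin p → ZMod 2} (hxy : x ≠ y) :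
    ∃ a b, a ≠ b ∧ withParity x a ≠ withParity y a ∧ withParity x b ≠ withParity y b := by
  obtain ⟨i, hi⟩ := Function.ne_iff.1 hxy
  by_contra! hcon
  have h : ∀ b, some i ≠ b → withParity x b = withParity y b := fun b hb => hcon (some i) b hb hi
  have h1 : ∑ j, x j = ∑ j, y j := h none (by simp)
  have h2 : ∑ j ∈ Finset.univ.erase i, x j = ∑ j ∈ Finset.univ.erase i, y j := by
    refine Finset.sum_congr rfl fun j hj => h (some j) ?_
    simpa using (Finset.ne_of_mem_erase hj).symm
  rw [← Finset.add_sum_erase _ _ (Finset.mem_univ i),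
    ← Finset.add_sum_erase _ y (Finset.mem_univ i), h2] at h1
  exact hi (add_right_cancel h1)

/-- A clique of one colour on the coordinates, with all vectors of `X` joined to all coordinates,
coloured by their entries. -/
def codeGraph {p : ℕ} (X : Finset (Fin p → ZMod 2)) :
    ColoredGraph (Option (Fin p) ⊕ X) (ZMod 2) where
  col u v := match u, v with
    | .inl a, .inl b => if a = b then none else some 0
    | .inl a, .inr x | .inr x, .inl a => some (withParity x.1 a)
    | .inr _, .inr _ => none
  symm u v := by
    rcases u with a | x <;> rcases v with b | y <;> simp only [eq_comm]
  irrefl u := by rcases u with a | x <;> simp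

/-- Two words are joined through two coordinates in which they differ. Two coordinates are joined by
their edge and through a unit vector that separates them. A word and a coordinate `a` are joined by
their edge and through another coordinate where the word has entry 1, as the clique has colour 0.
Such a coordinate exists because a nonzero word has two nonzero extended entries. -/
theorem codeGraph_linked {p : ℕ} {X : Finset (Fin p → ZMod 2)} (hp : 2 ≤ p)
    (h0 : (0 : Fin p → ZMod 2) ∉ X) (h1 : ∀ i, Pi.single i 1 ∈ X)
    (u v : Option (Fin p) ⊕ X) (huv : u ≠ v) : (codeGraph X).Linked u v := by
  have hsep : ∀ a b : Option (Fin p), a ≠ b → ∃ x ∈ X, withParity x a ≠ withParity x b := by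
    have hnone : ∀ i : Fin p, ∃ x ∈ X, withParity x (some i) ≠ withParity x none := by
      intro i
      have : Nontrivial (Fin p) := Fin.nontrivial_iff_two_le.2 hp
      obtain ⟨j, hj⟩ := exists_ne i
      exact ⟨_, h1 j, by simp [withParity, hj.symm]⟩
    rintro (_ | i) (_ | j) hab
    · exact absurd rfl hab
    · obtain ⟨x, hx, h⟩ := hnone j
      exact ⟨x, hx, h.symm⟩
    · exact hnone i
    · refine ⟨_, h1 i, ?_⟩
      have hij : j ≠ i := fun h => hab (by rw [h])
      simp [withParity, hij]
  have hmix : ∀ (a : Option (Fin p)) (x : X), (codeGraph X).Linked (.inl a) (.inr x) := by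
    intro a x
    have hx : x.1 ≠ 0 := fun h => h0 (h ▸ x.2)
    obtain ⟨b, hab, hb⟩ : ∃ b, a ≠ b ∧ withParity x.1 b ≠ 0 := by
      obtain ⟨b, c, hbc, hb, hc⟩ := exists_two_ne_withParity hx
      have hz : ∀ a, withParity (0 : Fin p → ZMod 2) a = 0 := by
        rintro (_ | i) <;> simp [withParity]
      rw [hz] at hb hc
      by_cases h : a = b
      · exact ⟨c, by rw [h]; exact hbc, hc⟩
      · exact ⟨b, h, hb⟩
    refine linked_of_triple _ (.inl b) (by simp) ?_ ?_ ?_ ?_ <;> simp [codeGraph, hab, hb.symm]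
  rcases u with a | x <;> rcases v with b | y
  · have hab : a ≠ b := fun h => huv (by rw [h])
    obtain ⟨x, hx, h⟩ := hsep a b hab
    refine linked_of_triple _ (.inr ⟨x, hx⟩) huv ?_ ?_ ?_ ?_ <;> simp [codeGraph, hab, h]
  · exact hmix a y
  · exact (hmix b x).symm
  · have hxy : x.1 ≠ y.1 := fun h => huv (by rw [Subtype.ext h])
    obtain ⟨a, b, hab, ha, hb⟩ := exists_two_ne_withParity hxy
    refine ⟨_, _, isRainbowPath_triple _ (w := .inl a) huv ?_ ?_ ?_,
      isRainbowPath_triple _ (w := .inl b) huv ?_ ?_ ?_, ?_, ?_⟩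
    all_goals simp [codeGraph, ha, hb, hab]

end ColoredGraph

open ColoredGraph in
theorem t_two_le {n p : ℕ} (hp : 2 ≤ p) (h1 : 2 * p + 1 ≤ n) (h2 : n ≤ 2 ^ p) :
    t 2 n 2 ≤ (p + 1) * n := by
  classical
  let U : Finset (Fin p → ZMod 2) := Finset.univ.image fun i => Pi.single i 1
  let W : Finset (Fin p → ZMod 2) := Finset.univ.erase 0
  have hUW : U ⊆ W := by
    intro x hx
    obtain ⟨i, -, rfl⟩ := Finset.mem_image.1 hx
    simp [W]
  have hU : U.card ≤ n - (p + 1) := by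
    refine Finset.card_image_le.trans ?_
    simp; omega
  have hW : n - (p + 1) ≤ W.card := by
    rw [Finset.card_erase_of_mem (Finset.mem_univ _), Finset.card_univ]
    simp only [Fintype.card_pi, ZMod.card, Finset.prod_const, Finset.card_univ, Fintype.card_fin]
    omega
  -- `X` lies between the unit vectors and the nonzero vectors; `2p + 1 ≤ n ≤ 2^p` leaves room for
  -- exactly `n - (p + 1)` words.
  obtain ⟨X, hUX, hXW, hX⟩ := Finset.exists_subsuperset_card_eq hUW hU hW
  have hcard : Fintype.card (Option (Fin p) ⊕ X) = n := by
    simp [hX]; omega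
  refine t_le_of_linked (codeGraph X) hcard (ZMod.card 2) (by omega)
    (codeGraph_linked hp (fun h => by simpa [W] using hXW h)
      fun i => hUX (Finset.mem_image_of_mem _ (Finset.mem_univ i))) ?_
  -- Every edge has an end among the `p + 1` coordinates.
  have hsub : (codeGraph X).toGraph.edgeSet ⊆
      (fun q : Option (Fin p) × (Option (Fin p) ⊕ X) => s(.inl q.1, q.2)) '' Set.univ := by
    intro e he
    induction e with
    | h u v =>
      rcases u with a | x
      · exact ⟨(a, v), trivial, rfl⟩
      · rcases v with b | y
        · exact ⟨(b, .inr x), trivial, Sym2.eq_swap⟩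
        · exact absurd rfl he
  refine (Set.ncard_le_ncard hsub (Set.toFinite _)).trans
    ((Set.ncard_image_le (Set.toFinite _)).trans ?_)
  rw [Set.ncard_univ, Nat.card_eq_fintype_card, Fintype.card_prod, hcard]
  simp

theorem t_two_le_clog {n : ℕ} (hn : 32 ≤ n) : t 2 n 2 ≤ (Nat.clog 2 n + 1) * n := by
  -- With p = `Nat.clog 2 n`, the requirement `2p + 1 ≤ n` follows from `2^(p-1) < n` and `2p ≤
  -- 2^(p-1)`. The latter holds for p ≥ 5, hence the assumption n ≥ 32.
  have h5 : 5 ≤ Nat.clog 2 n := by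
    calc 5 = Nat.clog 2 (2 ^ 5) := by rw [Nat.clog_pow]; norm_num
      _ ≤ _ := Nat.clog_mono_right 2 hn
  have h1 : 2 ^ (Nat.clog 2 n - 1) < n := Nat.pow_pred_clog_lt_self (by norm_num) (by omega)
  have h2 : ∀ q : ℕ, 4 ≤ q → 2 * (q + 1) ≤ 2 ^ q := by
    intro q hq
    induction q, hq using Nat.le_induction with
    | base => norm_num
    | succ q hq ih => rw [pow_succ]; omega
  have h3 := h2 (Nat.clog 2 n - 1) (by omega)
  exact t_two_le (by omega) (by omega) (Nat.le_pow_clog (by norm_num) n)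

/-! ### Two colours: the lower bound -/

theorem ColoredGraph.IsRainbowPath.length_le {V K : Type*} [Fintype K] {C : ColoredGraph V K}
    {u v : V} {l : List V} (h : C.IsRainbowPath u v l) : l.length ≤ Fintype.card K + 1 := by
  classical
  obtain ⟨-, -, -, h4, h5⟩ := h
  have h1 : (C.edgeCols l).toFinset ⊆ Finset.univ.image some := by
    intro x hx
    rw [List.mem_toFinset] at hx
    cases x with
    | none => exact absurd hx h5
    | some x => simp
  have h2 := Finset.card_le_card h1
  rw [List.toFinset_card_of_nodup h4, Finset.card_image_of_injective _ (Option.some_injective K),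
    Finset.card_univ] at h2
  simp only [edgeCols, List.length_zipWith, List.length_tail] at h2
  omega

/-- With two colours a rainbow path has at most two edges, and two distinct paths cannot both be the
edge `uv`. -/
theorem ColoredGraph.Linked.exists_triple {V : Type*} {C : ColoredGraph V (Fin 2)} {u v : V}
    (huv : u ≠ v) (h : C.Linked u v) :
    ∃ w, C.col u w ≠ none ∧ C.col w v ≠ none ∧ C.col u w ≠ C.col w v := by
  have aux : ∀ l, C.IsRainbowPath u v l → l = [u, v] ∨ ∃ w, l = [u, w, v] := by
    intro l hl
    have hlen := hl.length_le
    rw [Fintype.card_fin] at hlen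
    obtain ⟨a1, a2, -⟩ := hl
    match l, hlen, a1, a2 with
    | [x], _, a1, a2 => simp_all
    | [x, y], _, a1, a2 => simp_all
    | [x, y, z], _, a1, a2 => simp_all
  obtain ⟨l₁, l₂, h₁, h₂, hne, -⟩ := h
  obtain ⟨w, hw⟩ : ∃ w, C.IsRainbowPath u v [u, w, v] := by
    rcases aux l₁ h₁ with rfl | ⟨w, rfl⟩
    · rcases aux l₂ h₂ with rfl | ⟨w, rfl⟩
      · exact absurd rfl hne
      · exact ⟨w, h₂⟩
    · exact ⟨w, h₁⟩
  obtain ⟨-, -, -, h4, h5⟩ := hw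
  simp only [edgeCols_cons_cons, edgeCols_singleton, List.nodup_cons, List.mem_cons,
    List.not_mem_nil, or_false, not_or] at h4 h5
  exact ⟨w, Ne.symm h5.1, Ne.symm h5.2, h4.1⟩

section TwoColors

variable {V : Type*} [Fintype V] [DecidableEq V] (C : ColoredGraph V (Fin 2))

open Classical in
/-- The high-degree neighbours of a vertex. -/
noncomputable def highNeighbors (D : ℕ) (v : V) : Finset V :=
  (C.toGraph.neighborFinset v).filter fun w => D ≤ C.toGraph.degree w

open Classical in
/-- The low-degree vertices for which all edges to high-degree neighbours have the colours
prescribed by `f`. -/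
noncomputable def survivors (D : ℕ) (f : V → Fin 2) : Finset V :=
  Finset.univ.filter fun v => C.toGraph.degree v < D ∧
    ∀ w ∈ highNeighbors C D v, C.col v w = some (f w)

/-- Both edges from two survivors to a common high-degree neighbour `w` have colour `f w`, so the
two-coloured path between them has a low-degree middle vertex. From one survivor such paths reach at
most `D * D` vertices. -/
theorem card_survivors_le (hC : ∀ u v, u ≠ v → C.Linked u v) (D : ℕ) (f : V → Fin 2) :
    (survivors C D f).card ≤ D * D + 1 := by
  classical
  rcases (survivors C D f).eq_empty_or_nonempty with h | ⟨v, hv⟩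
  · simp [h]
  have hsub : survivors C D f ⊆ insert v (((C.toGraph.neighborFinset v).filter
      fun w => C.toGraph.degree w < D).biUnion fun w => C.toGraph.neighborFinset w) := by
    intro u hu
    by_cases huv : u = v
    · simp [huv]
    obtain ⟨w, h1, h2, h3⟩ := (hC v u (Ne.symm huv)).exists_triple (Ne.symm huv)
    refine Finset.mem_insert_of_mem (Finset.mem_biUnion.2 ⟨w, ?_, ?_⟩)
    · rw [Finset.mem_filter, SimpleGraph.mem_neighborFinset]
      refine ⟨h1, lt_of_not_ge fun hw => ?_⟩
      simp only [survivors, Finset.mem_filter, Finset.mem_univ, true_and] at hu hv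
      refine h3 ?_
      rw [hv.2 w, C.symm w u, hu.2 w]
      · rw [highNeighbors, Finset.mem_filter, SimpleGraph.mem_neighborFinset]
        exact ⟨by rw [C.symm] at h2; exact h2, hw⟩
      · rw [highNeighbors, Finset.mem_filter, SimpleGraph.mem_neighborFinset]
        exact ⟨h1, hw⟩
    · rw [SimpleGraph.mem_neighborFinset]; exact h2
  refine (Finset.card_le_card hsub).trans ((Finset.card_insert_le _ _).trans ?_)
  gcongr
  refine (Finset.card_biUnion_le_card_mul _ _ D fun w hw => ?_).trans ?_
  · rw [SimpleGraph.card_neighborFinset_eq_degree]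
    exact (Finset.mem_filter.1 hw).2.le
  · gcongr
    refine (Finset.card_filter_le _ _).trans ?_
    rw [SimpleGraph.card_neighborFinset_eq_degree]
    simp only [survivors, Finset.mem_filter] at hv
    exact hv.2.1.le

/-- A vertex fixes `f` on its high-degree neighbours and leaves all other values free. -/
theorem card_filter_eq_pow (D : ℕ) (v : V) :
    (Finset.univ.filter fun f : V → Fin 2 =>
      ∀ w ∈ highNeighbors C D v, C.col v w = some (f w)).card =
      2 ^ (Fintype.card V - (highNeighbors C D v).card) := by
  classical
  have h0 : ∀ w ∈ highNeighbors C D v, C.col v w ≠ none := by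
    intro w hw
    rw [highNeighbors, Finset.mem_filter, SimpleGraph.mem_neighborFinset] at hw
    exact hw.1
  have : (Finset.univ.filter fun f : V → Fin 2 =>
      ∀ w ∈ highNeighbors C D v, C.col v w = some (f w)) =
      Fintype.piFinset fun w => if w ∈ highNeighbors C D v then {(C.col v w).getD 0}
        else Finset.univ := by
    ext f
    simp only [Finset.mem_filter, Finset.mem_univ, true_and, Fintype.mem_piFinset]
    refine forall_congr' fun w => ?_
    by_cases hw : w ∈ highNeighbors C D v
    · obtain ⟨c, hc⟩ := Option.ne_none_iff_exists'.1 (h0 w hw)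
      simp [hw, hc, eq_comm]
    · simp [hw]
  rw [this, Fintype.card_piFinset]
  have h1 : ∀ w, (if w ∈ highNeighbors C D v then {(C.col v w).getD 0}
      else (Finset.univ : Finset (Fin 2))).card = if w ∈ highNeighbors C D v then 1 else 2 := by
    intro w; split_ifs <;> simp
  simp only [h1]
  rw [Finset.prod_ite, Finset.prod_const_one, one_mul, Finset.prod_const]
  congr 1
  rw [← Finset.card_univ, ← Finset.card_sdiff_of_subset (Finset.subset_univ _)]
  congr 1
  ext w; simp

open Classical in
/-- Few low-degree vertices have few high-degree neighbours. -/
theorem card_low_le (hC : ∀ u v, u ≠ v → C.Linked u v) (D T : ℕ) (hT : T ≤ Fintype.card V) :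
    (Finset.univ.filter fun v => C.toGraph.degree v < D ∧ (highNeighbors C D v).card ≤ T).card
      ≤ 2 ^ T * (D * D + 1) := by
  set S := Finset.univ.filter fun v => C.toGraph.degree v < D ∧ (highNeighbors C D v).card ≤ T
  -- Pairs of a vertex `v` in `S` and a function `f` for which `v` survives are counted in two ways.
  have h1 : S.card * 2 ^ (Fintype.card V - T) ≤ ∑ v ∈ S, (Finset.univ.filter
      fun f : V → Fin 2 => ∀ w ∈ highNeighbors C D v, C.col v w = some (f w)).card := by
    rw [← smul_eq_mul, ← Finset.sum_const]
    refine Finset.sum_le_sum fun v hv => ?_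
    rw [card_filter_eq_pow]
    have := (Finset.mem_filter.1 hv).2.2
    exact Nat.pow_le_pow_right (by norm_num) (by omega)
  have h2 : ∑ v ∈ S, (Finset.univ.filter
      fun f : V → Fin 2 => ∀ w ∈ highNeighbors C D v, C.col v w = some (f w)).card ≤
      ∑ f : V → Fin 2, (survivors C D f).card := by
    simp only [Finset.card_filter]
    rw [Finset.sum_comm]
    refine Finset.sum_le_sum fun f _ => ?_
    rw [← Finset.card_filter]
    refine Finset.card_le_card fun v hv => ?_
    rw [Finset.mem_filter] at hv
    exact Finset.mem_filter.2 ⟨Finset.mem_univ v, (Finset.mem_filter.1 hv.1).2.1, hv.2⟩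
  have h3 : ∑ f : V → Fin 2, (survivors C D f).card ≤ 2 ^ Fintype.card V * (D * D + 1) := by
    refine (Finset.sum_le_sum fun f _ => card_survivors_le C hC D f).trans ?_
    simp
  have h4 : 2 ^ Fintype.card V = 2 ^ T * 2 ^ (Fintype.card V - T) := by
    rw [← pow_add]; congr 1; omega
  have h5 := h1.trans (h2.trans h3)
  rw [h4] at h5
  exact Nat.le_of_mul_le_mul_right (by linarith) (pow_pos (by norm_num : 0 < 2)
    (Fintype.card V - T))

-- An edge between a low-degree and a high-degree vertex is counted once, since the degrees tell its
-- ends apart.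
open Classical in
theorem sum_card_highNeighbors_le (D : ℕ) :
    ∑ v ∈ Finset.univ.filter fun v => C.toGraph.degree v < D, (highNeighbors C D v).card ≤
      C.toGraph.edgeFinset.card := by
  rw [← Finset.card_sigma]
  refine Finset.card_le_card_of_injOn (fun q => s(q.1, q.2)) ?_ ?_
  · rintro ⟨v, w⟩ h
    simp only [Finset.coe_sigma, Set.mem_sigma_iff, Finset.mem_coe, highNeighbors,
      Finset.mem_filter, SimpleGraph.mem_neighborFinset] at h
    simpa using h.2.1
  · rintro ⟨v, w⟩ h ⟨v', w'⟩ h' heq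
    simp only [Finset.coe_sigma, Set.mem_sigma_iff, Finset.mem_coe, highNeighbors,
      Finset.mem_filter, SimpleGraph.mem_neighborFinset, Finset.mem_univ, true_and] at h h'
    simp only [Sym2.eq_iff] at heq
    rcases heq with ⟨rfl, rfl⟩ | ⟨rfl, rfl⟩
    · rfl
    · omega

omit [DecidableEq V] in
open Classical in
theorem card_high_mul_le (D : ℕ) :
    (Finset.univ.filter fun v => D ≤ C.toGraph.degree v).card * D ≤
      2 * C.toGraph.edgeFinset.card := by
  rw [← SimpleGraph.sum_degrees_eq_twice_card_edges, ← smul_eq_mul, ← Finset.sum_const]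
  exact (Finset.sum_le_sum fun v hv => (Finset.mem_filter.1 hv).2).trans
    (Finset.sum_le_sum_of_subset (Finset.subset_univ _))

open Classical in
/-- The counting bound behind the lower bound for two colours. -/
theorem mul_card_le_of_linked (hC : ∀ u v, u ≠ v → C.Linked u v) (D T : ℕ)
    (hT : T ≤ Fintype.card V) :
    (T + 1) * Fintype.card V ≤ C.toGraph.edgeFinset.card + (T + 1) *
      ((Finset.univ.filter fun v => D ≤ C.toGraph.degree v).card + 2 ^ T * (D * D + 1)) := by
  set H := Finset.univ.filter fun v => D ≤ C.toGraph.degree v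
  set L := Finset.univ.filter fun v => C.toGraph.degree v < D
  have h1 := card_low_le C hC D T hT
  set S := Finset.univ.filter fun v => C.toGraph.degree v < D ∧ (highNeighbors C D v).card ≤ T
  have h2 := sum_card_highNeighbors_le C D
  have h3 : Fintype.card V = L.card + H.card := by
    rw [← Finset.card_univ, ← Finset.card_filter_add_card_filter_not
      (fun v => C.toGraph.degree v < D)]
    simp only [not_lt]; rfl
  have h4 : S ⊆ L := fun v hv => by
    rw [Finset.mem_filter] at hv ⊢
    exact ⟨hv.1, hv.2.1⟩
  -- A low-degree vertex outside `S` has at least `T + 1` high-degree neighbours.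
  have h5 : (L \ S).card * (T + 1) ≤ ∑ v ∈ L, (highNeighbors C D v).card := by
    refine le_trans ?_ (Finset.sum_le_sum_of_subset (s := L \ S) Finset.sdiff_subset)
    rw [← smul_eq_mul, ← Finset.sum_const]
    refine Finset.sum_le_sum fun v hv => ?_
    rw [Finset.mem_sdiff] at hv
    by_contra hlt
    exact hv.2 (Finset.mem_filter.2 ⟨Finset.mem_univ v, (Finset.mem_filter.1 hv.1).2, by omega⟩)
  have h6 : L.card = (L \ S).card + S.card := (Finset.card_sdiff_add_card_eq_card h4).symm
  have h7 : L.card ≤ (L \ S).card + 2 ^ T * (D * D + 1) := by omega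
  calc (T + 1) * Fintype.card V ≤ (T + 1) * ((L \ S).card + 2 ^ T * (D * D + 1) + H.card) := by
        rw [h3]; gcongr
    _ = (L \ S).card * (T + 1) + (T + 1) * (H.card + 2 ^ T * (D * D + 1)) := by ring
    _ ≤ _ := by gcongr; exact h5.trans h2

end TwoColors

theorem t_two_bound {n : ℕ} (hn : 4 ≤ n) (D T : ℕ) (hT : T ≤ n) :
    ∃ H : ℕ, H * D ≤ 2 * t 2 n 2 ∧
      (T + 1) * n ≤ t 2 n 2 + (T + 1) * (H + 2 ^ T * (D * D + 1)) := by
  classical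
  obtain ⟨G, -, hr, he⟩ := t_mem_edgeCounts hn le_rfl
  obtain ⟨c, hc⟩ := exists_isRainbowKConnected_of_rc_le hr
  have hG : (ColoredGraph.ofLabeling c).toGraph = G := ColoredGraph.toGraph_ofLabeling c
  have hcard : (ColoredGraph.ofLabeling c).toGraph.edgeFinset.card = t 2 n 2 := by
    rw [← he, ← Set.ncard_coe_finset, SimpleGraph.coe_edgeFinset, hG]
  refine ⟨_, hcard ▸ card_high_mul_le (ColoredGraph.ofLabeling c) D, ?_⟩
  have := mul_card_le_of_linked (ColoredGraph.ofLabeling c)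
    (fun u v huv => ColoredGraph.linked_ofLabeling hc huv) D T (by simpa using hT)
  rw [hcard, Fintype.card_fin] at this
  exact this

end RainbowConnection

/-! ### Asymptotics for two colours -/

namespace RainbowConnection
open Filter Topology

/-- With `D` about x² and at most nx edges, at most 2n/x vertices have high degree. Since 2^T ≤ n/x⁷
and D² + 1 ≤ x⁵, at most n/x² low-degree vertices are exceptional. All remaining vertices account
for `T + 1` edges each, and T + 1 exceeds x - 7 log x. -/
theorem mul_log_le_of_t_two_lt {n : ℕ} (hn : 4 ≤ n) {x : ℝ} (hx : x = Real.logb 2 n)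
    (hx4 : 4 ≤ x) (hM : 0 ≤ x - 7 * Real.logb 2 x) (hlt : (t 2 n 2 : ℝ) ≤ n * x) :
    (x - 7 * Real.logb 2 x) * (n * (1 - 2 / x - 1 / x ^ 2)) ≤ t 2 n 2 := by
  have hn0 : (0 : ℝ) < n := by exact_mod_cast (by omega : 0 < n)
  have hx0 : 0 < x := by linarith
  set T := ⌊x - 7 * Real.logb 2 x⌋₊
  set D := ⌈x ^ 2⌉₊
  have hlogx : 0 ≤ Real.logb 2 x := Real.logb_nonneg (by norm_num) (by linarith)
  have hpow : (2 : ℝ) ^ x = n := by rw [hx]; exact Real.rpow_logb (by norm_num) (by norm_num) hn0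
  have hT1 : (T : ℝ) ≤ x - 7 * Real.logb 2 x := Nat.floor_le hM
  have hT2 : x - 7 * Real.logb 2 x < T + 1 := Nat.lt_floor_add_one _
  have hT : T ≤ n := by
    have h1 : (T : ℝ) ≤ x := by linarith
    have h2 : x ≤ n := by
      rw [hx, Real.logb_le_iff_le_rpow (by norm_num) hn0, Real.rpow_natCast]
      exact_mod_cast Nat.lt_two_pow_self.le
    exact_mod_cast h1.trans h2
  obtain ⟨H, hH, hmain⟩ := t_two_bound hn D T hT
  have hD1 : x ^ 2 ≤ (D : ℝ) := Nat.le_ceil _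
  have hD2 : (D : ℝ) ≤ x ^ 2 + 1 := (Nat.ceil_lt_add_one (by positivity)).le
  have hHle : (H : ℝ) ≤ n * (2 / x) := by
    have h1 : (H : ℝ) * D ≤ 2 * t 2 n 2 := by exact_mod_cast hH
    have h2 : (H : ℝ) * x ^ 2 ≤ 2 * (n * x) :=
      (mul_le_mul_of_nonneg_left hD1 (Nat.cast_nonneg H)).trans (h1.trans (by linarith))
    rw [mul_div_assoc', le_div_iff₀ hx0]
    have h3 : ((H : ℝ) * x) * x ≤ (n * 2) * x := by nlinarith
    exact le_of_mul_le_mul_right h3 hx0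
  have h2T : (2 : ℝ) ^ T * (D * D + 1) ≤ n * (1 / x ^ 2) := by
    have h1 : (2 : ℝ) ^ T ≤ n / x ^ 7 := by
      calc (2 : ℝ) ^ T = (2 : ℝ) ^ (T : ℝ) := (Real.rpow_natCast _ _).symm
        _ ≤ (2 : ℝ) ^ (x - 7 * Real.logb 2 x) := Real.rpow_le_rpow_of_exponent_le (by norm_num) hT1
        _ = n / x ^ 7 := by
          rw [Real.rpow_sub (by norm_num), hpow, mul_comm, Real.rpow_mul (by norm_num),
            Real.rpow_logb (by norm_num) (by norm_num) hx0]
          norm_cast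
    have h2 : (D : ℝ) * D + 1 ≤ x ^ 5 := by
      have h3 : (D : ℝ) * D ≤ (x ^ 2 + 1) * (x ^ 2 + 1) := by gcongr
      have h4 : 4 * x ^ 4 ≤ x ^ 5 := by
        rw [pow_succ x 4, mul_comm]; gcongr
      have h5 : 4 ^ 2 * x ^ 2 ≤ x ^ 4 := by
        rw [show x ^ 4 = x ^ 2 * x ^ 2 by ring]; gcongr
      nlinarith [sq_nonneg x]
    calc (2 : ℝ) ^ T * (D * D + 1) ≤ n / x ^ 7 * x ^ 5 := by gcongr
      _ = n * (1 / x ^ 2) := by field_simp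
  have hmain' : ((T : ℝ) + 1) * n ≤ t 2 n 2 + (T + 1) * (H + 2 ^ T * (D * D + 1)) := by
    exact_mod_cast hmain
  have hpos : 0 ≤ 1 - 2 / x - 1 / x ^ 2 := by
    have h1 : 2 / x ≤ 2 / 4 := by gcongr
    have h2 : 1 / x ^ 2 ≤ 1 / 4 ^ 2 := by gcongr
    linarith
  calc (x - 7 * Real.logb 2 x) * (n * (1 - 2 / x - 1 / x ^ 2))
      ≤ ((T : ℝ) + 1) * (n * (1 - 2 / x - 1 / x ^ 2)) := by gcongr
    _ ≤ ((T : ℝ) + 1) * (n - (H + 2 ^ T * (D * D + 1))) := by gcongr; linarith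
    _ ≤ (t 2 n 2 : ℝ) := by linarith

theorem tendsto_log_correction :
    Tendsto (fun x : ℝ => min 1 ((1 - 7 * (Real.logb 2 x / x)) * (1 - 2 / x - 1 / x ^ 2))) atTop
      (𝓝 1) := by
  have h1 : Tendsto (fun x : ℝ => Real.logb 2 x / x) atTop (𝓝 0) := by
    have := (Real.isLittleO_log_id_atTop.tendsto_div_nhds_zero).div_const (Real.log 2)
    simpa [Real.logb, div_right_comm] using this
  have h2 : Tendsto (fun x : ℝ => 2 / x) atTop (𝓝 0) := tendsto_const_nhds.div_atTop tendsto_id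
  have h3 : Tendsto (fun x : ℝ => 1 / x ^ 2) atTop (𝓝 0) :=
    tendsto_const_nhds.div_atTop (tendsto_pow_atTop (by norm_num))
  have h4 := ((h1.const_mul 7).const_sub 1).mul ((h2.const_sub 1).sub h3)
  simpa using (tendsto_const_nhds (x := (1 : ℝ))).min h4

theorem isEquivalent_t_two :
    Asymptotics.IsEquivalent atTop (fun n : ℕ => (t 2 n 2 : ℝ))
      (fun n : ℕ => (n : ℝ) * Real.logb 2 n) := by
  have hlog : Tendsto (fun n : ℕ => Real.logb 2 n) atTop atTop :=
    (Real.tendsto_logb_atTop (by norm_num)).comp tendsto_natCast_atTop_atTop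
  have hev : ∀ᶠ n : ℕ in atTop, 32 ≤ n ∧ 4 ≤ Real.logb 2 n :=
    (eventually_ge_atTop 32).and (hlog.eventually_ge_atTop 4)
  refine (Asymptotics.isEquivalent_iff_tendsto_one ?_).2 ?_
  · filter_upwards [hev] with n hn
    have : (0 : ℝ) < n := by exact_mod_cast (by omega : 0 < n)
    have : 0 < Real.logb 2 n := by linarith
    positivity
  have hup : Tendsto (fun n : ℕ => 1 + 2 / Real.logb 2 n) atTop (𝓝 1) := by
    simpa using (tendsto_const_nhds (x := (2 : ℝ)).div_atTop hlog).const_add 1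
  refine tendsto_of_tendsto_of_tendsto_of_le_of_le' (tendsto_log_correction.comp hlog) hup ?_ ?_
  · have h1 : ∀ᶠ x : ℝ in atTop, 0 ≤ x - 7 * Real.logb 2 x := by
      have h2 : Tendsto (fun x : ℝ => Real.logb 2 x / x) atTop (𝓝 0) := by
        have := (Real.isLittleO_log_id_atTop.tendsto_div_nhds_zero).div_const (Real.log 2)
        simpa [Real.logb, div_right_comm] using this
      filter_upwards [h2.eventually_le_const (show (0 : ℝ) < 1 / 7 by norm_num),
        eventually_gt_atTop 0] with x h3 h4
      rw [div_le_iff₀ h4] at h3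
      linarith
    filter_upwards [hev, hlog.eventually h1] with n hn h2
    have hn0 : (0 : ℝ) < n := by exact_mod_cast (by omega : 0 < n)
    have hx0 : 0 < Real.logb 2 n := by linarith
    simp only [Function.comp, Pi.div_apply]
    rw [le_div_iff₀ (by positivity)]
    -- The preceding estimate assumes at most n log n edges; otherwise the ratio exceeds 1, which
    -- the `min` with 1 allows for.
    rcases le_or_gt (t 2 n 2 : ℝ) (n * Real.logb 2 n) with h3 | h3
    · have h4 := mul_log_le_of_t_two_lt (by omega) rfl hn.2 h2 h3
      refine le_trans (mul_le_mul_of_nonneg_right (min_le_right _ _) (by positivity)) ?_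
      refine le_trans (le_of_eq ?_) h4
      field_simp
    · refine le_trans (mul_le_mul_of_nonneg_right (min_le_left _ _) (by positivity)) ?_
      linarith
  · filter_upwards [hev] with n hn
    have hn0 : (0 : ℝ) < n := by exact_mod_cast (by omega : 0 < n)
    have hx0 : 0 < Real.logb 2 n := by linarith
    rw [Pi.div_apply, div_le_iff₀ (by positivity)]
    have h1 : (t 2 n 2 : ℝ) ≤ (Nat.clog 2 n + 1) * n := by exact_mod_cast t_two_le_clog hn.1
    have h2 : (Nat.clog 2 n : ℝ) ≤ Real.logb 2 n + 1 := by
      have h3 : 2 ^ (Nat.clog 2 n - 1) < n := Nat.pow_pred_clog_lt_self (by norm_num) (by omega)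
      have h4 : ((Nat.clog 2 n - 1 : ℕ) : ℝ) ≤ Real.logb 2 n := by
        rw [Real.le_logb_iff_rpow_le (by norm_num) hn0, Real.rpow_natCast]
        exact_mod_cast h3.le
      have h5 : (Nat.clog 2 n : ℝ) ≤ ((Nat.clog 2 n - 1 : ℕ) : ℝ) + 1 := by
        exact_mod_cast (by omega : Nat.clog 2 n ≤ Nat.clog 2 n - 1 + 1)
      linarith
    calc (t 2 n 2 : ℝ) ≤ (Nat.clog 2 n + 1) * n := h1
      _ ≤ (Real.logb 2 n + 1 + 1) * n := by gcongr
      _ = (1 + 2 / Real.logb 2 n) * (n * Real.logb 2 n) := by field_simp; ring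

end RainbowConnection

namespace RainbowConnection
open SimpleGraph Finset

/-! ### Pairs of internally disjoint rainbow paths and vertices of degree two -/

section Pairs

variable {V K : Type*} {G : SimpleGraph V}

theorem exists_mem_edges_pair {u v x : V} {p : G.Walk u v} (hp : p.IsPath) (hx : x ∈ p.support)
    (hu : x ≠ u) (hv : x ≠ v) : ∃ y z, y ≠ z ∧ s(x, y) ∈ p.edges ∧ s(x, z) ∈ p.edges := by
  obtain ⟨i, hi, hil⟩ := Walk.mem_support_iff_exists_getVert.1 hx
  have h0 : i ≠ 0 := by rintro rfl; simp at hi; exact hu hi.symm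
  have hl : i < p.length := by
    refine lt_of_le_of_ne hil ?_
    rintro rfl; simp at hi; exact hv hi.symm
  have h := hp.ncard_neighborSet_toSubgraph_internal_eq_two h0 hl
  obtain ⟨y, z, hyz, h⟩ := Set.ncard_eq_two.1 h
  rw [hi] at h
  refine ⟨y, z, hyz, ?_, ?_⟩ <;> rw [← Walk.mem_edges_toSubgraph, Subgraph.mem_edgeSet,
    ← Subgraph.mem_neighborSet, h] <;> simp

theorem edges_eq_singleton {u v : V} {p : G.Walk u v} (hp : p.IsPath) (h : s(u, v) ∈ p.edges) :
    p.edges = [s(u, v)] := by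
  cases p with
  | nil => simp at h
  | cons huw p =>
    rename_i w
    rw [Walk.cons_isPath_iff] at hp
    have hwv : w = v := by
      rw [Walk.edges_cons, List.mem_cons] at h
      rcases h with h | h
      · rcases Sym2.eq_iff.1 h with ⟨-, h⟩ | ⟨h, h'⟩
        · exact h.symm
        · rw [h] at huw; exact absurd huw (by simp)
      · exact absurd (p.fst_mem_support_of_mem_edges h) hp.2
    subst hwv
    rw [Walk.eq_nil_iff_nil.2 (Walk.isPath_iff_nil.1 hp.1)]
    simp

theorem mem_edges_start_unique {u v y z : V} {p : G.Walk u v} (hp : p.IsPath)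
    (hy : s(u, y) ∈ p.edges) (hz : s(u, z) ∈ p.edges) : y = z := by
  cases p with
  | nil => simp at hy
  | cons huw p =>
    rename_i w
    rw [Walk.cons_isPath_iff] at hp
    have key : ∀ t, s(u, t) ∈ (Walk.cons huw p).edges → t = w := by
      intro t h
      rw [Walk.edges_cons, List.mem_cons] at h
      rcases h with h | h
      · exact Sym2.congr_right.1 h
      · exact absurd (p.fst_mem_support_of_mem_edges h) hp.2
    rw [key y hy, key z hz]

theorem eq_of_edges_eq {u v : V} : ∀ {p q : G.Walk u v}, p.edges = q.edges → p = q := by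
  intro p
  induction p with
  | nil => intro q h; cases q with
    | nil => rfl
    | cons _ _ => simp at h
  | cons h p ih =>
    intro q hq
    cases q with
    | nil => simp at hq
    | cons h' q =>
      rw [Walk.edges_cons, Walk.edges_cons, List.cons.injEq] at hq
      obtain rfl := Sym2.congr_right.1 hq.1
      rw [ih hq.2]

/-- `p` and `q` are distinct internally disjoint paths, on each of which `col` is injective. -/
structure IsRainbowPair (col : Sym2 V → K) {u v : V} (p q : G.Walk u v) : Prop where
  left_isPath : p.IsPath
  right_isPath : q.IsPath
  ne : p ≠ q
  disjoint : ∀ w ∈ p.support, w ∈ q.support → w = u ∨ w = v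
  left_inj : ∀ e ∈ p.edges, ∀ f ∈ p.edges, col e = col f → e = f
  right_inj : ∀ e ∈ q.edges, ∀ f ∈ q.edges, col e = col f → e = f

variable {col : Sym2 V → K} {u v : V} {p q : G.Walk u v}

theorem IsRainbowPair.swap (h : IsRainbowPair col p q) : IsRainbowPair col q p :=
  ⟨h.2, h.1, h.3.symm, fun w h1 h2 => h.4 w h2 h1, h.6, h.5⟩

theorem IsRainbowPair.reverse (h : IsRainbowPair col p q) :
    IsRainbowPair col p.reverse q.reverse :=
  ⟨h.1.reverse, h.2.reverse, fun h' => h.3 (Walk.reverse_injective h'),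
    fun w h1 h2 => (h.4 w (by simpa using h1) (by simpa using h2)).symm,
    by simpa using h.5, by simpa using h.6⟩

/-- A common edge has both ends in `{u, v}`, so it is `uv`; then each path consists of this edge
alone and the paths coincide. -/
theorem IsRainbowPair.edges_disjoint (h : IsRainbowPair col p q) {e : Sym2 V}
    (hp : e ∈ p.edges) (hq : e ∈ q.edges) : False := by
  induction e with
  | h x y =>
    have hxy : x ≠ y := (p.adj_of_mem_edges hp).ne
    have huv : s(u, v) = s(x, y) := by
      rcases h.disjoint x (p.fst_mem_support_of_mem_edges hp) (q.fst_mem_support_of_mem_edges hq)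
        with rfl | rfl <;>
      rcases h.disjoint y (p.snd_mem_support_of_mem_edges hp) (q.snd_mem_support_of_mem_edges hq)
        with rfl | rfl
      · exact absurd rfl hxy
      · rfl
      · exact Sym2.eq_swap
      · exact absurd rfl hxy
    rw [← huv] at hp hq
    exact h.ne (eq_of_edges_eq ((edges_eq_singleton h.1 hp).trans (edges_eq_singleton h.2 hq).symm))

theorem exists_mem_edges_start (huv : u ≠ v) (p : G.Walk u v) : ∃ y, s(u, y) ∈ p.edges := by
  cases p with
  | nil => exact absurd rfl huv
  | cons h p => exact ⟨_, List.mem_cons_self⟩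

variable [Fintype V] [DecidableRel G.Adj]

theorem eq_or_eq_of_degree_le_two {x a b c : V} (hx : G.degree x ≤ 2) (ha : G.Adj x a)
    (hb : G.Adj x b) (hc : G.Adj x c) (hab : a ≠ b) : c = a ∨ c = b := by
  classical
  by_contra! h
  have h1 : ({a, b, c} : Finset V) ⊆ G.neighborFinset x := by
    intro y hy
    simp only [Finset.mem_insert, Finset.mem_singleton] at hy
    rcases hy with rfl | rfl | rfl <;> simpa
  have h2 := Finset.card_le_card h1
  rw [G.card_neighborFinset_eq_degree, Finset.card_eq_three.2
    ⟨a, b, c, hab, h.1.symm, h.2.symm, rfl⟩] at h2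
  omega

/-- A path uses two edges at each inner vertex, hence every edge there if the degree is at most two.
All lower bounds for more than two colours exploit this. -/
theorem mem_edges_of_degree_le_two {x y : V} (hp : p.IsPath) (hx : x ∈ p.support) (hu : x ≠ u)
    (hv : x ≠ v) (hd : G.degree x ≤ 2) (hxy : G.Adj x y) : s(x, y) ∈ p.edges := by
  obtain ⟨a, b, hab, ha, hb⟩ := exists_mem_edges_pair hp hx hu hv
  rcases eq_or_eq_of_degree_le_two hd (p.adj_of_mem_edges ha) (p.adj_of_mem_edges hb) hxy hab
    with rfl | rfl <;> assumption

/-- The two paths leave `u` by different edges, so they exhaust the edges at an end of degree two.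
-/
theorem IsRainbowPair.mem_edges_start (h : IsRainbowPair col p q) (huv : u ≠ v)
    (hd : G.degree u ≤ 2) {y : V} (hy : G.Adj u y) : s(u, y) ∈ p.edges ∨ s(u, y) ∈ q.edges := by
  obtain ⟨a, ha⟩ := exists_mem_edges_start huv p
  obtain ⟨b, hb⟩ := exists_mem_edges_start huv q
  have hab : a ≠ b := by rintro rfl; exact h.edges_disjoint ha hb
  rcases eq_or_eq_of_degree_le_two hd (p.adj_of_mem_edges ha) (q.adj_of_mem_edges hb) hy hab
    with rfl | rfl
  · exact .inl ha
  · exact .inr hb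

theorem IsRainbowPair.mem_edges_end (h : IsRainbowPair col p q) (huv : u ≠ v)
    (hd : G.degree v ≤ 2) {y : V} (hy : G.Adj v y) : s(v, y) ∈ p.edges ∨ s(v, y) ∈ q.edges := by
  simpa using h.reverse.mem_edges_start huv.symm hd hy

theorem IsRainbowPair.two_le_degree (h : IsRainbowPair col p q) (huv : u ≠ v) :
    2 ≤ G.degree u := by
  classical
  obtain ⟨a, ha⟩ := exists_mem_edges_start huv p
  obtain ⟨b, hb⟩ := exists_mem_edges_start huv q
  have hab : a ≠ b := by rintro rfl; exact h.edges_disjoint ha hb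
  rw [← G.card_neighborFinset_eq_degree, ← Finset.card_pair hab]
  refine Finset.card_le_card fun z hz => ?_
  simp only [Finset.mem_insert, Finset.mem_singleton] at hz
  rcases hz with rfl | rfl
  · simpa using p.adj_of_mem_edges ha
  · simpa using q.adj_of_mem_edges hb

end Pairs

/-- `col` joins any two vertices by a pair of internally disjoint rainbow paths. -/
def IsRainbowLinked {V K : Type*} (G : SimpleGraph V) (col : Sym2 V → K) : Prop :=
  ∀ u v : V, u ≠ v → ∃ p q : G.Walk u v, IsRainbowPair col p q

/-- The colouring is extended to all unordered pairs. Non-edges get the default colour 0, which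
requires `1 ≤ r` and never occurs on a walk for this reason. -/
theorem exists_isRainbowLinked {n r e : ℕ} (hr : 1 ≤ r) (he : e ∈ edgeCounts 2 n r) :
    ∃ (G : SimpleGraph (Fin n)) (col : Sym2 (Fin n) → Fin r), IsRainbowLinked G col ∧
      G.edgeSet.ncard = e := by
  classical
  obtain ⟨G, -, hrc, hcard⟩ := he
  obtain ⟨c, hc⟩ := exists_isRainbowKConnected_of_rc_le hrc
  refine ⟨G, fun e => if h : e ∈ G.edgeSet then c ⟨e, h⟩ else ⟨0, hr⟩, fun u v huv => ?_, hcard⟩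
  obtain ⟨P, hP, hP'⟩ := hc u v huv
  have key : ∀ i, ∀ e ∈ (P i).edges, ∀ f ∈ (P i).edges,
      (if h : e ∈ G.edgeSet then c ⟨e, h⟩ else ⟨0, hr⟩) =
        (if h : f ∈ G.edgeSet then c ⟨f, h⟩ else ⟨0, hr⟩) → e = f := by
    intro i e he f hf h
    rw [dif_pos ((P i).edges_subset_edgeSet he), dif_pos ((P i).edges_subset_edgeSet hf)] at h
    exact congrArg Subtype.val ((hP i).2 _ _ he hf h)
  exact ⟨P 0, P 1, (hP 0).1, (hP 1).1, (hP' 0 1 (by decide)).1, (hP' 0 1 (by decide)).2,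
    key 0, key 1⟩

namespace IsRainbowLinked

variable {V K : Type*} [Fintype V] {G : SimpleGraph V} [DecidableRel G.Adj] {col : Sym2 V → K}

theorem two_le_degree (h : IsRainbowLinked G col) [Nontrivial V] (u : V) : 2 ≤ G.degree u := by
  obtain ⟨v, hv⟩ := exists_ne u
  obtain ⟨p, q, hpq⟩ := h u v hv.symm
  exact hpq.two_le_degree hv.symm

theorem exists_mem_left (h : IsRainbowLinked G col) {u v y : V} (huv : u ≠ v)
    (hd : G.degree u ≤ 2) (hy : G.Adj u y) :
    ∃ p q : G.Walk u v, IsRainbowPair col p q ∧ s(u, y) ∈ p.edges := by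
  obtain ⟨p, q, hpq⟩ := h u v huv
  rcases hpq.mem_edges_start huv hd hy with h1 | h1
  · exact ⟨p, q, hpq, h1⟩
  · exact ⟨q, p, hpq.swap, h1⟩

theorem col_ne_of_degree_le_two (h : IsRainbowLinked G col) {w x y : V} (hxy : G.Adj x y)
    (hwx : G.Adj w x) (hwy : w ≠ y) (hx : G.degree x ≤ 2) (hy : G.degree y ≤ 2) :
    col s(x, y) ≠ col s(w, x) := by
  obtain ⟨p, q, hpq, h1⟩ := h.exists_mem_left hwy.symm hy hxy.symm
  have h2 := mem_edges_of_degree_le_two hpq.1 (p.snd_mem_support_of_mem_edges h1) hxy.ne hwx.ne' hx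
    hwx.symm
  intro h3
  have h4 := hpq.left_inj _ h1 _ h2 (by rw [Sym2.eq_swap, h3, Sym2.eq_swap])
  rw [Sym2.eq_swap] at h4
  exact hwy (Sym2.congr_right.1 h4).symm

theorem inner_edge_eq (h : IsRainbowLinked G col) {w x y w' x' y' : V} (hxy : G.Adj x y)
    (hwx : G.Adj w x) (hwy : w ≠ y) (hx : G.degree x ≤ 2) (hy : G.degree y ≤ 2)
    (hxy' : G.Adj x' y') (hwx' : G.Adj w' x') (hwy' : w' ≠ y') (hx' : G.degree x' ≤ 2)
    (hy' : G.degree y' ≤ 2) (hα : col s(x, y) = col s(x', y'))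
    (hβ : col s(w, x) = col s(w', x')) : s(x, y) = s(x', y') := by
  by_contra hne
  have hαβ := h.col_ne_of_degree_le_two hxy hwx hwy hx hy
  have hxy'_ne : x ≠ y' := by
    rintro rfl
    rcases eq_or_eq_of_degree_le_two hx hwx.symm hxy hxy'.symm hwy with rfl | rfl
    · exact hαβ hα
    · exact hne Sym2.eq_swap
  obtain ⟨p, q, hpq, hp⟩ := h.exists_mem_left hxy'_ne hx hxy
  have hq : s(x, w) ∈ q.edges := by
    rcases hpq.mem_edges_start hxy'_ne hx hwx.symm with h1 | h1
    · exact absurd (mem_edges_start_unique hpq.1 hp h1) hwy.symm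
    · exact h1
  have hq' : s(x', y') ∈ q.edges := by
    rcases hpq.mem_edges_end hxy'_ne hy' hxy'.symm with h1 | h1
    · rw [Sym2.eq_swap] at h1
      exact absurd (hpq.left_inj _ hp _ h1 hα) hne
    · rwa [Sym2.eq_swap]
  have hxx' : x' ≠ x := by
    rintro rfl
    rcases eq_or_eq_of_degree_le_two hx hwx.symm hxy hxy' hwy with rfl | rfl
    · exact hαβ (by rw [hα, Sym2.eq_swap])
    · exact hne rfl
  have hw' := mem_edges_of_degree_le_two hpq.2 (q.fst_mem_support_of_mem_edges hq') hxx'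
    hxy'.ne hx' hwx'.symm
  have h1 := hpq.right_inj _ hq _ hw' (by rw [Sym2.eq_swap, hβ, Sym2.eq_swap])
  obtain ⟨-, rfl⟩ : w' = x ∧ w = x' := by
    rcases Sym2.eq_iff.1 h1 with h2 | h2
    · exact absurd h2.1.symm hxx'
    · exact ⟨h2.1.symm, h2.2⟩
  obtain rfl : x = w' := by
    rcases Sym2.eq_iff.1 h1 with h2 | h2
    · exact absurd h2.1.symm hxx'
    · exact h2.1
  -- Now y, x, x', y' are consecutive. If they close to a triangle, its two edges at `y` have equal
  -- colours; otherwise a rainbow path from `y` to `y'` runs along all three edges and repeats a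
  -- colour.
  by_cases hyy : y = y'
  · subst hyy
    exact h.col_ne_of_degree_le_two (w := x) hxy'.symm hxy hxx'.symm hy hx'
      (by rw [Sym2.eq_swap, ← hα])
  · obtain ⟨p, q, hpq, hp⟩ := h.exists_mem_left hyy hy hxy.symm
    have h2 := mem_edges_of_degree_le_two hpq.1 (p.snd_mem_support_of_mem_edges hp) hxy.ne hxy'_ne
      hx hwx'
    have h3 := mem_edges_of_degree_le_two hpq.1 (p.snd_mem_support_of_mem_edges h2) hwy hxy'.ne
      hx' hxy'
    exact hne ((Sym2.eq_swap).trans (hpq.left_inj _ hp _ h3 (by rw [Sym2.eq_swap, hα])))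

end IsRainbowLinked

/-! ### The lower bound for general r -/

/-- The number of vertices of degree two. -/
theorem two_mul_card_degree_two_le {V : Type*} [Fintype V] [DecidableEq V] (G : SimpleGraph V)
    [DecidableRel G.Adj] :
    2 * #{v | G.degree v = 2} ≤
      #G.edgeFinset + #{e ∈ G.edgeFinset | ∀ v ∈ e, G.degree v = 2} := by
  calc 2 * #{v | G.degree v = 2} = ∑ v with G.degree v = 2, #{e ∈ G.edgeFinset | v ∈ e} := by
        rw [Finset.sum_congr rfl (g := fun _ => 2), Finset.sum_const, smul_eq_mul, mul_comm]
        intro v hv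
        rw [← (Finset.mem_filter.1 hv).2, ← G.card_incidenceFinset_eq_degree,
          G.incidenceFinset_eq_filter]
    _ = ∑ e ∈ G.edgeFinset, #{v | G.degree v = 2 ∧ v ∈ e} := by
        have := Finset.sum_card_bipartiteAbove_eq_sum_card_bipartiteBelow
          (s := ({v | G.degree v = 2} : Finset V)) (t := G.edgeFinset) (fun v e => v ∈ e)
        simpa only [Finset.bipartiteAbove, Finset.bipartiteBelow, Finset.filter_filter] using this
    -- An edge is counted twice only if both of its ends have degree two.
    _ ≤ ∑ e ∈ G.edgeFinset, (1 + if ∀ v ∈ e, G.degree v = 2 then 1 else 0) := by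
        refine Finset.sum_le_sum fun e _ => ?_
        induction e with
        | h x y =>
          split_ifs with h
          · refine (Finset.card_le_card (t := {x, y}) fun v hv => ?_).trans Finset.card_le_two
            simpa using (Finset.mem_filter.1 hv).2.2
          · refine Finset.card_le_one.2 fun a ha b hb => ?_
            simp only [Finset.mem_filter, Finset.mem_univ, true_and, Sym2.mem_iff] at ha hb
            simp only [Sym2.mem_iff, forall_eq_or_imp, forall_eq] at h
            grind
    _ = _ := by rw [Finset.sum_add_distrib, Finset.sum_const, smul_eq_mul, mul_one,
        Finset.sum_ite, Finset.sum_const, Finset.sum_const_zero, smul_eq_mul, mul_one, add_zero]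

theorem IsRainbowLinked.card_inner_le {V K : Type*} [Fintype V] [Nonempty V] [DecidableEq V] [Fintype K]
    [DecidableEq K] {G : SimpleGraph V} [DecidableRel G.Adj] {col : Sym2 V → K}
    (h : IsRainbowLinked G col) :
    #{e ∈ G.edgeFinset | ∀ v ∈ e, G.degree v = 2} ≤
      Fintype.card K * (Fintype.card K - 1) := by
  have key : ∀ e : Sym2 V, e ∈ G.edgeFinset.filter (fun e => ∀ v ∈ e, G.degree v = 2) →
      ∃ w x y, G.Adj x y ∧ G.Adj w x ∧ w ≠ y ∧ G.degree x = 2 ∧ G.degree y = 2 ∧ e = s(x, y) := by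
    intro e he
    induction e with
    | h x y =>
      simp only [Finset.mem_filter, mem_edgeFinset, mem_edgeSet, Sym2.mem_iff, forall_eq_or_imp,
        forall_eq] at he
      obtain ⟨hxy, hx, hy⟩ := he
      have h1 : 1 < #(G.neighborFinset x) := by rw [G.card_neighborFinset_eq_degree]; omega
      obtain ⟨w, hw, hwy⟩ := Finset.exists_mem_ne h1 y
      exact ⟨w, x, y, hxy, by simpa using ((G.mem_neighborFinset _ _).1 hw).symm, hwy, hx, hy, rfl⟩
  choose! w x y h1 h2 h3 h4 h5 h6 using key
  rw [Nat.mul_sub, mul_one, ← Finset.card_univ, ← Finset.offDiag_card]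
  refine Finset.card_le_card_of_injOn (fun e => (col s(x e, y e), col s(w e, x e))) ?_ ?_
  · intro e he
    simpa using h.col_ne_of_degree_le_two (h1 e he) (h2 e he) (h3 e he) (h4 e he).le (h5 e he).le
  · intro e he f hf hef
    simp only [Prod.mk.injEq] at hef
    rw [h6 e he, h6 f hf]
    exact h.inner_edge_eq (h1 e he) (h2 e he) (h3 e he) (h4 e he).le (h5 e he).le
      (h1 f hf) (h2 f hf) (h3 f hf) (h4 f hf).le (h5 f hf).le hef.1 hef.2

/-- With e edges and n₂ vertices of degree two, 3n ≤ 2e + n₂ and 2n₂ ≤ e + r(r - 1); eliminating n₂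
gives the bound. -/
theorem six_mul_le_five_mul_t {n r : ℕ} (hn : 4 ≤ n) (hr : 2 ≤ r) :
    6 * n ≤ 5 * t 2 n r + r * (r - 1) := by
  classical
  obtain ⟨G, col, h, he⟩ := exists_isRainbowLinked (by omega) (t_mem_edgeCounts hn hr)
  have hnt : Nontrivial (Fin n) := Fin.nontrivial_iff_two_le.2 (by omega)
  rw [← he, Set.ncard_eq_toFinset_card']
  change 6 * n ≤ 5 * #G.edgeFinset + r * (r - 1)
  have h1 := two_mul_card_degree_two_le G
  have h2 := h.card_inner_le
  have h3 : ∑ v, 3 ≤ ∑ v, (G.degree v + if G.degree v = 2 then 1 else 0) :=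
    Finset.sum_le_sum fun v _ => by have := h.two_le_degree v; split_ifs <;> omega
  rw [Finset.sum_add_distrib, G.sum_degrees_eq_twice_card_edges, Finset.sum_ite, Finset.sum_const,
    Finset.sum_const, Finset.sum_const_zero, Finset.card_univ] at h3
  simp only [Fintype.card_fin, smul_eq_mul, mul_one, add_zero] at h2 h3
  omega

end RainbowConnection

namespace RainbowConnection
open SimpleGraph Finset

/-! ### Four colours: cherries -/

section

variable {V K : Type*} {G : SimpleGraph V} {u v : V}

theorem length_le_card_of_injOn [Fintype K] {col : Sym2 V → K} {p : G.Walk u v} (hp : p.IsPath)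
    (h : ∀ e ∈ p.edges, ∀ f ∈ p.edges, col e = col f → e = f) : p.length ≤ Fintype.card K := by
  have h1 : (p.edges.map col).Nodup := hp.isTrail.edges_nodup.map_on h
  have h2 := h1.length_le_card
  simpa using h2

theorem exists_of_length_le_four {a : V} {p : G.Walk u v} (hp : p.IsPath) (hl : p.length ≤ 4)
    (ha : s(u, a) ∈ p.edges) (hav : a ≠ v) :
    ∃ b, s(a, b) ∈ p.edges ∧ b ≠ u ∧ (b = v ∨ (b ≠ v ∧ s(b, v) ∈ p.edges) ∨
      ∃ w, s(b, w) ∈ p.edges ∧ s(w, v) ∈ p.edges ∧ [u, a, b, w, v].Nodup) := by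
  cases p with
  | nil => simp at ha
  | cons h p =>
    rename_i a'
    obtain rfl : a' = a := mem_edges_start_unique hp (by simp) ha
    cases p with
    | nil => exact absurd rfl hav
    | cons h p =>
      rename_i b
      refine ⟨b, by simp, ?_, ?_⟩
      · rintro rfl
        have := hp.support_nodup
        simp at this
      cases p with
      | nil => exact .inl rfl
      | cons h p =>
        rename_i w
        right
        cases p with
        | nil => exact .inl ⟨h.ne, by simp⟩
        | cons h p =>
          rename_i t
          cases p with
          | nil =>
            refine .inr ⟨w, by simp, by simp, ?_⟩
            simpa using hp.support_nodup
          | cons h p => simp at hl; omega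

theorem mem_edges_end_unique {y z : V} {p : G.Walk u v} (hp : p.IsPath)
    (hy : s(v, y) ∈ p.edges) (hz : s(v, z) ∈ p.edges) : y = z :=
  mem_edges_start_unique hp.reverse (by simpa using hy) (by simpa using hz)

end

/-- A vertex `a` of degree three with neighbours `x`, `y`, `z`, of which `x` and `y` have degree
two and further neighbours `x'` and `y'`. -/
structure IsCherry {V : Type*} [Fintype V] (G : SimpleGraph V) [DecidableRel G.Adj]
    (a x y z x' y' : V) : Prop where
  adj_x : G.Adj a x
  adj_y : G.Adj a y
  adj_z : G.Adj a z
  xy : x ≠ y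
  xz : x ≠ z
  yz : y ≠ z
  eq_of_adj : ∀ w, G.Adj a w → w = x ∨ w = y ∨ w = z
  degree_a : G.degree a = 3
  degree_x : G.degree x = 2
  degree_y : G.degree y = 2
  adj_x' : G.Adj x x'
  adj_y' : G.Adj y y'
  x'_ne : x' ≠ a
  y'_ne : y' ≠ a

section

variable {V K : Type*} [Fintype V] {G : SimpleGraph V} [DecidableRel G.Adj]
  {a x y z x' y' : V} {col : Sym2 V → K}

theorem IsCherry.swap (h : IsCherry G a x y z x' y') : IsCherry G a y x z y' x' :=
  ⟨h.2, h.1, h.3, h.4.symm, h.6, h.5, fun w hw => by have := h.7 w hw; tauto, h.8, h.10, h.9, h.12,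
    h.11, h.14, h.13⟩

theorem IsCherry.eq_of_adj_y (h : IsCherry G a x y z x' y') {w : V} (hw : G.Adj y w) :
    w = a ∨ w = y' :=
  eq_or_eq_of_degree_le_two h.degree_y.le h.adj_y.symm h.adj_y' hw h.y'_ne.symm

/-- Equally coloured edges at `u` and `v` lie on different paths, so the path starting with one of
them ends with the other edge at `v`. -/
theorem IsRainbowLinked.exists_opposite (h : IsRainbowLinked G col) {u v u' v' a b : V}
    (hu : G.degree u = 2) (hv : G.degree v = 2) (huv : u ≠ v) (hua : G.Adj u a) (huu : G.Adj u u')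
    (hua' : u' ≠ a) (hvb : G.Adj v b) (hvv : G.Adj v v') (hvb' : v' ≠ b)
    (hc : col s(u, a) = col s(v, b)) (hne : s(u, a) ≠ s(v, b)) :
    ∃ p q : G.Walk u v, IsRainbowPair col p q ∧ s(u, a) ∈ p.edges ∧ s(v, v') ∈ p.edges ∧
      s(u, u') ∈ q.edges := by
  obtain ⟨p, q, hpq, hp⟩ := h.exists_mem_left huv hu.le hua
  refine ⟨p, q, hpq, hp, ?_, ?_⟩
  · obtain ⟨t, ht⟩ := exists_mem_edges_start huv.symm p.reverse
    simp only [Walk.edges_reverse, List.mem_reverse] at ht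
    rcases eq_or_eq_of_degree_le_two hv.le hvb hvv (p.adj_of_mem_edges ht) hvb'.symm
      with rfl | rfl
    · exact absurd (hpq.left_inj _ hp _ ht hc) hne
    · exact ht
  · refine (hpq.mem_edges_start huv hu.le huu).resolve_left fun h1 => ?_
    exact hua' (mem_edges_start_unique hpq.1 h1 hp)

/-- If `u' = v'`, this would be an inner vertex of both paths; if `v' = u`, the path starting with
`ua` would be the single edge `uv`. -/
theorem IsRainbowLinked.ne_of_opposite (h : IsRainbowLinked G col) {u v u' v' a b : V}
    (hu : G.degree u = 2) (hv : G.degree v = 2) (huv : u ≠ v) (hua : G.Adj u a) (huu : G.Adj u u')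
    (hua' : u' ≠ a) (hvb : G.Adj v b) (hvv : G.Adj v v') (hvb' : v' ≠ b)
    (hc : col s(u, a) = col s(v, b)) (hne : s(u, a) ≠ s(v, b)) (hav : a ≠ v) :
    u' ≠ v' ∧ v' ≠ u := by
  obtain ⟨p, q, hpq, h1, h2, h3⟩ := h.exists_opposite hu hv huv hua huu hua' hvb hvv hvb' hc hne
  refine ⟨?_, ?_⟩
  · rintro rfl
    rcases hpq.disjoint u' (p.snd_mem_support_of_mem_edges h2) (q.snd_mem_support_of_mem_edges h3)
      with rfl | rfl
    · exact huu.ne rfl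
    · exact hvv.ne rfl
  · rintro rfl
    rw [edges_eq_singleton hpq.1 (by rwa [Sym2.eq_swap])] at h1
    exact hav (Sym2.congr_right.1 (List.mem_singleton.1 h1))

/-- The centre cannot be an inner vertex of both paths from `x` to `y`, so one path contains both
edges. -/
theorem IsCherry.col_ne (h : IsRainbowLinked G col) (hc : IsCherry G a x y z x' y') :
    col s(a, x) ≠ col s(a, y) := by
  intro h1
  obtain ⟨p, q, hpq, h2⟩ := h.exists_mem_left hc.xy hc.degree_x.le hc.adj_x.symm
  have h3 : s(y, a) ∈ p.edges := by
    refine (hpq.mem_edges_end hc.xy hc.degree_y.le hc.adj_y.symm).resolve_right fun h3 => ?_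
    rcases hpq.disjoint a (p.snd_mem_support_of_mem_edges h2) (q.snd_mem_support_of_mem_edges h3)
      with rfl | rfl
    · exact hc.adj_x.ne rfl
    · exact hc.adj_y.ne rfl
  have h4 := hpq.left_inj _ h2 _ h3 (by rw [Sym2.eq_swap, h1, Sym2.eq_swap])
  exact hc.xy (Sym2.congr_left.1 h4)

variable [DecidableEq V]

/-- If two edges at the centre of a cherry share their colour, some vertex has large degree. -/
theorem IsCherry.card_le_degree_add [Fintype K] (hK : Fintype.card K = 4)
    (h : IsRainbowLinked G col) (hc : IsCherry G a x y z x' y')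
    (hcol : col s(a, x) = col s(a, z)) : Fintype.card V ≤ G.degree y' + 5 := by
  -- A rainbow path from `x` through `a` cannot go on to `z`, where the colour repeats. It goes to
  -- `y` and `y'`, and then length four leaves only one more edge, to `v`.
  have key : ∀ v, v ∉ ({x, a, y, z, y'} : Finset V) → G.Adj y' v := by
    intro v hv
    simp only [Finset.mem_insert, Finset.mem_singleton, not_or] at hv
    obtain ⟨hvx, hva, hvy, hvz, hvy'⟩ := hv
    obtain ⟨p, q, hpq, h1⟩ := h.exists_mem_left (Ne.symm hvx) hc.degree_x.le hc.adj_x.symm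
    have hl := length_le_card_of_injOn hpq.1 hpq.left_inj
    rw [hK] at hl
    obtain ⟨b, hb, hbx, hb'⟩ := exists_of_length_le_four hpq.1 hl h1 (Ne.symm hva)
    rcases hc.eq_of_adj b (p.adj_of_mem_edges hb) with rfl | rfl | rfl
    · exact absurd rfl hbx
    · rcases hb' with rfl | ⟨-, hb'⟩ | ⟨w, hw, hw', hnd⟩
      · exact absurd rfl hvy
      · rcases hc.eq_of_adj_y (p.adj_of_mem_edges hb') with rfl | rfl
        · exact absurd rfl hva
        · exact absurd rfl hvy'
      · rcases hc.eq_of_adj_y (p.adj_of_mem_edges hw) with rfl | rfl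
        · simp at hnd
        · exact p.adj_of_mem_edges hw'
    · have h4 := hpq.left_inj _ h1 _ hb (by rw [Sym2.eq_swap, hcol])
      rw [Sym2.eq_swap] at h4
      exact absurd (Sym2.congr_right.1 h4).symm hbx
  have h1 : univ \ ({x, a, y, z, y'} : Finset V) ⊆ G.neighborFinset y' := fun v hv => by
    rw [mem_neighborFinset]
    exact key v (Finset.mem_sdiff.1 hv).2
  have h2 := Finset.card_le_card h1
  rw [G.card_neighborFinset_eq_degree] at h2
  have h3 := Finset.le_card_sdiff ({x, a, y, z, y'} : Finset V) univ
  rw [Finset.card_univ] at h3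
  have h4 : #({x, a, y, z, y'} : Finset V) ≤ 5 := Finset.card_le_five
  omega

/-- Two cherries with the same colours are close to each other. -/
theorem IsCherry.close_of_col_eq {V : Type*} [Fintype V] {G : SimpleGraph V} [DecidableRel G.Adj]
    {col : Sym2 V → Fin 4} {a x y z x' y' b x₁ y₁ z₁ x₁' y₁' : V}
    (h : IsRainbowLinked G col) (hi : IsCherry G a x y z x' y')
    (hj : IsCherry G b x₁ y₁ z₁ x₁' y₁') (hx : col s(a, x) = col s(b, x₁))
    (hy : col s(a, y) = col s(b, y₁)) (hz : col s(a, z) = col s(b, z₁))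
    (hxz : col s(a, x) ≠ col s(a, z)) (hyz : col s(a, y) ≠ col s(a, z)) :
    y₁ = z ∨ y₁ = x ∨ y₁ = y ∨ y₁' = x ∨ y₁' = z ∨ y₁' = x' ∨ b = z := by
  by_contra! hcon
  obtain ⟨hy₁z, hy₁x, hy₁y, hy₁'x, hy₁'z, hy₁'x', hbz⟩ := hcon
  have hxy := hi.col_ne h
  have hay₁ : a ≠ y₁ := by
    rintro rfl
    have := hi.degree_a.symm.trans hj.degree_y
    omega
  have hby : b ≠ y := by
    rintro rfl
    have := hj.degree_a.symm.trans hi.degree_y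
    omega
  have hcy : col s(y, a) = col s(y₁, b) := by rw [Sym2.eq_swap, hy, Sym2.eq_swap]
  have hne : s(y, a) ≠ s(y₁, b) := fun h1 => by
    rcases Sym2.eq_iff.1 h1 with h2 | h2
    · exact hy₁y h2.1.symm
    · exact hby h2.1.symm
  have hopp := h.ne_of_opposite hi.degree_y hj.degree_y (Ne.symm hy₁y) hi.adj_y.symm hi.adj_y'
    hi.y'_ne hj.adj_y.symm hj.adj_y' hj.y'_ne hcy hne hay₁
  obtain ⟨p, q, hpq, hp, hp', -⟩ := h.exists_opposite hi.degree_y hj.degree_y (Ne.symm hy₁y)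
    hi.adj_y.symm hi.adj_y' hi.y'_ne hj.adj_y.symm hj.adj_y' hj.y'_ne hcy hne
  have hl := length_le_card_of_injOn hpq.1 hpq.left_inj
  rw [Fintype.card_fin] at hl
  obtain ⟨c, hc, hcy', hc'⟩ := exists_of_length_le_four hpq.1 hl hp hay₁
  -- Length four and the excluded coincidences force the path from `y` through `a` to be y, a, z,
  -- y₁', y₁.
  have hcols : s(z, y₁') ∈ G.edgeSet ∧
      [col s(a, y), col s(a, z), col s(z, y₁'), col s(y₁', y₁)].Nodup := by
    have hlast : ∀ w, s(w, y₁) ∈ p.edges → w = y₁' := fun w hw =>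
      mem_edges_end_unique hpq.1 (by rwa [Sym2.eq_swap]) hp'
    rcases hi.eq_of_adj c (p.adj_of_mem_edges hc) with rfl | rfl | rfl
    · exfalso
      rcases hc' with rfl | ⟨-, hc'⟩ | ⟨w, hw, hw', hnd⟩
      · exact hy₁x rfl
      · exact hy₁'x (hlast _ hc').symm
      · rcases hi.swap.eq_of_adj_y (p.adj_of_mem_edges hw) with rfl | rfl
        · simp at hnd
        · exact hy₁'x' (hlast _ hw').symm
    · exact absurd rfl hcy'
    · rcases hc' with rfl | ⟨-, hc'⟩ | ⟨w, hw, hw', hnd⟩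
      · exact absurd rfl hy₁z
      · exact absurd (hlast _ hc').symm hy₁'z
      · obtain rfl := hlast _ hw'
        refine ⟨p.adj_of_mem_edges hw, ?_⟩
        have hnd' : ([s(y, a), s(a, c), s(c, w), s(w, y₁)].map col).Nodup := by
          refine List.Nodup.map_on (fun e he f hf => hpq.left_inj e ?_ f ?_) ?_
          · simp only [List.mem_cons, List.not_mem_nil, or_false] at he
            rcases he with rfl | rfl | rfl | rfl <;> assumption
          · simp only [List.mem_cons, List.not_mem_nil, or_false] at hf
            rcases hf with rfl | rfl | rfl | rfl <;> assumption
          · simp only [List.nodup_cons, List.mem_cons, List.not_mem_nil, or_false, not_or,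
              List.nodup_nil, not_false_eq_true, and_true, Sym2.eq_iff] at hnd ⊢
            grind
        rw [Sym2.eq_swap (a := a) (b := y)]
        exact hnd'
  obtain ⟨hzy₁', hcols⟩ := hcols
  clear hc' hcy' hc hl hp' hp hpq c p q
  -- Next `x` is linked with `y₁`, again along the path that starts with `xa`.
  obtain ⟨p, q, hpq, hp⟩ := h.exists_mem_left (Ne.symm hy₁x) hi.degree_x.le hi.adj_x.symm
  have hl := length_le_card_of_injOn hpq.1 hpq.left_inj
  rw [Fintype.card_fin] at hl
  obtain ⟨c, hc, hcx, hc'⟩ := exists_of_length_le_four hpq.1 hl hp hay₁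
  rcases hi.eq_of_adj c (p.adj_of_mem_edges hc) with rfl | rfl | rfl
  · exact absurd rfl hcx
  -- Going on through `y`, the path cannot end with `b y₁`, which repeats the colour of `ay`. Ending
  -- with `y₁' y₁` is ruled out by `hopp`.
  · have hlast : ∀ w, s(w, y₁) ∈ p.edges → w = y₁' := fun w hw => by
      refine (hj.eq_of_adj_y (p.adj_of_mem_edges hw).symm).resolve_left ?_
      rintro rfl
      have := hpq.left_inj _ hc _ hw hy
      exact hne (Sym2.eq_swap.trans (this.trans Sym2.eq_swap))
    rcases hc' with rfl | ⟨-, hc'⟩ | ⟨w, hw, hw', hnd⟩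
    · exact hy₁y rfl
    · exact hopp.2 (hlast _ hc').symm
    · rcases hi.eq_of_adj_y (p.adj_of_mem_edges hw) with rfl | rfl
      · simp at hnd
      · exact hopp.1 (hlast _ hw')
  · rcases hc' with rfl | ⟨-, hc'⟩ | ⟨w, hw, hw', hnd⟩
    · exact hy₁z rfl
    · rcases hj.eq_of_adj_y (p.adj_of_mem_edges hc').symm with rfl | rfl
      · exact hbz rfl
      · exact hy₁'z rfl
    · have hnd' : ([s(x, a), s(a, c), s(c, w), s(w, y₁)].map col).Nodup := by
        refine List.Nodup.map_on (fun e he f hf => hpq.left_inj e ?_ f ?_) ?_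
        · simp only [List.mem_cons, List.not_mem_nil, or_false] at he
          rcases he with rfl | rfl | rfl | rfl <;> assumption
        · simp only [List.mem_cons, List.not_mem_nil, or_false] at hf
          rcases hf with rfl | rfl | rfl | rfl <;> assumption
        · simp only [List.nodup_cons, List.mem_cons, List.not_mem_nil, or_false, not_or,
            List.nodup_nil, not_false_eq_true, and_true, Sym2.eq_iff] at hnd ⊢
          grind
      rw [Sym2.eq_swap (a := x) (b := a)] at hnd'
      simp only [List.map_cons, List.map_nil, List.nodup_cons, List.mem_cons, List.not_mem_nil,
        or_false, not_or, List.nodup_nil, not_false_eq_true, and_true] at hnd' hcols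
      rcases hj.eq_of_adj_y (p.adj_of_mem_edges hw').symm with rfl | rfl
      -- Here the path is x, a, z, b, y₁. The edge `zb` has one of the three colours at `b`, but
      -- those already occur on the path as the colours of `xa`, `az` and `b y₁`.
      · have h1 := hj.eq_of_adj c (p.adj_of_mem_edges hw).symm
        rw [Sym2.eq_swap (a := c) (b := w)] at hnd'
        rcases h1 with rfl | rfl | rfl
        · grind
        · grind
        · grind
      -- Here the path is x, a, z, y₁', y₁. Together with `hcols` this gives five pairwise distinct
      -- colours out of four.
      · generalize col s(a, x) = α at *
        generalize col s(a, y) = β at *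
        generalize col s(a, c) = γ at *
        generalize col s(c, w) = δ at *
        generalize col s(w, y₁) = ε at *
        omega


end

end RainbowConnection

/-! ### Counting cherries; the lower bound for three and four colours -/

namespace RainbowConnection
open SimpleGraph Finset

section

variable {V : Type*} [Fintype V] {G : SimpleGraph V} [DecidableRel G.Adj]

/-- The neighbours of degree two. -/
def degreeTwoNeighbors (G : SimpleGraph V) [DecidableRel G.Adj] (a : V) : Finset V :=
  {x ∈ G.neighborFinset a | G.degree x = 2}

theorem mem_degreeTwoNeighbors {a x : V} :
    x ∈ degreeTwoNeighbors G a ↔ G.Adj a x ∧ G.degree x = 2 := by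
  simp [degreeTwoNeighbors]

theorem exists_ne_of_degree_eq_two {x a : V} (hx : G.degree x = 2) :
    ∃ x', G.Adj x x' ∧ x' ≠ a := by
  have h1 : 1 < #(G.neighborFinset x) := by rw [G.card_neighborFinset_eq_degree]; omega
  obtain ⟨w, hw, hwy⟩ := Finset.exists_mem_ne h1 a
  exact ⟨w, (G.mem_neighborFinset _ _).1 hw, hwy⟩

variable [DecidableEq V] {col : Sym2 V → Fin 4}

-- Compare all such cherries with one of them, `i`. By `close_of_col_eq` each centre is `Z i`, or
-- has `Y` among three vertices, or has `Y'` among three. The fibres of `Y` have at most two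
-- elements and those of `Y'` at most one, so there are at most 1 + 3 · 2 + 3 centres.
open Classical in
theorem IsRainbowLinked.card_cherry_le (h : IsRainbowLinked G col) {α β γ : Fin 4} (hαγ : α ≠ γ)
    (hβγ : β ≠ γ) :
    #{a : V | ∃ x y z x' y', IsCherry G a x y z x' y' ∧ col s(a, x) = α ∧ col s(a, y) = β ∧
      col s(a, z) = γ} ≤ 10 := by
  set S : Finset V := {a : V | ∃ x y z x' y', IsCherry G a x y z x' y' ∧ col s(a, x) = α ∧
    col s(a, y) = β ∧ col s(a, z) = γ}
  rcases S.eq_empty_or_nonempty with h0 | ⟨i, hi⟩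
  · rw [h0]; simp
  have : Nonempty V := ⟨i⟩
  have hS : ∀ a ∈ S, ∃ x y z x' y', IsCherry G a x y z x' y' ∧ col s(a, x) = α ∧
      col s(a, y) = β ∧ col s(a, z) = γ := fun a ha => (Finset.mem_filter.1 ha).2
  choose! X Y Z X' Y' hC hα hβ hγ using hS
  -- All centres in the fibre are neighbours of a vertex of degree two.
  have hY : ∀ w, #(S.filter fun j => Y j = w) ≤ 2 := by
    intro w
    rcases (S.filter fun j => Y j = w).eq_empty_or_nonempty with h1 | ⟨j, hj⟩
    · rw [h1]; simp
    · rw [Finset.mem_filter] at hj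
      rw [← (hC j hj.1).degree_y, hj.2, ← G.card_neighborFinset_eq_degree]
      refine Finset.card_le_card fun k hk => ?_
      rw [Finset.mem_filter] at hk
      rw [mem_neighborFinset, ← hk.2]
      exact (hC k hk.1).adj_y.symm
  -- For different `Y` this is `ne_of_opposite`. If two centres share `Y`, each is the other
  -- neighbour of it, so their `Y'` differ.
  have hY' : ∀ w, #(S.filter fun j => Y' j = w) ≤ 1 := by
    intro w
    refine Finset.card_le_one.2 fun j hj k hk => ?_
    rw [Finset.mem_filter] at hj hk
    by_contra hjk
    have hj1 := hC j hj.1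
    have hk1 := hC k hk.1
    have hkY : k ≠ Y j := by
      intro h1
      have := hk1.degree_a
      rw [h1, hj1.degree_y] at this
      omega
    have hjY : j ≠ Y k := by
      intro h1
      have := hj1.degree_a
      rw [h1, hk1.degree_y] at this
      omega
    by_cases hy : Y j = Y k
    · have h1 : Y' j = k := by
        rcases hk1.eq_of_adj_y (hy ▸ hj1.adj_y') with h2 | h2
        · exact h2
        · rcases hj1.eq_of_adj_y (hy ▸ hk1.adj_y.symm) with h3 | h3
          · exact absurd h3.symm hjk
          · exact h3.symm
      exact hk1.y'_ne (by rw [hk.2, ← hj.2, h1])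
    · refine (h.ne_of_opposite hj1.degree_y hk1.degree_y hy hj1.adj_y.symm hj1.adj_y' hj1.y'_ne
        hk1.adj_y.symm hk1.adj_y' hk1.y'_ne ?_ ?_ hjY).1 (hj.2.trans hk.2.symm)
      · rw [Sym2.eq_swap, hβ j hj.1, Sym2.eq_swap, hβ k hk.1]
      · intro h1
        rcases Sym2.eq_iff.1 h1 with h2 | h2
        · exact hy h2.1
        · exact hkY h2.1.symm
  have hsub : S ⊆ {Z i} ∪ (S.filter (fun j => Y j = Z i) ∪ (S.filter (fun j => Y j = X i) ∪
      (S.filter (fun j => Y j = Y i) ∪ (S.filter (fun j => Y' j = X i) ∪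
      (S.filter (fun j => Y' j = Z i) ∪ S.filter (fun j => Y' j = X' i)))))) := by
    intro j hj
    have := (hC i hi).close_of_col_eq h (hC j hj) (by rw [hα i hi, hα j hj])
      (by rw [hβ i hi, hβ j hj]) (by rw [hγ i hi, hγ j hj]) (by rwa [hα i hi, hγ i hi])
      (by rwa [hβ i hi, hγ i hi])
    simp only [Finset.mem_union, Finset.mem_singleton, Finset.mem_filter, hj, true_and]
    tauto
  have h1 := Finset.card_le_card hsub
  have h2 := Finset.card_union_le {Z i} (S.filter (fun j => Y j = Z i) ∪
    (S.filter (fun j => Y j = X i) ∪ (S.filter (fun j => Y j = Y i) ∪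
    (S.filter (fun j => Y' j = X i) ∪ (S.filter (fun j => Y' j = Z i) ∪
    S.filter (fun j => Y' j = X' i))))))
  have h3 := Finset.card_union_le (S.filter (fun j => Y j = Z i))
    (S.filter (fun j => Y j = X i) ∪ (S.filter (fun j => Y j = Y i) ∪
    (S.filter (fun j => Y' j = X i) ∪ (S.filter (fun j => Y' j = Z i) ∪
    S.filter (fun j => Y' j = X' i)))))
  have h4 := Finset.card_union_le (S.filter (fun j => Y j = X i))
    (S.filter (fun j => Y j = Y i) ∪ (S.filter (fun j => Y' j = X i) ∪
    (S.filter (fun j => Y' j = Z i) ∪ S.filter (fun j => Y' j = X' i))))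
  have h5 := Finset.card_union_le (S.filter (fun j => Y j = Y i)) (S.filter (fun j => Y' j = X i) ∪
    (S.filter (fun j => Y' j = Z i) ∪ S.filter (fun j => Y' j = X' i)))
  have h6 := Finset.card_union_le (S.filter (fun j => Y' j = X i))
    (S.filter (fun j => Y' j = Z i) ∪ S.filter (fun j => Y' j = X' i))
  have h7 := Finset.card_union_le (S.filter (fun j => Y' j = Z i))
    (S.filter (fun j => Y' j = X' i))
  have h8 := hY (Z i)
  have h9 := hY (X i)
  have h10 := hY (Y i)
  have h11 := hY' (X i)
  have h12 := hY' (Z i)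
  have h13 := hY' (X' i)
  rw [Finset.card_singleton] at h2
  omega

theorem exists_isCherry {a x y : V} (ha : G.degree a = 3) (hx : x ∈ degreeTwoNeighbors G a)
    (hy : y ∈ degreeTwoNeighbors G a) (hxy : x ≠ y) :
    ∃ z x' y', IsCherry G a x y z x' y' := by
  rw [mem_degreeTwoNeighbors] at hx hy
  obtain ⟨x', hx', hxa⟩ := exists_ne_of_degree_eq_two (a := a) hx.2
  obtain ⟨y', hy', hya⟩ := exists_ne_of_degree_eq_two (a := a) hy.2
  have h1 : #(((G.neighborFinset a).erase x).erase y) = 1 := by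
    rw [Finset.card_erase_of_mem, Finset.card_erase_of_mem, G.card_neighborFinset_eq_degree, ha]
    · simpa using hx.1
    · simpa using ⟨hxy.symm, hy.1⟩
  obtain ⟨z, hz⟩ := Finset.card_eq_one.1 h1
  have hz' : ∀ w, w ≠ y ∧ w ≠ x ∧ G.Adj a w ↔ w = z := fun w => by
    simpa using (Finset.ext_iff.1 hz) w
  obtain ⟨h2, h3, h4⟩ := (hz' z).2 rfl
  exact ⟨z, x', y', hx.1, hy.1, h4, hxy, h3.symm, h2.symm, fun w hw => by
    have := hz' w; tauto, ha, hx.2, hy.2, hx', hy', hxa, hya⟩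

/-- An ordered pair of degree-two neighbours at a vertex of degree three is a cherry. Without
vertices of huge degree its three colours are distinct, so there are 24 colour triples with at most
10 centres each. -/
theorem IsRainbowLinked.sum_cherries_le (h : IsRainbowLinked G col)
    (hbig : ∀ w, G.degree w + 5 < Fintype.card V) :
    ∑ a with G.degree a = 3, #(degreeTwoNeighbors G a).offDiag ≤ 240 := by
  classical
  let T : Finset (Fin 4 × Fin 4 × Fin 4) :=
    {τ | τ.1 ≠ τ.2.1 ∧ τ.1 ≠ τ.2.2 ∧ τ.2.1 ≠ τ.2.2}
  let R : V → Fin 4 × Fin 4 × Fin 4 → Prop := fun a τ => ∃ x y z x' y', IsCherry G a x y z x' y' ∧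
    col s(a, x) = τ.1 ∧ col s(a, y) = τ.2.1 ∧ col s(a, z) = τ.2.2
  have hne : ∀ {a x y z x' y' : V}, IsCherry G a x y z x' y' → col s(a, x) ≠ col s(a, y) ∧
      col s(a, x) ≠ col s(a, z) ∧ col s(a, y) ≠ col s(a, z) := by
    intro a x y z x' y' hc
    refine ⟨hc.col_ne h, fun h1 => ?_, fun h1 => ?_⟩
    · have := hc.card_le_degree_add (by simp) h h1
      have := hbig y'
      omega
    · have := hc.swap.card_le_degree_add (by simp) h h1
      have := hbig x'
      omega
  calc ∑ a with G.degree a = 3, #(degreeTwoNeighbors G a).offDiag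
      ≤ ∑ a with G.degree a = 3, #{τ ∈ T | R a τ} := by
        refine Finset.sum_le_sum fun a ha => ?_
        have ha := (Finset.mem_filter.1 ha).2
        have : Nonempty V := ⟨a⟩
        have key : ∀ x y, x ∈ degreeTwoNeighbors G a → y ∈ degreeTwoNeighbors G a → x ≠ y →
            ∃ z x' y', IsCherry G a x y z x' y' := fun x y => exists_isCherry ha
        choose! Z X' Y' hC using key
        refine Finset.card_le_card_of_injOn
          (fun xy => (col s(a, xy.1), col s(a, xy.2), col s(a, Z xy.1 xy.2))) ?_ ?_
        · rintro ⟨x, y⟩ hxy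
          rw [Finset.mem_coe, Finset.mem_offDiag] at hxy
          have hc := hC x y hxy.1 hxy.2.1 hxy.2.2
          rw [Finset.mem_coe, Finset.mem_filter]
          exact ⟨Finset.mem_filter.2 ⟨Finset.mem_univ _, hne hc⟩, x, y, _, _, _, hc, rfl, rfl, rfl⟩
        -- At a fixed centre the three edges have distinct colours, so the triple recovers `x` and
        -- `y`.
        · rintro ⟨x, y⟩ hxy ⟨x₁, y₁⟩ hxy₁ heq
          rw [Finset.mem_coe, Finset.mem_offDiag] at hxy hxy₁
          have hc := hC x y hxy.1 hxy.2.1 hxy.2.2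
          have hc₁ := hC x₁ y₁ hxy₁.1 hxy₁.2.1 hxy₁.2.2
          simp only [Prod.mk.injEq] at heq
          obtain ⟨e1, e2, e3⟩ := heq
          obtain ⟨n1, n2, n3⟩ := hne hc
          have hx : x = x₁ := by
            rcases hc.eq_of_adj _ hc₁.adj_x with h1 | h1 | h1
            · exact h1.symm
            · rw [h1] at e1; exact absurd e1 n1
            · rw [h1] at e1; exact absurd e1 n2
          have hy : y = y₁ := by
            rcases hc.eq_of_adj _ hc₁.adj_y with h1 | h1 | h1
            · rw [h1] at e2; exact absurd e2 n1.symm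
            · exact h1.symm
            · rw [h1] at e2; exact absurd e2 n3
          rw [hx, hy]
    _ ≤ ∑ a, #{τ ∈ T | R a τ} := Finset.sum_le_sum_of_subset (Finset.filter_subset _ _)
    _ = ∑ τ ∈ T, #{a | R a τ} := Finset.sum_card_bipartiteAbove_eq_sum_card_bipartiteBelow R
    _ ≤ ∑ τ ∈ T, 10 := by
        refine Finset.sum_le_sum fun τ hτ => ?_
        have hτ := (Finset.mem_filter.1 hτ).2
        have := h.card_cherry_le hτ.2.1 hτ.2.2
        convert this
    _ = 240 := by
        rw [Finset.sum_const, smul_eq_mul, show #T = 24 by decide]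

theorem sum_degreeTwoNeighbors_le :
    ∑ x with G.degree x = 2, #(degreeTwoNeighbors G x) ≤
      2 * #{e ∈ G.edgeFinset | ∀ v ∈ e, G.degree v = 2} := by
  rw [← Finset.card_sigma]
  refine Finset.card_le_mul_card_image_of_maps_to
    (f := fun xy : (_ : V) × V => s(xy.1, xy.2)) ?_ 2 ?_
  · rintro ⟨x, y⟩ hxy
    rw [Finset.mem_sigma, Finset.mem_filter, mem_degreeTwoNeighbors] at hxy
    simpa using ⟨hxy.2.1, hxy.1.2, hxy.2.2⟩
  · intro e _
    induction e with
    | h x y =>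
      refine (Finset.card_le_card (t := {⟨x, y⟩, ⟨y, x⟩}) ?_).trans Finset.card_le_two
      rintro ⟨a, b⟩ hab
      have h1 := Sym2.eq_iff.1 (Finset.mem_filter.1 hab).2
      simp only [Finset.mem_insert, Finset.mem_singleton]
      rcases h1 with ⟨rfl, rfl⟩ | ⟨rfl, rfl⟩ <;> simp

/-- Let a vertex of degree d ≠ 2 have k neighbours of degree two. Then 2k + 16 ≤ 6d if d ≥ 4; for d
= 3 this holds after adding k(k - 1), because (k - 1)(k - 2) ≥ 0. The added terms total at most 240.
The k sum to at least 2n₂ - 24, since at most 12 edges join vertices of degree two, and n₂ then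
cancels. -/
theorem IsRainbowLinked.sixteen_mul_le (h : IsRainbowLinked G col) [Nontrivial V]
    (hbig : ∀ w, G.degree w + 5 < Fintype.card V) :
    16 * Fintype.card V ≤ 12 * #G.edgeFinset + 288 := by
  have h1 := h.sum_cherries_le hbig
  have h2 := (sum_degreeTwoNeighbors_le (G := G)).trans (Nat.mul_le_mul_left 2 h.card_inner_le)
  rw [Fintype.card_fin] at h2
  have hT : ∑ x with G.degree x = 2, (#(degreeTwoNeighbors G x) +
      #{y ∈ G.neighborFinset x | ¬ G.degree y = 2}) = ∑ x with G.degree x = 2, 2 := by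
    refine Finset.sum_congr rfl fun x hx => ?_
    rw [degreeTwoNeighbors, Finset.card_filter_add_card_filter_not, G.card_neighborFinset_eq_degree]
    exact (Finset.mem_filter.1 hx).2
  have hdc : ∑ x with G.degree x = 2, #{y ∈ G.neighborFinset x | ¬ G.degree y = 2} =
      ∑ w with ¬ G.degree w = 2, #(degreeTwoNeighbors G w) := by
    have := Finset.sum_card_bipartiteAbove_eq_sum_card_bipartiteBelow
      (s := ({v | G.degree v = 2} : Finset V)) (t := ({v | ¬ G.degree v = 2} : Finset V)) G.Adj
    convert this using 3 with x hx w hw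
    · ext y; simp [Finset.bipartiteAbove, and_comm]
    · ext y; simp [Finset.bipartiteBelow, degreeTwoNeighbors, G.adj_comm, and_comm]
  have hS : ∑ w with ¬ G.degree w = 2, (2 * #(degreeTwoNeighbors G w) + 16) ≤
      ∑ w with ¬ G.degree w = 2, (6 * G.degree w +
        if G.degree w = 3 then #(degreeTwoNeighbors G w).offDiag else 0) := by
    refine Finset.sum_le_sum fun w hw => ?_
    have hw := (Finset.mem_filter.1 hw).2
    have h3 := h.two_le_degree w
    have h4 : #(degreeTwoNeighbors G w) ≤ G.degree w := by
      rw [← G.card_neighborFinset_eq_degree]; exact Finset.card_filter_le _ _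
    split_ifs with h5
    · rw [Finset.offDiag_card]
      rw [h5] at h4 ⊢
      generalize #(degreeTwoNeighbors G w) = k at *
      interval_cases k <;> omega
    · omega
  have hQ : ∑ w with ¬ G.degree w = 2, (if G.degree w = 3 then
      #(degreeTwoNeighbors G w).offDiag else 0) ≤
      ∑ a with G.degree a = 3, #(degreeTwoNeighbors G a).offDiag := by
    rw [Finset.sum_filter (fun a => G.degree a = 3)]
    exact Finset.sum_le_sum_of_subset (Finset.filter_subset _ _)
  have hdeg := G.sum_degrees_eq_twice_card_edges
  rw [← Finset.sum_filter_add_sum_filter_not univ (fun v => G.degree v = 2)] at hdeg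
  have hd2 : ∑ x with G.degree x = 2, G.degree x = ∑ x with G.degree x = 2, 2 :=
    Finset.sum_congr rfl fun x hx => (Finset.mem_filter.1 hx).2
  have hn := Finset.card_filter_add_card_filter_not (s := (univ : Finset V))
    (fun v => G.degree v = 2)
  rw [Finset.card_univ] at hn
  rw [Finset.sum_add_distrib, Finset.sum_const, smul_eq_mul] at hT
  rw [Finset.sum_add_distrib, Finset.sum_add_distrib, ← Finset.mul_sum, ← Finset.mul_sum,
    Finset.sum_const, smul_eq_mul] at hS
  rw [Finset.sum_const, smul_eq_mul] at hd2
  omega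

end

theorem four_mul_le_three_mul_t {n : ℕ} (hn : 18 ≤ n) : 4 * n ≤ 3 * t 2 n 4 + 72 := by
  classical
  obtain ⟨G, col, h, he⟩ :=
    exists_isRainbowLinked (by omega) (t_mem_edgeCounts (by omega : 4 ≤ n) (by norm_num : 2 ≤ 4))
  have hnt : Nontrivial (Fin n) := Fin.nontrivial_iff_two_le.2 (by omega)
  rw [← he, Set.ncard_eq_toFinset_card']
  change 4 * n ≤ 3 * #G.edgeFinset + 72
  by_cases hbig : ∀ w, G.degree w + 5 < Fintype.card (Fin n)
  · have := h.sixteen_mul_le hbig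
    rw [Fintype.card_fin] at this
    omega
  -- One degree is at least n - 5 and the others are at least 2, so twice the number of edges is at
  -- least 3n - 7.
  · push Not at hbig
    obtain ⟨w, hw⟩ := hbig
    rw [Fintype.card_fin] at hw
    have h1 : ∑ v ∈ univ.erase w, 2 ≤ ∑ v ∈ univ.erase w, G.degree v :=
      Finset.sum_le_sum fun v _ => h.two_le_degree v
    have h2 := Finset.add_sum_erase univ (fun v => G.degree v) (Finset.mem_univ w)
    rw [G.sum_degrees_eq_twice_card_edges] at h2
    rw [Finset.sum_const, Finset.card_erase_of_mem (Finset.mem_univ w), Finset.card_univ,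
      Fintype.card_fin, smul_eq_mul] at h1
    omega

end RainbowConnection

namespace RainbowConnection
open SimpleGraph Finset

/-! ### Graphs with few vertices of degree greater than two -/

theorem eq_or_eq_of_mem_support {V : Type*} {G : SimpleGraph V} {u v x : V} {p : G.Walk u v}
    (hp : p.IsPath) (h : s(u, v) ∈ p.edges) (hx : x ∈ p.support) : x = u ∨ x = v := by
  by_contra! hcon
  obtain ⟨y, z, -, hy, -⟩ := exists_mem_edges_pair hp hx hcon.1 hcon.2
  rw [edges_eq_singleton hp h, List.mem_singleton, Sym2.eq_iff] at hy
  rcases hy with h1 | h1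
  · exact hcon.1 h1.1
  · exact hcon.2 h1.1

section

variable {V K : Type*} [Fintype V] {G : SimpleGraph V} [DecidableRel G.Adj] {col : Sym2 V → K}

/-- Once a path meets `W`, it is forced along it through vertices of degree at most two. -/
theorem edges_subset_of_mem_support {u v : V} {p : G.Walk u v} (hp : p.IsPath) {x t : V}
    (W : G.Walk x t) (hW : W.IsPath) (hx : x ∈ p.support)
    (h : ∀ y ∈ W.support, y ≠ t → G.degree y ≤ 2 ∧ y ≠ u ∧ y ≠ v) :
    ∀ e ∈ W.edges, e ∈ p.edges := by
  induction W with
  | nil => simp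
  | cons hxy W ih =>
    rename_i x y t
    rw [Walk.cons_isPath_iff] at hW
    have hxt : x ≠ t := by
      rintro rfl
      exact hW.2 W.end_mem_support
    obtain ⟨h1, h2, h3⟩ := h x (by simp) hxt
    have h4 := mem_edges_of_degree_le_two hp hx h2 h3 h1 hxy
    intro e he
    rw [Walk.edges_cons, List.mem_cons] at he
    rcases he with rfl | he
    · exact h4
    · exact ih hW.1 (p.snd_mem_support_of_mem_edges h4) (fun z hz => h z (by simp [hz])) e he

theorem IsRainbowPair.edges_subset {s t x : V} {p q : G.Walk s t} (h : IsRainbowPair col p q)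
    (hst : s ≠ t) (W : G.Walk s x) (hW : W.IsPath)
    (hd : ∀ y ∈ W.support, y ≠ x → G.degree y ≤ 2 ∧ y ≠ t) :
    (∀ e ∈ W.edges, e ∈ p.edges) ∨ ∀ e ∈ W.edges, e ∈ q.edges := by
  cases W with
  | nil => simp
  | cons hsy W =>
    rename_i y
    rw [Walk.cons_isPath_iff] at hW
    have hsx : s ≠ x := by
      rintro rfl
      exact hW.2 W.end_mem_support
    have hd' : ∀ z ∈ W.support, z ≠ x → G.degree z ≤ 2 ∧ z ≠ s ∧ z ≠ t := by
      intro z hz hzx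
      obtain ⟨h1, h2⟩ := hd z (by simp [hz]) hzx
      exact ⟨h1, fun h3 => hW.2 (h3 ▸ hz), h2⟩
    have key : ∀ {r : G.Walk s t}, r.IsPath → s(s, y) ∈ r.edges →
        ∀ e ∈ (Walk.cons hsy W).edges, e ∈ r.edges := by
      intro r hr hm e he
      rw [Walk.edges_cons, List.mem_cons] at he
      rcases he with rfl | he
      · exact hm
      · exact edges_subset_of_mem_support hr W hW.1 (r.snd_mem_support_of_mem_edges hm) hd' e he
    rcases h.mem_edges_start hst (hd s (by simp) hsx).1 hsy with h1 | h1
    · exact .inl (key h.1 h1)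
    · exact .inr (key h.2 h1)

/-- A path all of whose vertices but one have degree two is rainbow. -/
theorem IsRainbowLinked.injOn_of_degree_le_two (h : IsRainbowLinked G col) {s t a : V}
    (W : G.Walk s t) (hW : W.IsPath) (hd : ∀ y ∈ W.support, y ≠ a → G.degree y ≤ 2) :
    ∀ e ∈ W.edges, ∀ f ∈ W.edges, col e = col f → e = f := by
  classical
  by_cases hst : s = t
  · subst hst
    rw [Walk.eq_nil_iff_nil.2 (Walk.isPath_iff_nil.1 hW)]
    simp
  obtain ⟨p, q, hpq⟩ := h s t hst
  suffices hsub : (∀ e ∈ W.edges, e ∈ p.edges) ∨ ∀ e ∈ W.edges, e ∈ q.edges by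
    rcases hsub with hs | hs
    · exact fun e he f hf => hpq.left_inj e (hs e he) f (hs f hf)
    · exact fun e he f hf => hpq.right_inj e (hs e he) f (hs f hf)
  -- The degree condition may fail only at `a`. If `a` is an end of `W` or not on it, `W` is
  -- followed by one path of the pair; otherwise `W` is split at `a`.
  by_cases has : a = s
  · subst has
    have := hpq.reverse.edges_subset (Ne.symm hst) W.reverse hW.reverse
      (fun y hy hys => ⟨hd y (by simpa using hy) hys, hys⟩)
    simpa using this
  by_cases hat : a ∈ W.support ∧ a ≠ t
  · obtain ⟨ha, hat⟩ := hat
    have hW' := W.take_spec ha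
    have htake := hW.takeUntil ha
    have hdrop := hW.dropUntil ha
    have h1 := hpq.edges_subset hst (W.takeUntil a ha) htake fun y hy hya =>
      ⟨hd y (W.support_takeUntil_subset_support ha hy) hya, fun hyt => by
        subst hyt
        exact Walk.endpoint_notMem_support_takeUntil hW ha (Ne.symm hat) hy⟩
    have h2 := hpq.reverse.edges_subset (Ne.symm hst) (W.dropUntil a ha).reverse hdrop.reverse
      fun y hy hya => by
        rw [Walk.support_reverse, List.mem_reverse] at hy
        rw [← hW'] at hW
        exact ⟨hd y (W.support_dropUntil_subset_support ha hy) hya, fun hys =>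
          hW.ne_of_mem_support_of_append hya (Walk.start_mem_support _) hy hys.symm⟩
    simp only [Walk.edges_reverse, List.mem_reverse] at h2
    have hne1 : ∃ e ∈ (W.takeUntil a ha).edges, a ∈ e := by
      obtain ⟨y, hy⟩ := exists_mem_edges_start has (W.takeUntil a ha).reverse
      exact ⟨_, by simpa using hy, by simp⟩
    have hne2 : ∃ e ∈ (W.dropUntil a ha).edges, a ∈ e := by
      obtain ⟨y, hy⟩ := exists_mem_edges_start hat (W.dropUntil a ha)
      exact ⟨_, hy, by simp⟩
    obtain ⟨e1, he1, hae1⟩ := hne1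
    obtain ⟨e2, he2, hae2⟩ := hne2
    -- The two halves of `W` follow the same path of the pair, since `a` cannot be an inner vertex
    -- of both.
    have hcross : ∀ e f, e ∈ p.edges → f ∈ q.edges → a ∈ e → a ∈ f → False := by
      intro e f he hf hae haf
      rcases hpq.disjoint a (p.mem_support_of_mem_edges he hae)
        (q.mem_support_of_mem_edges hf haf) with h3 | h3
      · exact has h3
      · exact hat h3
    have hsplit : ∀ e ∈ W.edges, e ∈ (W.takeUntil a ha).edges ∨ e ∈ (W.dropUntil a ha).edges := by
      intro e he
      rw [← hW', Walk.edges_append, List.mem_append] at he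
      exact he
    rcases h1 with h1 | h1 <;> rcases h2 with h2 | h2
    · exact .inl fun e he => (hsplit e he).elim (h1 e) (h2 e)
    · exact (hcross _ _ (h1 _ he1) (h2 _ he2) hae1 hae2).elim
    · exact (hcross _ _ (h2 _ he2) (h1 _ he1) hae2 hae1).elim
    · exact .inr fun e he => (hsplit e he).elim (h1 e) (h2 e)
  · refine hpq.edges_subset hst W hW fun y hy hyt => ⟨hd y hy ?_, hyt⟩
    rintro rfl
    exact hat ⟨hy, hyt⟩

/-- `B` is empty or a single vertex. If the edges lie on different paths between `u` and `v`, one of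
these paths avoids `B` and can be prolonged by the missing edge. The result has at most `a` as a
vertex of degree above two, so it is rainbow. -/
theorem IsRainbowLinked.col_ne_of_subsingleton (h : IsRainbowLinked G col) {a : V} {B : Set V}
    (hB : B.Subsingleton) (hd : ∀ v, v ≠ a → v ∉ B → G.degree v ≤ 2) {u v x y : V} (huv : u ≠ v)
    (hua : u ≠ a) (hva : v ≠ a) (huB : u ∉ B) (hvB : v ∉ B) (hxB : x ∉ B) (hyB : y ∉ B)
    (hux : G.Adj u x) (hvy : G.Adj v y) (hne : s(u, x) ≠ s(v, y)) :
    col s(u, x) ≠ col s(v, y) := by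
  obtain ⟨p, q, hpq, hp⟩ := h.exists_mem_left huv (hd u hua huB) hux
  rcases hpq.mem_edges_end huv (hd v hva hvB) hvy with hf | hf
  · exact fun hc => hne (hpq.left_inj _ hp _ hf hc)
  have hxp := p.snd_mem_support_of_mem_edges hp
  have hyq := q.snd_mem_support_of_mem_edges hf
  by_cases hcase : (∃ b ∈ B, b ∈ p.support) ∨ y = u
  · have hxq : x ∉ q.support := by
      intro hxq
      rcases hpq.disjoint x hxp hxq with rfl | rfl
      · exact hux.ne rfl
      · rcases hcase with ⟨b, hb, hbp⟩ | rfl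
        · rcases eq_or_eq_of_mem_support hpq.1 hp hbp with rfl | rfl
          · exact huB hb
          · exact hxB hb
        · exact hne Sym2.eq_swap
    have hqB : ∀ b ∈ B, b ∉ q.support := by
      intro b hb hbq
      rcases hcase with ⟨b', hb', hbp⟩ | rfl
      · obtain rfl := hB hb hb'
        rcases hpq.disjoint b hbp hbq with rfl | rfl
        · exact huB hb
        · exact hvB hb
      · rcases eq_or_eq_of_mem_support hpq.2 (by rwa [Sym2.eq_swap]) hbq with rfl | rfl
        · exact huB hb
        · exact hvB hb
    have hW := h.injOn_of_degree_le_two (a := a) (Walk.cons hux.symm q)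
      (by rw [Walk.cons_isPath_iff]; exact ⟨hpq.2, hxq⟩) (fun z hz hza => by
        rw [Walk.support_cons, List.mem_cons] at hz
        refine hd z hza ?_
        rcases hz with rfl | hz
        · exact hxB
        · exact fun hzB => hqB z hzB hz)
    intro hc
    exact hne (hW _ (by simp [Sym2.eq_swap]) _ (by simp [hf]) hc)
  · push Not at hcase
    obtain ⟨hpB, hyu⟩ := hcase
    have hyp : y ∉ p.support := by
      intro hyp
      rcases hpq.disjoint y hyp hyq with rfl | rfl
      · exact hyu rfl
      · exact hvy.ne rfl
    have hW := h.injOn_of_degree_le_two (a := a) (Walk.cons hvy.symm p.reverse)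
      (by rw [Walk.cons_isPath_iff]; exact ⟨hpq.1.reverse, by simpa using hyp⟩) (fun z hz hza => by
        rw [Walk.support_cons, List.mem_cons] at hz
        refine hd z hza ?_
        rcases hz with rfl | hz
        · exact hyB
        · exact fun hzB => hpB z hzB (by simpa using hz))
    intro hc
    exact hne (hW _ (by simp [hp]) _ (by simp [Sym2.eq_swap]) hc)

/-- Distinct edges avoiding `B` have distinct colours. -/
theorem IsRainbowLinked.eq_of_col_eq (h : IsRainbowLinked G col) {a : V} {B : Set V}
    (hB : B.Subsingleton) (hd : ∀ v, v ≠ a → v ∉ B → G.degree v ≤ 2) {e f : Sym2 V}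
    (he : e ∈ G.edgeSet) (hf : f ∈ G.edgeSet) (heB : ∀ v ∈ e, v ∉ B) (hfB : ∀ v ∈ f, v ∉ B)
    (hc : col e = col f) : e = f := by
  by_contra hne
  -- Distinct edges have distinct ends `u` and `v` other than `a`.
  have key : ∃ u x v y, e = s(u, x) ∧ f = s(v, y) ∧ u ≠ v ∧ u ≠ a ∧ v ≠ a := by
    induction e with
    | h x y =>
      induction f with
      | h z w =>
        have h1 : x ≠ y := G.ne_of_adj he
        have h2 : z ≠ w := G.ne_of_adj hf
        by_cases hx : x ≠ a ∧ ((z ≠ a ∧ z ≠ x) ∨ (w ≠ a ∧ w ≠ x))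
        · obtain ⟨hx, hz | hw⟩ := hx
          · exact ⟨x, y, z, w, rfl, rfl, hz.2.symm, hx, hz.1⟩
          · exact ⟨x, y, w, z, rfl, Sym2.eq_swap, hw.2.symm, hx, hw.1⟩
        · have hy : y ≠ a ∧ ((z ≠ a ∧ z ≠ y) ∨ (w ≠ a ∧ w ≠ y)) := by
            rw [Sym2.eq_iff] at hne
            grind
          obtain ⟨hx, hz | hw⟩ := hy
          · exact ⟨y, x, z, w, Sym2.eq_swap, rfl, hz.2.symm, hx, hz.1⟩
          · exact ⟨y, x, w, z, Sym2.eq_swap, Sym2.eq_swap, hw.2.symm, hx, hw.1⟩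
  obtain ⟨u, x, v, y, rfl, rfl, huv, hu, hv⟩ := key
  exact h.col_ne_of_subsingleton hB hd huv hu hv (heB u (by simp)) (hfB v (by simp))
    (heB x (by simp)) (hfB y (by simp)) he hf hne hc

end

end RainbowConnection

/-! ### Lower bounds with n - 1 and n - 2 colours -/

namespace RainbowConnection
open SimpleGraph Finset

theorem exists_mem_edges_of_mem_support {V : Type*} {G : SimpleGraph V} {u v x : V} {p : G.Walk u v} (hp : p.IsPath)
    (hx : x ∈ p.support) (hu : x ≠ u) : ∃ y, s(x, y) ∈ p.edges := by
  by_cases hv : x = v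
  · subst hv
    obtain ⟨y, hy⟩ := exists_mem_edges_start hu p.reverse
    exact ⟨y, by simpa using hy⟩
  · obtain ⟨y, -, -, hy, -⟩ := exists_mem_edges_pair hp hx hu hv
    exact ⟨y, hy⟩

/-- A path through `a` and `b` avoiding the edge `ab` has three edges meeting `a` or `b`. -/
theorem exists_three_edges {V : Type*} {G : SimpleGraph V} [DecidableEq V] {a b u w : V} (hab : a ≠ b) {q : G.Walk u w} (hq : q.IsPath)
    (ha : a ∈ q.support) (hb : b ∈ q.support) (hua : u ≠ a) (hub : u ≠ b) (hwb : w ≠ b)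
    (hg : s(a, b) ∉ q.edges) : ∃ D : Finset (Sym2 V), #D = 3 ∧ (∀ f ∈ D, f ∈ q.edges) ∧
      ∀ f ∈ D, a ∈ f ∨ b ∈ f := by
  obtain ⟨y, z, hyz, hy, hz⟩ := exists_mem_edges_pair hq hb hub.symm hwb.symm
  obtain ⟨x, hx⟩ := exists_mem_edges_of_mem_support hq ha hua.symm
  have hxb : x ≠ b := by rintro rfl; exact hg hx
  refine ⟨{s(a, x), s(b, y), s(b, z)}, Finset.card_eq_three.2 ⟨_, _, _, ?_, ?_, ?_, rfl⟩, ?_, ?_⟩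
  · simp only [ne_eq, Sym2.eq_iff]; tauto
  · simp only [ne_eq, Sym2.eq_iff]; tauto
  · exact fun h1 => hyz (Sym2.congr_right.1 h1)
  · simp only [Finset.mem_insert, Finset.mem_singleton]
    rintro f (rfl | rfl | rfl) <;> assumption
  · simp only [Finset.mem_insert, Finset.mem_singleton]
    rintro f (rfl | rfl | rfl) <;> simp

section

variable {V K : Type*} [Fintype V] {G : SimpleGraph V} [DecidableRel G.Adj] {col : Sym2 V → K}

theorem IsRainbowLinked.card_edgeFinset_le [DecidableEq V] [Fintype K] (h : IsRainbowLinked G col)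
    {a : V} (hd : ∀ v, v ≠ a → G.degree v ≤ 2) : #G.edgeFinset ≤ Fintype.card K := by
  rw [← Finset.card_univ]
  refine Finset.card_le_card_of_injOn col (fun _ _ => Finset.mem_coe.2 (Finset.mem_univ _))
    fun e he f hf hc => ?_
  exact h.eq_of_col_eq (B := ∅) Set.subsingleton_empty (fun v hv _ => hd v hv)
    (mem_edgeFinset.1 he) (mem_edgeFinset.1 hf) (by simp) (by simp) hc

/-- If only `a` and `b` have degree greater than two, every cycle passes through `b`. -/
theorem IsRainbowLinked.mem_support_of_edge (h : IsRainbowLinked G col) {a b u w : V}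
    (hab : a ≠ b) (hd : ∀ v, v ≠ a → v ≠ b → G.degree v ≤ 2) (hua : u ≠ a) (hub : u ≠ b)
    {p q : G.Walk u w} (hpq : IsRainbowPair col p q) (hp : s(u, w) ∈ p.edges) : b ∈ q.support := by
  by_contra hb
  have huw : u ≠ w := (p.adj_of_mem_edges hp).ne
  -- If the cycle missed `b`, it could be left only through `a`. Then every path from `u` to `b`
  -- would pass through `a`, but two of them are internally disjoint.
  have hclosed : ∀ x y, x ∈ q.support → x ≠ a → G.Adj x y → y ∈ q.support := by
    intro x y hx hxa hxy
    have hxb : x ≠ b := by rintro rfl; exact hb hx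
    have hdx := hd x hxa hxb
    have hsing := edges_eq_singleton hpq.1 hp
    by_cases hxu : x = u
    · subst hxu
      rcases hpq.mem_edges_start huw hdx hxy with h1 | h1
      · rw [hsing, List.mem_singleton, Sym2.congr_right] at h1
        rw [h1]
        exact q.end_mem_support
      · exact q.snd_mem_support_of_mem_edges h1
    by_cases hxw : x = w
    · subst hxw
      rcases hpq.mem_edges_end huw hdx hxy with h1 | h1
      · rw [hsing, List.mem_singleton, Sym2.eq_swap, Sym2.congr_left] at h1
        rw [h1]
        exact q.start_mem_support
      · exact q.snd_mem_support_of_mem_edges h1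
    · exact q.snd_mem_support_of_mem_edges (mem_edges_of_degree_le_two hpq.2 hx hxu hxw hdx hxy)
  obtain ⟨p', q', hpq'⟩ := h u b hub
  have hmem : ∀ r : G.Walk u b, a ∈ r.support := by
    intro r
    obtain ⟨d, hdr, hd1, hd2⟩ := r.exists_boundary_dart {x | x ∈ q.support} q.start_mem_support hb
    by_contra hcon
    refine hd2 (hclosed _ _ hd1 ?_ d.adj)
    intro h1
    exact hcon (h1 ▸ r.dart_fst_mem_support_of_mem_darts hdr)
  rcases hpq'.disjoint a (hmem _) (hmem _) with h1 | h1
  · exact hua h1.symm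
  · exact hab h1

variable [DecidableEq V]

/-- The edges that meet neither `a` nor `b`. -/
def edgesAvoiding (G : SimpleGraph V) [DecidableRel G.Adj] (a b : V) : Finset (Sym2 V) :=
  {e ∈ G.edgeFinset | a ∉ e ∧ b ∉ e}

theorem mem_edgesAvoiding {a b : V} {e : Sym2 V} :
    e ∈ edgesAvoiding G a b ↔ e ∈ G.edgeSet ∧ a ∉ e ∧ b ∉ e := by
  simp [edgesAvoiding]

theorem card_edgeFinset_le_edgesAvoiding (a b : V) :
    #G.edgeFinset + #(G.incidenceFinset a ∩ G.incidenceFinset b) ≤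
      #(edgesAvoiding G a b) + (G.degree a + G.degree b) := by
  have h1 : G.edgeFinset ⊆ edgesAvoiding G a b ∪ (G.incidenceFinset a ∪ G.incidenceFinset b) := by
    intro e he
    rw [mem_edgeFinset] at he
    simp only [Finset.mem_union, mem_edgesAvoiding, mem_incidenceFinset, incidenceSet,
      Set.mem_ofPred_eq, he, true_and]
    tauto
  have h2 := (Finset.card_le_card h1).trans (Finset.card_union_le _ _)
  have h3 := Finset.card_union_add_card_inter (G.incidenceFinset a) (G.incidenceFinset b)
  rw [G.card_incidenceFinset_eq_degree, G.card_incidenceFinset_eq_degree] at h3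
  omega

variable [Fintype K]

/-- Edges that both miss `a`, or both miss `b`, have distinct colours by `eq_of_col_eq`. An edge of
`D` meets both only if it is `ab`, which `hchord` covers. -/
theorem IsRainbowLinked.card_add_card_le (h : IsRainbowLinked G col) {a b : V}
    (hab : a ≠ b) (hd : ∀ v, v ≠ a → v ≠ b → G.degree v ≤ 2) (D : Finset (Sym2 V)) (hDG : ∀ f ∈ D, f ∈ G.edgeSet)
    (hDab : ∀ f ∈ D, a ∈ f ∨ b ∈ f) (hD : ∀ e ∈ D, ∀ f ∈ D, col e = col f → e = f)
    (hchord : s(a, b) ∈ D → ∀ e ∈ edgesAvoiding G a b, col e ≠ col s(a, b)) :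
    #(edgesAvoiding G a b) + #D ≤ Fintype.card K := by
  have hdisj : Disjoint (edgesAvoiding G a b) D := by
    rw [Finset.disjoint_left]
    intro e he heD
    have := (mem_edgesAvoiding.1 he).2
    have := hDab e heD
    tauto
  have hB : ∀ {x : V} {e f : Sym2 V}, (x = a ∨ x = b) → e ∈ G.edgeSet → f ∈ G.edgeSet →
      x ∉ e → x ∉ f → col e = col f → e = f := by
    intro x e f hx he hf hxe hxf hc
    rcases hx with rfl | rfl
    · exact h.eq_of_col_eq (a := b) (B := {x}) Set.subsingleton_singleton
        (fun v hv hvx => hd v (by simpa using hvx) hv) he hf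
        (fun v hv hvx => hxe (by rwa [Set.mem_singleton_iff.1 hvx] at hv))
        (fun v hv hvx => hxf (by rwa [Set.mem_singleton_iff.1 hvx] at hv)) hc
    · exact h.eq_of_col_eq (a := a) (B := {x}) Set.subsingleton_singleton
        (fun v hv hvx => hd v hv (by simpa using hvx)) he hf
        (fun v hv hvx => hxe (by rwa [Set.mem_singleton_iff.1 hvx] at hv))
        (fun v hv hvx => hxf (by rwa [Set.mem_singleton_iff.1 hvx] at hv)) hc
  have hcross : ∀ e ∈ edgesAvoiding G a b, ∀ f ∈ D, col e = col f → e = f := by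
    intro e he f hf hc
    obtain ⟨heG, hea, heb⟩ := mem_edgesAvoiding.1 he
    by_cases hfa : a ∈ f
    · by_cases hfb : b ∈ f
      · rw [(Sym2.mem_and_mem_iff hab).1 ⟨hfa, hfb⟩] at hf hc
        exact absurd hc (hchord hf e he)
      · exact hB (.inr rfl) heG (hDG f hf) heb hfb hc
    · exact hB (.inl rfl) heG (hDG f hf) hea hfa hc
  rw [← Finset.card_union_of_disjoint hdisj, ← Finset.card_univ]
  refine Finset.card_le_card_of_injOn col (fun _ _ => Finset.mem_coe.2 (Finset.mem_univ _)) ?_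
  intro e he f hf hc
  rw [Finset.mem_coe, Finset.mem_union] at he hf
  rcases he with he | he <;> rcases hf with hf | hf
  · obtain ⟨heG, hea, -⟩ := mem_edgesAvoiding.1 he
    obtain ⟨hfG, hfa, -⟩ := mem_edgesAvoiding.1 hf
    exact hB (.inl rfl) heG hfG hea hfa hc
  · exact hcross e he f hf hc
  · exact (hcross f hf e he hc.symm).symm
  · exact hD e he f hf hc

/-- Let ε be 1 if `ab` is an edge and 0 otherwise. At least n - 5 + ε edges avoid `a` and `b`. A
rainbow path through both as inner vertices has at least 4 - ε edges meeting them. Together these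
edges have distinct colours, so at least n - 1 colours are needed. -/
theorem IsRainbowLinked.card_le_of_two_branch (h : IsRainbowLinked G col) {a b : V} (hab : a ≠ b)
    (hd : ∀ v, v ≠ a → v ≠ b → G.degree v = 2) (ha : G.degree a = 3) (hb : G.degree b = 3)
    (hV : 6 ≤ Fintype.card V) (he : #G.edgeFinset = Fintype.card V + 1) :
    Fintype.card V ≤ Fintype.card K + 1 := by
  have hd' : ∀ v, v ≠ a → v ≠ b → G.degree v ≤ 2 := fun v h1 h2 => (hd v h1 h2).le
  have hI := card_edgeFinset_le_edgesAvoiding (G := G) a b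
  rw [he, ha, hb] at hI
  have hchordI : s(a, b) ∈ G.edgeSet →
      1 ≤ #(G.incidenceFinset a ∩ G.incidenceFinset b) := by
    intro hg
    refine Finset.card_pos.2 ⟨s(a, b), ?_⟩
    simpa [incidenceSet] using hg
  have hne : (edgesAvoiding G a b).Nonempty := Finset.card_pos.1 (by omega)
  by_contra hcon
  -- the edge `ab`, if there is one, shares its colour with no edge that avoids `a` and `b`
  have hchord : s(a, b) ∈ G.edgeSet → ∀ e ∈ edgesAvoiding G a b, col e ≠ col s(a, b) := by
    intro hg e he'
    have hc1 := hchordI hg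
    obtain ⟨heG, hea, heb⟩ := mem_edgesAvoiding.1 he'
    induction e with
    | h u v =>
      have hua : u ≠ a := by rintro rfl; simp at hea
      have hub : u ≠ b := by rintro rfl; simp at heb
      obtain ⟨w, huw, hwv⟩ := exists_ne_of_degree_eq_two (a := v) (hd u hua hub)
      obtain ⟨p, q, hpq, hp⟩ := h.exists_mem_left huw.ne (hd' u hua hub) huw
      have heq : s(u, v) ∈ q.edges := by
        refine (hpq.mem_edges_start huw.ne (hd' u hua hub) heG).resolve_left fun h1 => ?_
        exact hwv (mem_edges_start_unique hpq.1 hp h1)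
      have hbq := h.mem_support_of_edge hab hd' hua hub hpq hp
      have haq := h.mem_support_of_edge hab.symm (fun v h1 h2 => hd' v h2 h1) hub hua hpq hp
      -- If `q` missed `ab`, it would have three edges at `a` or `b`. With the n - 4 edges avoiding
      -- both they would already need n - 1 colours.
      have hgq : s(a, b) ∈ q.edges := by
        by_contra hgq
        have hD : ∃ D : Finset (Sym2 V), #D = 3 ∧ (∀ f ∈ D, f ∈ q.edges) ∧
            ∀ f ∈ D, a ∈ f ∨ b ∈ f := by
          by_cases hwb : w = b
          · obtain ⟨D, h1, h2, h3⟩ := exists_three_edges hab.symm hpq.2 hbq haq hub hua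
              (fun h1 => hab (h1.symm.trans hwb)) (by rwa [Sym2.eq_swap])
            exact ⟨D, h1, h2, fun f hf => (h3 f hf).symm⟩
          · exact exists_three_edges hab hpq.2 haq hbq hua hub hwb hgq
        obtain ⟨D, h1, h2, h3⟩ := hD
        have := h.card_add_card_le hab hd' D (fun f hf => q.edges_subset_edgeSet (h2 f hf)) h3
          (fun e he f hf => hpq.right_inj e (h2 e he) f (h2 f hf))
          (fun hgD => absurd (h2 _ hgD) hgq)
        omega
      intro hc
      have := hpq.right_inj _ heq _ hgq hc
      rw [this] at hea
      simp at hea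
  obtain ⟨e, he'⟩ := hne
  obtain ⟨heG, hea, heb⟩ := mem_edgesAvoiding.1 he'
  induction e with
  | h u v =>
    have hua : u ≠ a := by rintro rfl; simp at hea
    have hub : u ≠ b := by rintro rfl; simp at heb
    have hva : v ≠ a := by rintro rfl; simp at hea
    have hvb : v ≠ b := by rintro rfl; simp at heb
    obtain ⟨p, q, hpq, hp⟩ := h.exists_mem_left (G.ne_of_adj heG) (hd' u hua hub) heG
    have hbq := h.mem_support_of_edge hab hd' hua hub hpq hp
    have haq := h.mem_support_of_edge hab.symm (fun v h1 h2 => hd' v h2 h1) hub hua hpq hp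
    obtain ⟨y, z, hyz, hy, hz⟩ := exists_mem_edges_pair hpq.2 haq hua.symm hva.symm
    obtain ⟨y', z', hyz', hy', hz'⟩ := exists_mem_edges_pair hpq.2 hbq hub.symm hvb.symm
    let D : Finset (Sym2 V) := {s(a, y), s(a, z)} ∪ {s(b, y'), s(b, z')}
    have hDq : ∀ f ∈ D, f ∈ q.edges := by
      simp only [D, Finset.mem_union, Finset.mem_insert, Finset.mem_singleton]
      rintro f ((rfl | rfl) | (rfl | rfl)) <;> assumption
    have hDab : ∀ f ∈ D, a ∈ f ∨ b ∈ f := by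
      simp only [D, Finset.mem_union, Finset.mem_insert, Finset.mem_singleton]
      rintro f ((rfl | rfl) | (rfl | rfl)) <;> simp
    have hK := h.card_add_card_le hab hd' D (fun f hf => q.edges_subset_edgeSet (hDq f hf)) hDab
      (fun e he f hf => hpq.right_inj e (hDq e he) f (hDq f hf))
      (fun hgD => hchord (q.edges_subset_edgeSet (hDq _ hgD)))
    have hDc := Finset.card_union_add_card_inter ({s(a, y), s(a, z)} : Finset (Sym2 V))
      {s(b, y'), s(b, z')}
    rw [Finset.card_pair (fun h1 => hyz (Sym2.congr_right.1 h1)),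
      Finset.card_pair (fun h1 => hyz' (Sym2.congr_right.1 h1))] at hDc
    have hinter : ({s(a, y), s(a, z)} ∩ {s(b, y'), s(b, z')} : Finset (Sym2 V)) ⊆
        G.incidenceFinset a ∩ G.incidenceFinset b ∩ {s(a, b)} := by
      intro f hf
      have hfq : f ∈ q.edges := hDq f (Finset.mem_union_left _ (Finset.mem_inter.1 hf).1)
      have hfG := q.edges_subset_edgeSet hfq
      simp only [Finset.mem_inter, Finset.mem_insert, Finset.mem_singleton] at hf
      have hfa : a ∈ f := by rcases hf.1 with h1 | h1 <;> simp [h1]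
      have hfb : b ∈ f := by rcases hf.2 with h1 | h1 <;> simp [h1]
      simp only [Finset.mem_inter, mem_incidenceFinset, incidenceSet, Set.mem_ofPred_eq,
        Finset.mem_singleton]
      exact ⟨⟨⟨hfG, hfa⟩, hfG, hfb⟩, (Sym2.mem_and_mem_iff hab).1 ⟨hfa, hfb⟩⟩
    have hi1 := Finset.card_le_card (hinter.trans Finset.inter_subset_left)
    change _ + #D ≤ _ at hK
    change #D + _ = _ at hDc
    omega

end

theorem IsRainbowLinked.sum_degree_sub_two {V K : Type*} [Fintype V] [Nontrivial V]
    {G : SimpleGraph V} [DecidableRel G.Adj] {col : Sym2 V → K} (h : IsRainbowLinked G col) :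
    ∑ v, (G.degree v - 2) + 2 * Fintype.card V = 2 * #G.edgeFinset := by
  classical
  rw [← G.sum_degrees_eq_twice_card_edges, mul_comm, ← smul_eq_mul, ← Finset.card_univ,
    ← Finset.sum_const, ← Finset.sum_add_distrib]
  exact Finset.sum_congr rfl fun v _ => Nat.sub_add_cancel (h.two_le_degree v)

/-- With at most n edges every degree is two, so all edges have distinct colours; but there are n
edges and only n - 1 colours. -/
theorem add_one_le_t {n : ℕ} (hn : 4 ≤ n) : n + 1 ≤ t 2 n (n - 1) := by
  classical
  obtain ⟨G, col, h, he⟩ :=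
    exists_isRainbowLinked (by omega) (t_mem_edgeCounts hn (by omega : 2 ≤ n - 1))
  have hnt : Nontrivial (Fin n) := Fin.nontrivial_iff_two_le.2 (by omega)
  rw [← he, Set.ncard_eq_toFinset_card']
  change n + 1 ≤ #G.edgeFinset
  have hsum := h.sum_degree_sub_two
  rw [Fintype.card_fin] at hsum
  by_contra hlt
  have h1 := h.card_edgeFinset_le (a := ⟨0, by omega⟩) fun v _ => by
    have := Finset.single_le_sum (f := fun v => G.degree v - 2) (fun _ _ => Nat.zero_le _)
      (Finset.mem_univ v)
    omega
  rw [Fintype.card_fin] at h1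
  omega

/-- With at most n + 1 edges the degrees exceed two by at most 2 in total. So either at most one
vertex has degree above two, and all edges differ in colour, or two vertices have degree three. -/
theorem add_two_le_t {n : ℕ} (hn : 6 ≤ n) : n + 2 ≤ t 2 n (n - 2) := by
  classical
  obtain ⟨G, col, h, he⟩ := exists_isRainbowLinked (by omega)
    (t_mem_edgeCounts (by omega : 4 ≤ n) (by omega : 2 ≤ n - 2))
  have hnt : Nontrivial (Fin n) := Fin.nontrivial_iff_two_le.2 (by omega)
  rw [← he, Set.ncard_eq_toFinset_card']
  change n + 2 ≤ #G.edgeFinset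
  have hsum := h.sum_degree_sub_two
  rw [Fintype.card_fin] at hsum
  by_contra hlt
  by_cases hone : ∃ a, ∀ v, v ≠ a → G.degree v ≤ 2
  · obtain ⟨a, ha⟩ := hone
    have h1 := h.card_edgeFinset_le ha
    rw [Fintype.card_fin] at h1
    omega
  push Not at hone
  obtain ⟨a, -, ha⟩ := hone ⟨0, by omega⟩
  obtain ⟨b, hba, hb⟩ := hone a
  have hle : ∀ s : Finset (Fin n), ∑ v ∈ s, (G.degree v - 2) ≤ ∑ v, (G.degree v - 2) := fun s =>
    Finset.sum_le_sum_of_subset (Finset.subset_univ s)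
  have hab := hle {a, b}
  rw [Finset.sum_pair hba.symm] at hab
  have hd : ∀ v, v ≠ a → v ≠ b → G.degree v = 2 := by
    intro v hva hvb
    have h1 := hle {v, a, b}
    rw [Finset.sum_insert (by simp [hva, hvb]), Finset.sum_pair hba.symm] at h1
    have h2 := h.two_le_degree v
    omega
  have h1 := h.card_le_of_two_branch hba.symm hd (by omega) (by omega) (by simpa using hn)
    (by rw [Fintype.card_fin]; omega)
  rw [Fintype.card_fin, Fintype.card_fin] at h1
  omega

end RainbowConnection

/-! ### Assembly of the four statements -/

theorem theoremt2 :
    -- the minimum defining `t 2 n r` is over a nonempty set in all cases considered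
    (∀ n r : ℕ, 4 ≤ n → 2 ≤ r → (RainbowConnection.edgeCounts 2 n r).Nonempty) ∧
    -- (a)
    Asymptotics.IsEquivalent Filter.atTop
      (fun n : ℕ => (RainbowConnection.t 2 n 2 : ℝ)) (fun n : ℕ => (n : ℝ) * Real.logb 2 n) ∧
    -- (b)
    (∀ n r : ℕ, (r = 3 ∨ r = 4) → 18 ≤ n →
      (4 / 3 : ℝ) * n - 24 ≤ RainbowConnection.t 2 n r) ∧
    (∀ n r : ℕ, 5 ≤ r → r + 1 ≤ n → (1 / 6 : ℝ) * r * (r - 1) < n →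
      (6 / 5 : ℝ) * n - (1 / 5 : ℝ) * r * (r - 1) ≤ RainbowConnection.t 2 n r) ∧
    -- (c)
    (∀ n r : ℕ, (r = 3 ∨ r = 4) → r + 1 ≤ n →
      (RainbowConnection.t 2 n r : ℝ) ≤ (5 / 2 : ℝ) * n - 5) ∧
    (∀ n : ℕ, 7 ≤ n → (RainbowConnection.t 2 n 5 : ℝ) ≤ (7 * n - 19) / 3) ∧
    (∀ n r : ℕ, 6 ≤ r → r + 3 ≤ n → (RainbowConnection.t 2 n r : ℝ) ≤ 2 * n - r + 2) ∧
    -- (d)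
    (∀ n : ℕ, 6 ≤ n → RainbowConnection.t 2 n (n - 2) = n + 2) ∧
    (∀ n : ℕ, 4 ≤ n → RainbowConnection.t 2 n (n - 1) = n + 1) := by
  open RainbowConnection in
  refine ⟨fun n r => edgeCounts_two_nonempty, isEquivalent_t_two, fun n r hr hn => ?_,
    fun n r hr hn _ => ?_, fun n r hr hn => ?_, fun n hn => ?_, fun n r hr hn => ?_,
    fun n hn => ?_, fun n hn => ?_⟩
  -- Three colours need at least as many edges as four.
  · have h1 : t 2 n 4 ≤ t 2 n r := t_anti (by omega) (by omega) (by omega)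
    have h2 := four_mul_le_three_mul_t hn
    have h3 : (4 * n : ℝ) ≤ 3 * t 2 n r + 72 := by exact_mod_cast (by omega)
    linarith
  · have h1 : ((6 * n : ℕ) : ℝ) ≤ ((5 * t 2 n r + r * (r - 1) : ℕ) : ℝ) :=
      Nat.cast_le.2 (six_mul_le_five_mul_t (by omega) (by omega))
    push_cast [Nat.cast_sub (by omega : 1 ≤ r)] at h1
    linarith
  · have h1 := t_le_five_halves (n := n) (r := r) (by omega) (by omega)
    have h2 : (2 * t 2 n r + 10 : ℝ) ≤ 5 * n := by exact_mod_cast (by omega)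
    linarith
  · have h1 := t_five_le_seven_thirds hn
    have h2 : (3 * t 2 n 5 + 19 : ℝ) ≤ 7 * n := by exact_mod_cast (by omega)
    linarith
  · have h1 : (t 2 n r + r : ℝ) ≤ 2 * n + 2 := by exact_mod_cast t_add_le_two_mul hr hn
    linarith
  · obtain ⟨m, rfl⟩ := Nat.exists_eq_add_of_le' (by omega : 5 ≤ n)
    exact le_antisymm (ColoredGraph.t_add_five_le m) (add_two_le_t hn)
  · obtain ⟨m, rfl⟩ := Nat.exists_eq_add_of_le' hn
    exact le_antisymm (ColoredGraph.t_add_three_le m) (add_one_le_t hn)
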